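/- **Setting.** Let $\mathcal H_s,\mathcal H_b$ be complex Hilbert spaces. Let $H_s$ and $H_b$ be (possibly unbounded) self-adjoint operators on $\mathcal H_s$ and $\mathcal H_b$, $W_s$ a bounded self-adjoint operator and $O_s$ a bounded operator on $\mathcal H_s$, and $W_b,\widetilde W_b$ (possibly unbounded) self-adjoint operators on $\mathcal H_b$. Let $H$ and $\widetilde H$ be self-adjoint operators on the Hilbert space tensor product $\mathcal H_s\otimes\mathcal H_b$ which realize $$H_s\otimes \mathrm{Id}+\mathrm{Id}\otimes H_b+W_s\otimes W_b\qquad\text{and}\qquad H_s\otimes \mathrm{Id}+\mathrm{Id}\otimes H_b+W_s\otimes \widetilde W_b,$$ that is, which extend these sums from the elementary tensors $x\otimes y$ with $x\in D(H_s)$ and $y\in D(H_b)\cap D(W_b)$ (respectively $y\in D(H_b)\cap D(\widetilde W_b)$). The initial state is $\rho(0)=\rho_s\otimes\rho_b$, where $\rho_s$ is a density operator on $\mathcal H_s$ and $\rho_b=Z_b^{-1}e^{-\beta H_b}$, $Z_b=\mathrm{tr}\,e^{-\beta H_b}$; here $\mathcal H_b$ has an orthonormal basis $(e_k)$ of eigenvectors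 of $H_b$, $H_be_k=\varepsilon_ke_k$, with $\sum_k e^{-\beta\varepsilon_k}<\infty$. Fix $t\ge 0$ and put $$\langle O(t)\rangle_B=\mathrm{tr}\big((O_s\otimes \mathrm{Id})\,e^{-itH}\rho(0)e^{itH}\big),\qquad \langle O(t)\rangle_{\widetilde B}=\mathrm{tr}\big((O_s\otimes \mathrm{Id})\,e^{-it\widetilde H}\rho(0)e^{it\widetilde H}\big),$$ and $\Delta\langle O(t)\rangle=\langle O(t)\rangle_{\widetilde B}-\langle O(t)\rangle_{B}$. **Bath correlations.** For $s_i\le s_f$ in $[0,2t]$ let $$G_b(s_f,s_i)=\begin{cases}e^{-i(s_f-s_i)H_b}, & s_f<t,\\ e^{-i(s_i-s_f)H_b}, & t\le s_i,\\ e^{-i(2t-s_i-s_f)H_b}, & s_i<t\le s_f,\end{cases}$$ and for $2t>s_m>\cdots>s_1>0$ let $$\mathcal L_b(s_m,\dots,s_1)=\mathrm{tr}_b\big(\rho_bG_b(2t,s_m)W_bG_b(s_m,s_{m-1})W_b\cdots W_bG_b(s_2,s_1)W_bG_b(s_1,0)\big),\qquad B(\tau_1,\tau_2)=\mathcal L_b(\tau_2,\tau_1),$$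 the trace being evaluated in the eigenbasis $(e_k)$. It is assumed that these traces are well defined: the operator products can be applied to each $e_k$, and the sums over $k$ converge absolutely. $\widetilde{\mathcal L}_b$ and $\widetilde B$ are defined in the same way from $\widetilde W_b$, under the same assumption, and $\Delta B=\widetilde B-B$. Assume that Wick's theorem holds for the bath: for all $m\ge 0$ and $2t>s_m>\cdots>s_1>0$, $$\mathcal L_b(s_m,\dots,s_1)=\sum_{\mathfrak q}\ \prod_{(j,k)\in\mathfrak q}B(s_j,s_k),$$ where $\mathfrak q$ runs over all partitions of $\{1,\dots,m\}$ into pairs $(j,k)$ with $j<k$ (so the right-hand side is $0$ for odd $m$ and $1$ for $m=0$), and likewise for $\widetilde{\mathcal L}_b$ and $\widetilde B$. **Theorem.** If $B$ and $\widetilde B$ are bounded on $\{0<\tau_1<\tau_2<2t\}$, then $$|\Delta\langle O(t)\rangle|\le \|O_s\|\left[\exp\left(\|W_s\|^2\int_0^{2t}\int_0^{s_2}|\Delta B(s_1,s_2)|\,ds_1\,ds_2\right)-1\right].$$ -/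

import Mathlib

open scoped TensorProduct

namespace OpenQuantum

noncomputable section

/-! ### Self-adjoint operators, the groups they generate, traces and density operators -/

/-- `H` is a (possibly unbounded) self-adjoint operator and `U τ = exp (-i τ H)`: the family `U` is
the strongly continuous one-parameter unitary group whose generator (with its exact domain) is
`-i H`. -/
structure IsEvolutionGroup {E : Type*} [NormedAddCommGroup E] [InnerProductSpace ℂ E]
    [CompleteSpace E] (H : E →ₗ.[ℂ] E) (U : ℝ → E →L[ℂ] E) : Prop where
  selfAdjoint : IsSelfAdjoint H
  unitary : ∀ τ, U τ ∈ unitary (E →L[ℂ] E)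
  zero : U 0 = 1
  add : ∀ σ τ, U (σ + τ) = U σ * U τ
  continuous : ∀ x, Continuous fun τ => U τ x
  generator : ∀ x y : E,
    (x, y) ∈ H.graph ↔ HasDerivAt (fun τ => U τ x) (-(Complex.I • y)) 0

/-- A fixed orthonormal (Hilbert) basis of a complex Hilbert space. -/
def hilbertBasisSet (E : Type*) [NormedAddCommGroup E] [InnerProductSpace ℂ E]
    [CompleteSpace E] : Set E :=
  (exists_hilbertBasis ℂ E).choose

/-- A fixed orthonormal (Hilbert) basis of a complex Hilbert space. -/
def stdHilbertBasis (E : Type*) [NormedAddCommGroup E] [InnerProductSpace ℂ E]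
    [CompleteSpace E] : HilbertBasis (hilbertBasisSet E) ℂ E :=
  (exists_hilbertBasis ℂ E).choose_spec.choose

/-- The trace `∑ i, ⟪b i, A (b i)⟫`. It is used for trace-class operators only, for which it does
not depend on the orthonormal basis `b`. -/
def trace {E : Type*} [NormedAddCommGroup E] [InnerProductSpace ℂ E] [CompleteSpace E]
    (A : E →L[ℂ] E) : ℂ :=
  ∑' i, inner ℂ (stdHilbertBasis E i) (A (stdHilbertBasis E i))

/-- A density operator: positive, trace class, of trace one. -/
structure IsDensityOperator {E : Type*} [NormedAddCommGroup E] [InnerProductSpace ℂ E]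
    [CompleteSpace E] (ρ : E →L[ℂ] E) : Prop where
  positive : ρ.IsPositive
  hasTrace_one :
    HasSum (fun i => inner ℂ (stdHilbertBasis E i) (ρ (stdHilbertBasis E i))) (1 : ℂ)

/-! ### The Hilbert space of the composite system -/

/-- The Hilbert space tensor product: the completion of the algebraic tensor product. -/
abbrev Joint (S K : Type*) [NormedAddCommGroup S] [InnerProductSpace ℂ S]
    [NormedAddCommGroup K] [InnerProductSpace ℂ K] : Type _ :=
  UniformSpace.Completion (S ⊗[ℂ] K)

section Joint

variable {S K : Type*} [NormedAddCommGroup S] [InnerProductSpace ℂ S]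
  [NormedAddCommGroup K] [InnerProductSpace ℂ K]

/-- The elementary tensor `x ⊗ y` as a vector of the Hilbert space tensor product. -/
def tens (x : S) (y : K) : Joint S K := ((x ⊗ₜ[ℂ] y : S ⊗[ℂ] K) : Joint S K)

/-- The bounded operator `A ⊗ B`, the continuous extension of `x ⊗ y ↦ A x ⊗ B y`. -/
def opTensor (A : S →L[ℂ] S) (B : K →L[ℂ] K) : Joint S K →L[ℂ] Joint S K :=
  ((UniformSpace.Completion.toComplL (𝕜 := ℂ) (E := S ⊗[ℂ] K)).comp
    (TensorProduct.mapL A B)).extend (UniformSpace.Completion.toComplL (𝕜 := ℂ) (E := S ⊗[ℂ] K))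

/-- `H` acts as `Hₛ ⊗ Id + Id ⊗ H_b + Wₛ ⊗ W_b` on all elementary tensors `x ⊗ y` for which the
three summands make sense. (Self-adjointness of `H` is demanded separately, so that `H` is a
self-adjoint realization of this sum.) -/
def ExtendsTotalHamiltonian (Hs : S →ₗ.[ℂ] S) (Hb Wb : K →ₗ.[ℂ] K) (Ws : S →L[ℂ] S)
    (H : Joint S K →ₗ.[ℂ] Joint S K) : Prop :=
  ∀ (x : S) (y : K) (hx : x ∈ Hs.domain) (hy : y ∈ Hb.domain) (hy' : y ∈ Wb.domain),
    (tens x y,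
      tens (Hs ⟨x, hx⟩) y + tens x (Hb ⟨y, hy⟩) + tens (Ws x) (Wb ⟨y, hy'⟩)) ∈ H.graph

/-- The expectation `⟨O(t)⟩ = tr (O e^{-itH} ρ(0) e^{itH})` of the observable `O = Oₛ ⊗ Id`, where
`U τ = e^{-iτH}` and `ρ₀ = ρ(0)`. -/
def expectation [CompleteSpace S] [CompleteSpace K] (U : ℝ → Joint S K →L[ℂ] Joint S K)
    (ρ₀ : Joint S K →L[ℂ] Joint S K) (Os : S →L[ℂ] S) (t : ℝ) : ℂ :=
  trace (opTensor Os 1 * U t * ρ₀ * U (-t))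

end Joint

/-! ### The thermal state of the bath -/

section Bath

variable {K ι : Type*} [NormedAddCommGroup K] [InnerProductSpace ℂ K]

/-- `e` is an orthonormal eigenbasis of `Hb` with energies `ε`, and `exp (-β Hb)` is trace class, so
that the thermal state at inverse temperature `β` exists. -/
structure HasThermalState (Hb : K →ₗ.[ℂ] K) (β : ℝ) (e : HilbertBasis ι ℂ K) (ε : ι → ℝ) :
    Prop where
  eigenvector : ∀ k, (e k, (ε k : ℂ) • e k) ∈ Hb.graph
  summable : Summable fun k => Real.exp (-β * ε k)

/-- The eigenvalue `Z⁻¹ exp (-β ε_k)` of the thermal state, with `Z = tr (exp (-β Hb))`. -/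
def thermalWeight (β : ℝ) (ε : ι → ℝ) (k : ι) : ℝ :=
  Real.exp (-β * ε k) / ∑' j, Real.exp (-β * ε j)

/-- The thermal state `ρ_b = Z⁻¹ exp (-β Hb)`, from the spectral decomposition of `Hb`. -/
def thermalState (β : ℝ) (e : HilbertBasis ι ℂ K) (ε : ι → ℝ) : K →L[ℂ] K :=
  ∑' k, (thermalWeight β ε k : ℂ) • InnerProductSpace.rankOne ℂ (e k) (e k)

/-! ### Bath correlations on the unfolded Keldysh contour `[0, 2t]` -/

/-- The bath propagator `G_b(sf, si)` for `si ≤ sf`, where `Ub τ = exp (-i τ Hb)`. -/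
def bathPropagator (Ub : ℝ → K →L[ℂ] K) (t sf si : ℝ) : K →L[ℂ] K :=
  if sf < t then Ub (sf - si)
  else if t ≤ si then Ub (si - sf)
  else Ub (2 * t - si - sf)

open scoped Classical in
/-- Application of an unbounded operator (zero outside the domain; only used inside it). -/
def applyOp (W : K →ₗ.[ℂ] K) (x : K) : K := if h : x ∈ W.domain then W ⟨x, h⟩ else 0

/-- For a decreasing list `[s_m, …, s_1]` of contour times, the vector
`W_b G_b(s_m, s_{m-1}) W_b ⋯ W_b G_b(s_2, s_1) W_b G_b(s_1, 0) x` (and `x` for the empty list). -/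
def bathWord (Ub : ℝ → K →L[ℂ] K) (Wb : K →ₗ.[ℂ] K) (t : ℝ) : List ℝ → K → K
  | [], x => x
  | s :: l, x => applyOp Wb (bathPropagator Ub t s (l.headD 0) (bathWord Ub Wb t l x))

/-- The term of
`tr_b (ρ_b G_b(2t, s_m) W_b G_b(s_m, s_{m-1}) W_b ⋯ W_b G_b(s_1, 0))`
that belongs to the `k`-th vector of the eigenbasis `e` of `ρ_b`. -/
def bathTerm (e : HilbertBasis ι ℂ K) (β : ℝ) (ε : ι → ℝ) (Ub : ℝ → K →L[ℂ] K) (Wb : K →ₗ.[ℂ] K)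
    (t : ℝ) (l : List ℝ) (k : ι) : ℂ :=
  thermalWeight β ε k *
    inner ℂ (e k) (bathPropagator Ub t (2 * t) (l.headD 0) (bathWord Ub Wb t l (e k)))

/-- The bath functional
`𝓛_b(s_m, …, s_1) = tr_b (ρ_b G_b(2t, s_m) W_b G_b(s_m, s_{m-1}) W_b ⋯ W_b G_b(s_1, 0))`. -/
def bathFunctional (e : HilbertBasis ι ℂ K) (β : ℝ) (ε : ι → ℝ) (Ub : ℝ → K →L[ℂ] K)
    (Wb : K →ₗ.[ℂ] K) (t : ℝ) (l : List ℝ) : ℂ :=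
  ∑' k, bathTerm e β ε Ub Wb t l k

/-- The unfolded bath correlation function
`B(τ₁, τ₂) = tr_b (ρ_b G_b(2t, τ₂) W_b G_b(τ₂, τ₁) W_b G_b(τ₁, 0))`. -/
def bathCorrelation (e : HilbertBasis ι ℂ K) (β : ℝ) (ε : ι → ℝ) (Ub : ℝ → K →L[ℂ] K)
    (Wb : K →ₗ.[ℂ] K) (t τ₁ τ₂ : ℝ) : ℂ :=
  bathFunctional e β ε Ub Wb t [τ₂, τ₁]

/-- A decreasing list of contour times `2t > s_m > ⋯ > s_1 > 0`. -/
def IsContourTimes (t : ℝ) (l : List ℝ) : Prop :=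
  l.Pairwise (· > ·) ∧ ∀ s ∈ l, 0 < s ∧ s < 2 * t

/-- All the contour-ordered bath expectations are meaningful: the operator products can be applied
to the eigenvectors of `ρ_b`, and the series defining the traces converge absolutely. -/
structure BathFunctionalDefined (e : HilbertBasis ι ℂ K) (β : ℝ) (ε : ι → ℝ)
    (Ub : ℝ → K →L[ℂ] K) (Wb : K →ₗ.[ℂ] K) (t : ℝ) : Prop where
  mem_domain : ∀ (s : ℝ) (l : List ℝ) (k : ι), IsContourTimes t (s :: l) →
    bathPropagator Ub t s (l.headD 0) (bathWord Ub Wb t l (e k)) ∈ Wb.domain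
  summable : ∀ l : List ℝ, IsContourTimes t l → Summable (bathTerm e β ε Ub Wb t l)

end Bath

/-! ### Pairings and Wick's theorem -/

open scoped Classical in
/-- The ordered pairings of `m` points: sets of pairs `(j, k)` with `j < k` such that every point
occurs in exactly one pair. (There are none for odd `m`, and one, the empty one, for `m = 0`.) -/
def pairings (m : ℕ) : Finset (Finset (Fin m × Fin m)) :=
  Finset.univ.filter fun q =>
    (∀ p ∈ q, p.1 < p.2) ∧ ∀ i, ∃! p, p ∈ q ∧ (p.1 = i ∨ p.2 = i)

/-- Wick's theorem for the bath: for `0 < s_1 < ⋯ < s_m < 2t`, the bath functional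
`𝓛_b(s_m, …, s_1)` is the sum, over all ordered pairings of the time points, of the products of
bath correlations (hence zero for odd `m`). -/
def WickTheorem {K ι : Type*} [NormedAddCommGroup K] [InnerProductSpace ℂ K]
    (e : HilbertBasis ι ℂ K) (β : ℝ) (ε : ι → ℝ) (Ub : ℝ → K →L[ℂ] K) (Wb : K →ₗ.[ℂ] K)
    (t : ℝ) : Prop :=
  ∀ (m : ℕ) (s : Fin m → ℝ), StrictMono s → (∀ i, 0 < s i ∧ s i < 2 * t) →
    bathFunctional e β ε Ub Wb t (List.ofFn s).reverse =
      ∑ q ∈ pairings m, ∏ p ∈ q, bathCorrelation e β ε Ub Wb t (s p.1) (s p.2)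

/-- The bath correlation function is bounded (on the triangle `0 < τ₁ < τ₂ < 2t`). -/
def BoundedCorrelation {K ι : Type*} [NormedAddCommGroup K] [InnerProductSpace ℂ K]
    (e : HilbertBasis ι ℂ K) (β : ℝ) (ε : ι → ℝ) (Ub : ℝ → K →L[ℂ] K) (Wb : K →ₗ.[ℂ] K)
    (t : ℝ) : Prop :=
  ∃ C : ℝ, ∀ τ₁ τ₂ : ℝ, 0 < τ₁ → τ₁ < τ₂ → τ₂ < 2 * t →
    ‖bathCorrelation e β ε Ub Wb t τ₁ τ₂‖ ≤ C

end

end OpenQuantum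

open OpenQuantum

/-! Both expectations are expanded in powers of the coupling. The forward and the backward evolution
each contribute a Dyson series of integrals over coupling times in `(0, t)`. Unfolding the backward
branch by `u ↦ 2 t - u` turns the product of the two into one series of integrals over finite sets
of points of `(0, 2 t)`. Its integrand is a system amplitude times a bath functional, and Wick's
theorem makes the latter a hafnian of `B`. Integrating a hafnian against a function over `2 p`
points, with the factor `1 / (2 p)!`, amounts to applying `J_B ^ p / p!`, where `J_B` integrates
over two additional points with weight `B / 2` (`pointOp_pow_haf_even`). Hence the amplitude is
`exp(J_B) f` at the empty configuration, where `f` is the system amplitude as a function of the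
points at which the system coupling is inserted (`hasSum_jointAmplitude`).

The operators `J_B` commute and are linear in `B`, so the difference of the two amplitudes is the
sum over `n ≥ 1` of `J_ΔB ^ n / n!` applied to `exp(J_B) f`. Bounding `exp(J_B) f` through its
series would bring the size of `B` into the result. Instead, `exp(J_B) f` at a configuration `σ` is
again an amplitude of the full unitary dynamics, with the coupling `-i W_s` inserted at the points
of `σ`; unitarity bounds it by `‖O_s‖ ‖x‖² ‖W_s‖ ^ |σ|`, whatever the bath
(`norm_jointAmplitude_le`). Each factor `J_ΔB` then costs `‖W_s‖²` times half the integral of `|ΔB|`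
over the square, which is the integral over the triangle, and summing over `n ≥ 1` gives `exp - 1`
(`norm_exp_op_sub_le`).

Two analytic points need care. The operators are unbounded, so Duhamel's formula is proved weakly,
on time averages of orbits that lie in all the domains, and then extended by limits
(`CouplingDomain.duhamel`). And the Dyson series has to converge: joining a forward configuration of
`n` points to its mirror image turns the thermal average of the squared norms of the bath vectors
into a hafnian of `2 n` points, hence at most `(2 C) ^ n n!` (`sum_norm_sq_bathVector_le`). The
`n`-th Dyson term is thus of order `c ^ n / √n!`, which also justifies exchanging the series with
the sum over the eigenbasis. Finally `ρ_s` is a sum of rank-one operators of vectors `v j` with `∑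
‖v j‖² = 1`, and the estimate is summed over `j`. -/

namespace OpenQuantum
open MeasureTheory

noncomputable section

/-! ### Functions of finite configurations of times -/

/-- A family of functions of finite configurations of times that is jointly measurable, and
bounded on the configurations of each given size. -/
structure IsConf {X E : Type*} [MeasurableSpace X] [NormedAddCommGroup E]
    (G : X → Multiset ℝ → E) : Prop where
  meas : ∀ n, StronglyMeasurable
    fun p : X × (Fin n → ℝ) => G p.1 (List.ofFn p.2 : Multiset ℝ)
  bdd : ∀ n, ∃ C, ∀ x σ, Multiset.card σ = n → ‖G x σ‖ ≤ C

section IsConf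

variable {X Y E : Type*} [MeasurableSpace X] [MeasurableSpace Y] [NormedAddCommGroup E]

theorem IsConf.comp {G : X → Multiset ℝ → E} (hG : IsConf G) {f : Y → X} (hf : Measurable f) :
    IsConf fun y => G (f y) :=
  ⟨fun n => (hG.meas n).comp_measurable
      (g := fun p : Y × (Fin n → ℝ) => (f p.1, p.2)) (by fun_prop),
    fun n => (hG.bdd n).imp fun _ h y σ => h (f y) σ⟩

theorem IsConf.congr {G G' : X → Multiset ℝ → E} (hG : IsConf G) (h : ∀ x σ, G x σ = G' x σ) :
    IsConf G' := by
  rwa [show G' = G from funext fun x => funext fun σ => (h x σ).symm]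

theorem coe_ofFn_append {m n : ℕ} (a : Fin m → ℝ) (b : Fin n → ℝ) :
    (List.ofFn (Fin.append a b) : Multiset ℝ) = ↑(List.ofFn a) + ↑(List.ofFn b) := by
  rw [List.ofFn_fin_append]; rfl

theorem exists_ofFn_eq (σ : Multiset ℝ) :
    ∃ s : Fin (Multiset.card σ) → ℝ, (List.ofFn s : Multiset ℝ) = σ := by
  induction σ using Quotient.inductionOn with
  | h l => exact ⟨l.get, by simp⟩

theorem measurable_append {m n : ℕ} :
    Measurable fun p : (Fin m → ℝ) × (Fin n → ℝ) => Fin.append p.1 p.2 := by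
  refine measurable_pi_lambda _ fun i => ?_
  refine Fin.addCases (fun j => ?_) (fun j => ?_) i
  · simp only [Fin.append_left]; fun_prop
  · simp only [Fin.append_right]; fun_prop

/-- The added points may depend measurably on a further parameter; integrating over this parameter
gives all the integral operators below. -/
theorem IsConf.add_points {d : ℕ} {G : X → Multiset ℝ → E} (hG : IsConf G) {r : Y → Fin d → ℝ}
    (hr : Measurable r) : IsConf fun (p : X × Y) σ => G p.1 (↑(List.ofFn (r p.2)) + σ) := by
  refine ⟨fun n => ?_, fun n => (hG.bdd (d + n)).imp fun C h p σ hσ => h _ _ (by simp [hσ])⟩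
  have := (hG.meas (d + n)).comp_measurable
    (g := fun p : (X × Y) × (Fin n → ℝ) => (p.1.1, Fin.append (r p.1.2) p.2))
    (by
      refine Measurable.prodMk (by fun_prop) ?_
      exact measurable_append.comp (f := fun p : (X × Y) × (Fin n → ℝ) => (r p.1.2, p.2))
        (by fun_prop))
  simpa only [Function.comp_def, coe_ofFn_append] using this

theorem IsConf.cons {G : X → Multiset ℝ → E} (hG : IsConf G) :
    IsConf fun (p : X × ℝ) σ => G p.1 (p.2 ::ₘ σ) := by
  refine (hG.add_points (Y := ℝ) (r := fun u => ![u]) (by fun_prop)).congr fun p σ => ?_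
  simp

theorem IsConf.add_const {G : X → Multiset ℝ → E} (hG : IsConf G) (τ : Multiset ℝ) :
    IsConf fun x σ => G x (σ + τ) := by
  obtain ⟨s, hs⟩ := exists_ofFn_eq τ
  refine ((hG.add_points (Y := Unit) (r := fun _ => s) measurable_const).comp
    (f := fun x => (x, ())) (by fun_prop)).congr fun x σ => ?_
  simp only [hs, add_comm]

theorem IsConf.add {G G' : X → Multiset ℝ → E} (hG : IsConf G) (hG' : IsConf G') :
    IsConf fun x σ => G x σ + G' x σ := by
  refine ⟨fun n => (hG.meas n).add (hG'.meas n), fun n => ?_⟩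
  obtain ⟨C, hC⟩ := hG.bdd n
  obtain ⟨C', hC'⟩ := hG'.bdd n
  exact ⟨C + C', fun x σ hσ => (norm_add_le _ _).trans (add_le_add (hC x σ hσ) (hC' x σ hσ))⟩

theorem isConf_zero : IsConf fun (_ : X) (_ : Multiset ℝ) => (0 : E) :=
  ⟨fun _ => stronglyMeasurable_const, fun _ => ⟨0, by simp⟩⟩

/-- Families of functions of configurations may be combined by continuous maps that are bounded
on bounded sets. -/
theorem IsConf.map₂ {E' E'' : Type*} [NormedAddCommGroup E'] [NormedAddCommGroup E'']
    {G : X → Multiset ℝ → E} {G' : X → Multiset ℝ → E'} (hG : IsConf G) (hG' : IsConf G')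
    {φ : E → E' → E''} (hφ : Continuous (Function.uncurry φ)) {c : ℝ} (hc : 0 ≤ c)
    (hb : ∀ a b, ‖φ a b‖ ≤ c * ‖a‖ * ‖b‖) : IsConf fun x σ => φ (G x σ) (G' x σ) := by
  refine ⟨fun n => hφ.comp_stronglyMeasurable ((hG.meas n).prodMk (hG'.meas n)), fun n => ?_⟩
  obtain ⟨C, hC⟩ := hG.bdd n
  obtain ⟨C', hC'⟩ := hG'.bdd n
  refine ⟨c * |C| * |C'|, fun x σ hσ => (hb _ _).trans ?_⟩
  have h1 := (hC x σ hσ).trans (le_abs_self C)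
  have h2 := (hC' x σ hσ).trans (le_abs_self C')
  gcongr

theorem IsConf.smul [NormedSpace ℂ E] {c : X → Multiset ℝ → ℂ} {G : X → Multiset ℝ → E}
    (hc : IsConf c) (hG : IsConf G) : IsConf fun x σ => c x σ • G x σ :=
  hc.map₂ hG (φ := fun a b => a • b) (by fun_prop) zero_le_one fun a b => by
    rw [one_mul]; exact norm_smul_le _ _

theorem isConf_param {c : X → E} (hc : StronglyMeasurable c) (hb : ∃ C, ∀ x, ‖c x‖ ≤ C) :
    IsConf fun x (_ : Multiset ℝ) => c x :=
  ⟨fun _ => hc.comp_measurable measurable_fst, fun _ => hb.imp fun _ h x _ _ => h x⟩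

theorem IsConf.integrable {G : X → Multiset ℝ → E} (hG : IsConf G) (ν : Measure X)
    [IsFiniteMeasure ν] (σ : Multiset ℝ) : Integrable (fun x => G x σ) ν := by
  obtain ⟨s, hs⟩ := exists_ofFn_eq σ
  obtain ⟨C, hC⟩ := hG.bdd (Multiset.card σ)
  refine Integrable.of_bound (C := C) ?_ (Filter.Eventually.of_forall fun x => hC x σ rfl)
  have := (hG.meas (Multiset.card σ)).comp_measurable (g := fun x : X => (x, s)) (by fun_prop)
  simp only [Function.comp_def, hs] at this
  exact this.aestronglyMeasurable

theorem IsConf.integral [NormedSpace ℝ E] {G : X × Y → Multiset ℝ → E} (hG : IsConf G)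
    (ν : Measure Y) [IsFiniteMeasure ν] : IsConf fun x σ => ∫ y, G (x, y) σ ∂ν := by
  refine ⟨fun n => ?_, fun n => ?_⟩
  · have := (hG.meas n).comp_measurable
      (g := fun p : (X × (Fin n → ℝ)) × Y => ((p.1.1, p.2), p.1.2)) (by fun_prop)
    exact StronglyMeasurable.integral_prod_right
      (f := fun (p : X × (Fin n → ℝ)) y => G (p.1, y) (List.ofFn p.2 : Multiset ℝ)) this
  · obtain ⟨C, hC⟩ := hG.bdd n
    exact ⟨C * ν.real Set.univ, fun x σ hσ =>
      norm_integral_le_of_norm_le_const (Filter.Eventually.of_forall fun y => hC _ σ hσ)⟩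

theorem IsConf.integral_integral_swap [NormedSpace ℝ E] {G : X × Y → Multiset ℝ → E}
    (hG : IsConf G) (μ : Measure X) (ν : Measure Y) [IsFiniteMeasure μ] [IsFiniteMeasure ν]
    (σ : Multiset ℝ) :
    ∫ x, ∫ y, G (x, y) σ ∂ν ∂μ = ∫ y, ∫ x, G (x, y) σ ∂μ ∂ν :=
  MeasureTheory.integral_integral_swap (f := fun x y => G (x, y) σ) (hG.integrable (μ.prod ν) σ)

end IsConf

/-! ### The space of functions of configurations and its integral operators -/

/-- The measurable functions of finite configurations of times that are bounded on the
configurations of each given size. -/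
def confSpace (E : Type*) [NormedAddCommGroup E] [NormedSpace ℂ E] :
    Submodule ℂ (Multiset ℝ → E) where
  carrier := {F | IsConf fun _ : Unit => F}
  add_mem' := fun h h' => IsConf.add h h'
  zero_mem' := isConf_zero
  smul_mem' := fun c _ h => (isConf_param stronglyMeasurable_const ⟨‖c‖, by simp⟩).smul h

section confSpace

variable {X Y E : Type*} [MeasurableSpace X] [MeasurableSpace Y] [NormedAddCommGroup E]
  [NormedSpace ℂ E]

instance : FunLike (confSpace E) (Multiset ℝ) E where
  coe h := h.1
  coe_injective := Subtype.val_injective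

theorem isConf_coe (h : confSpace E) : IsConf fun _ : Unit => (h : Multiset ℝ → E) := h.2

theorem isConf_coe' (h : confSpace E) : IsConf fun _ : X => (h : Multiset ℝ → E) :=
  (isConf_coe h).comp (f := fun _ => ()) (by fun_prop)

@[ext] theorem confSpace.ext {h h' : confSpace E} (H : ∀ σ, h σ = h' σ) : h = h' :=
  DFunLike.ext _ _ H

/-- A function of configurations, as an element of `confSpace`. -/
def IsConf.toSpace {F : Multiset ℝ → E} (hF : IsConf fun _ : Unit => F) : confSpace E := ⟨F, hF⟩

@[simp] theorem IsConf.toSpace_apply {F : Multiset ℝ → E} (hF : IsConf fun _ : Unit => F)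
    (σ : Multiset ℝ) : hF.toSpace σ = F σ := rfl

@[simp] theorem confSpace.add_apply (h h' : confSpace E) (σ : Multiset ℝ) :
    (h + h') σ = h σ + h' σ := rfl

@[simp] theorem confSpace.smul_apply (c : ℂ) (h : confSpace E) (σ : Multiset ℝ) :
    (c • h) σ = c • h σ := rfl

omit [NormedSpace ℂ E] in
theorem IsConf.slice {G : X → Multiset ℝ → E} (hG : IsConf G) (x : X) :
    IsConf fun _ : Unit => G x := hG.comp (f := fun _ => x) (by fun_prop)

/-- The data of an operator that integrates a function of configurations over `d` additional
points. -/
structure PointKernel (Y : Type*) [MeasurableSpace Y] (d : ℕ) where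
  /-- the measure on the parameter space -/
  measure : Measure Y
  /-- the weight of a parameter -/
  coeff : Y → ℂ
  /-- the points that belong to a parameter -/
  pts : Y → Fin d → ℝ
  finite : IsFiniteMeasure measure
  measurable_coeff : Measurable coeff
  bdd_coeff : ∃ C, ∀ y, ‖coeff y‖ ≤ C
  measurable_pts : Measurable pts

attribute [instance] PointKernel.finite

namespace PointKernel

variable {d d' : ℕ} (κ : PointKernel Y d) (κ' : PointKernel X d')

theorem isConf_integrand {G : X → Multiset ℝ → E} (hG : IsConf G) :
    IsConf fun (p : X × Y) σ => κ.coeff p.2 • G p.1 (↑(List.ofFn (κ.pts p.2)) + σ) :=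
  ((isConf_param κ.measurable_coeff.stronglyMeasurable κ.bdd_coeff).comp measurable_snd).smul
    (hG.add_points κ.measurable_pts)

theorem integrable (h : confSpace E) (σ : Multiset ℝ) :
    Integrable (fun y => κ.coeff y • h (↑(List.ofFn (κ.pts y)) + σ)) κ.measure :=
  ((κ.isConf_integrand (isConf_coe h)).comp (f := fun y => ((), y)) (by fun_prop)).integrable _ σ

/-- The operator that integrates a function of configurations over `d` additional points. -/
def op : Module.End ℂ (confSpace E) where
  toFun h := IsConf.toSpace
    (F := fun σ => ∫ y, κ.coeff y • h (↑(List.ofFn (κ.pts y)) + σ) ∂κ.measure)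
    ((κ.isConf_integrand (isConf_coe h)).integral κ.measure)
  map_add' h h' := by
    ext σ
    simp only [IsConf.toSpace_apply, confSpace.add_apply, smul_add]
    exact integral_add (κ.integrable h σ) (κ.integrable h' σ)
  map_smul' c h := by
    ext σ
    simp only [IsConf.toSpace_apply, confSpace.smul_apply, smul_comm _ c, RingHom.id_apply]
    exact integral_smul c _

theorem op_apply (h : confSpace E) (σ : Multiset ℝ) :
    κ.op h σ = ∫ y, κ.coeff y • h (↑(List.ofFn (κ.pts y)) + σ) ∂κ.measure := rfl

/-- Configurations are unordered, so adding two groups of points in either order gives the same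
configuration; the rest is Fubini. -/
theorem op_commute [CompleteSpace E] : Commute (κ.op (E := E)) κ'.op := by
  refine LinearMap.ext fun h => confSpace.ext fun σ => ?_
  simp only [Module.End.mul_apply, op_apply]
  have hG := κ'.isConf_integrand (κ.isConf_integrand (isConf_coe h))
  have hG' : IsConf fun (p : X × Y) σ => κ.coeff p.2 • κ'.coeff p.1 •
      h (↑(List.ofFn (κ'.pts p.1)) + (↑(List.ofFn (κ.pts p.2)) + σ)) := by
    refine (hG.comp (f := fun p : X × Y => (((), p.2), p.1)) (by fun_prop)).congr fun p σ => ?_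
    simp only [smul_comm (κ'.coeff p.1), add_left_comm]
  have := hG'.integral_integral_swap κ'.measure κ.measure σ
  simp only [integral_smul] at this
  rw [← this]
  refine integral_congr_ae (Filter.Eventually.of_forall fun x => ?_)
  simp only
  rw [← integral_smul]
  refine integral_congr_ae (Filter.Eventually.of_forall fun y => ?_)
  simp only [smul_comm (κ'.coeff x), add_left_comm]

/-- Translation of a function of configurations by a fixed configuration. -/
def _root_.OpenQuantum.shift (τ : Multiset ℝ) (h : confSpace E) : confSpace E :=
  ((isConf_coe h).add_const τ).toSpace

@[simp] theorem _root_.OpenQuantum.shift_apply (τ : Multiset ℝ) (h : confSpace E)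
    (σ : Multiset ℝ) : shift τ h σ = h (σ + τ) := rfl

/-- With this, a series of powers evaluated at `σ` can be read off from the series of the translated
function at the empty configuration. -/
theorem op_shift (τ : Multiset ℝ) (h : confSpace E) : κ.op (shift τ h) = shift τ (κ.op h) := by
  ext σ
  simp only [op_apply, shift_apply, add_assoc]

theorem op_pow_shift (τ : Multiset ℝ) (h : confSpace E) (n : ℕ) :
    (κ.op ^ n) (shift τ h) = shift τ ((κ.op ^ n) h) := by
  induction n with
  | zero => rfl
  | succ n ih => rw [pow_succ', Module.End.mul_apply, ih, op_shift]; rfl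

/-- The finite sum is kept inside the estimate: for series over the eigenbasis only the partial sums
of norms are bounded uniformly in the configuration, and such bounds have to survive the operator.
-/
theorem sum_norm_op_le {I : Type*} (F : Finset I) (h : I → confSpace E) {β : ℝ}
    {σ : Multiset ℝ}
    (hβ : ∀ᵐ y ∂κ.measure, ∑ i ∈ F, ‖h i (↑(List.ofFn (κ.pts y)) + σ)‖ ≤ β) :
    ∑ i ∈ F, ‖κ.op (h i) σ‖ ≤ (∫ y, ‖κ.coeff y‖ ∂κ.measure) * β := by
  calc ∑ i ∈ F, ‖κ.op (h i) σ‖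
      ≤ ∑ i ∈ F, ∫ y, ‖κ.coeff y • h i (↑(List.ofFn (κ.pts y)) + σ)‖ ∂κ.measure :=
        Finset.sum_le_sum fun i _ => norm_integral_le_integral_norm _
    _ = ∫ y, ∑ i ∈ F, ‖κ.coeff y • h i (↑(List.ofFn (κ.pts y)) + σ)‖ ∂κ.measure :=
        (integral_finsetSum _ fun i _ => (κ.integrable (h i) σ).norm).symm
    _ ≤ ∫ y, ‖κ.coeff y‖ * β ∂κ.measure := by
        refine integral_mono_ae (integrable_finsetSum _ fun i _ => (κ.integrable (h i) σ).norm)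
          ?_ (hβ.mono fun y hy => ?_)
        · obtain ⟨C, hC⟩ := κ.bdd_coeff
          exact (Integrable.of_bound κ.measurable_coeff.norm.aestronglyMeasurable C
            (Filter.Eventually.of_forall fun y => by simpa using hC y)).mul_const β
        · simp only [norm_smul, ← Finset.mul_sum]
          gcongr
    _ = _ := integral_mul_const _ _

theorem norm_op_le (h : confSpace E) {β : ℝ} {σ : Multiset ℝ}
    (hβ : ∀ᵐ y ∂κ.measure, ‖h (↑(List.ofFn (κ.pts y)) + σ)‖ ≤ β) :
    ‖κ.op h σ‖ ≤ (∫ y, ‖κ.coeff y‖ ∂κ.measure) * β := by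
  simpa using κ.sum_norm_op_le (I := Unit) {()} (fun _ => h) (σ := σ) (β := β) (by simpa using hβ)

end PointKernel

/-- A family of functions of configurations with sum `H`, with absolute convergence that is
uniform on the configurations of each given size. -/
structure ConfHasSum {I : Type*} (h : I → confSpace E) (H : confSpace E) : Prop where
  hasSum : ∀ σ, HasSum (fun i => h i σ) (H σ)
  bdd : ∀ n, ∃ C, ∀ (F : Finset I) (σ : Multiset ℝ), Multiset.card σ = n →
    ∑ i ∈ F, ‖h i σ‖ ≤ C

/-- The uniform bound on partial sums of norms makes the sum of the integrals of the norms finite,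
so sum and integral may be exchanged. The same bound passes to the images, so that the operator can
be iterated. -/
theorem ConfHasSum.op [CompleteSpace E] {I : Type*} [Countable I] {h : I → confSpace E}
    {H : confSpace E} (hH : ConfHasSum h H) {d : ℕ} (κ : PointKernel Y d) :
    ConfHasSum (fun i => κ.op (h i)) (κ.op H) := by
  refine ⟨fun σ => ?_, fun n => ?_⟩
  · obtain ⟨C, hC⟩ := hH.bdd (d + Multiset.card σ)
    obtain ⟨c, hc⟩ := κ.bdd_coeff
    have key := hasSum_integral_of_summable_integral_norm (μ := κ.measure)
      (F := fun i y => κ.coeff y • h i (↑(List.ofFn (κ.pts y)) + σ))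
      (fun i => κ.integrable (h i) σ) ?_
    · have hval : κ.op H σ = ∫ y, ∑' i, κ.coeff y • h i (↑(List.ofFn (κ.pts y)) + σ)
          ∂κ.measure := ?_
      · rw [hval]
        exact key
      refine integral_congr_ae (Filter.Eventually.of_forall fun y => ?_)
      exact ((hH.hasSum (↑(List.ofFn (κ.pts y)) + σ)).const_smul (κ.coeff y)).tsum_eq.symm
    · refine summable_of_sum_le (c := κ.measure.real Set.univ * (|c| * C))
        (fun i => integral_nonneg fun y => norm_nonneg _) fun F => ?_
      rw [← integral_finsetSum _ fun i _ => (κ.integrable (h i) σ).norm]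
      refine (integral_mono (integrable_finsetSum _ fun i _ => (κ.integrable (h i) σ).norm)
        (integrable_const (|c| * C)) fun y => ?_).trans (by simp)
      simp only [norm_smul, ← Finset.mul_sum]
      exact mul_le_mul ((hc y).trans (le_abs_self c)) (hC F _ (by simp))
        (Finset.sum_nonneg fun _ _ => norm_nonneg _) (abs_nonneg c)
  · obtain ⟨C, hC⟩ := hH.bdd (d + n)
    exact ⟨_, fun F σ hσ => κ.sum_norm_op_le F h (β := C)
      (Filter.Eventually.of_forall fun y => hC F _ (by simp [hσ]))⟩

theorem ConfHasSum.op_pow [CompleteSpace E] {I : Type*} [Countable I] {h : I → confSpace E}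
    {H : confSpace E} (hH : ConfHasSum h H) {d : ℕ} (κ : PointKernel Y d) (n : ℕ) :
    ConfHasSum (fun i => (κ.op ^ n) (h i)) ((κ.op ^ n) H) := by
  induction n with
  | zero => exact hH
  | succ n ih => simpa only [pow_succ', Module.End.mul_apply] using ih.op κ

end confSpace

/-! ### Integration over one additional point -/

section pointOp

variable {X Y E : Type*} [MeasurableSpace X] [MeasurableSpace Y] [NormedAddCommGroup E]
  [NormedSpace ℂ E]

/-- Integration over one additional point with respect to `μ`. -/
def pointKernel (μ : Measure ℝ) [IsFiniteMeasure μ] : PointKernel ℝ 1 where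
  measure := μ
  coeff _ := 1
  pts u := ![u]
  finite := inferInstance
  measurable_coeff := measurable_const
  bdd_coeff := ⟨1, by simp⟩
  measurable_pts := by fun_prop

/-- Integration over one additional point with respect to `μ`. -/
abbrev pointOp (μ : Measure ℝ) [IsFiniteMeasure μ] : Module.End ℂ (confSpace E) :=
  (pointKernel μ).op

variable (μ ν : Measure ℝ) [IsFiniteMeasure μ] [IsFiniteMeasure ν]

theorem pointOp_apply (h : confSpace E) (σ : Multiset ℝ) :
    pointOp μ h σ = ∫ u, h (u ::ₘ σ) ∂μ := by
  simp [pointOp, PointKernel.op_apply, pointKernel]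

theorem pointOp_add_measure :
    pointOp (E := E) (μ + ν) = pointOp μ + pointOp ν := by
  refine LinearMap.ext fun h => confSpace.ext fun σ => ?_
  have h1 := fun (ρ : Measure ℝ) [IsFiniteMeasure ρ] => (pointKernel ρ).integrable h σ
  simp only [pointKernel, one_smul] at h1
  simp only [LinearMap.add_apply, confSpace.add_apply, pointOp, PointKernel.op_apply, pointKernel,
    one_smul]
  exact integral_add_measure (h1 μ) (h1 ν)

theorem pointOp_pow_congr {h h' : confSpace E} {P : ℝ → Prop} (hP : ∀ᵐ u ∂μ, P u) (n : ℕ)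
    (σ : Multiset ℝ) (H : ∀ τ : Multiset ℝ, Multiset.card τ = n → (∀ u ∈ τ, P u) →
      h (τ + σ) = h' (τ + σ)) : (pointOp μ ^ n) h σ = (pointOp μ ^ n) h' σ := by
  induction n generalizing σ with
  | zero => simpa using H 0 rfl (by simp)
  | succ n ih =>
    simp only [pow_succ', Module.End.mul_apply, pointOp_apply]
    refine integral_congr_ae (hP.mono fun u hu => ih _ fun τ hτ hτP => ?_)
    have := H (u ::ₘ τ) (by simp [hτ]) (by simpa [hu] using hτP)
    simpa [Multiset.cons_add, Multiset.add_cons] using this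

/-- The binomial theorem in the normalization of the exponential series. -/
theorem pow_div_factorial_add {V : Type*} [AddCommGroup V] [Module ℂ V] {a b : Module.End ℂ V}
    (h : Commute a b) (n : ℕ) (v : V) :
    ((n.factorial : ℂ)⁻¹) • ((a + b) ^ n) v = ∑ m ∈ Finset.HasAntidiagonal.antidiagonal n,
      ((m.1.factorial : ℂ)⁻¹ * (m.2.factorial : ℂ)⁻¹) • (a ^ m.1) ((b ^ m.2) v) := by
  rw [h.add_pow', LinearMap.sum_apply, Finset.smul_sum]
  refine Finset.sum_congr rfl fun m hm => ?_
  rw [Finset.HasAntidiagonal.mem_antidiagonal] at hm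
  rw [LinearMap.smul_apply, Module.End.mul_apply, ← Nat.cast_smul_eq_nsmul ℂ, smul_smul, ← hm,
    Nat.choose_symm_add, Nat.add_choose]
  congr 1
  have h1 : (m.1.factorial * m.2.factorial : ℕ) ∣ (m.1 + m.2).factorial :=
    Nat.factorial_mul_factorial_dvd_factorial_add _ _
  have h2 : ∀ k : ℕ, (k.factorial : ℂ) ≠ 0 := fun k => Nat.cast_ne_zero.2 k.factorial_ne_zero
  rw [Nat.cast_div h1 (by exact_mod_cast mul_ne_zero (h2 m.1) (h2 m.2))]
  have := h2 (m.1 + m.2)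
  push_cast
  field_simp [h2 m.1, h2 m.2]

end pointOp

end

noncomputable section

/-! ### A Mecke formula: sums over the points of a configuration -/

section Mecke

variable {E : Type*} [NormedAddCommGroup E] [NormedSpace ℂ E]

theorem coe_ofFn_eq_cons {n : ℕ} (s : Fin (n + 1) → ℝ) (i : Fin (n + 1)) :
    (List.ofFn s : Multiset ℝ) = s i ::ₘ ↑(List.ofFn fun j => s (i.succAbove j)) := by
  have h : ∀ {k : ℕ} (f : Fin k → ℝ), (List.ofFn f : Multiset ℝ) = Finset.univ.val.map f := by
    intro k f
    rw [List.ofFn_eq_map, ← Multiset.map_coe]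
    rfl
  rw [h, h, Fin.univ_succAbove n i]
  simp [Function.comp_def]

/-- The sum of `G v (σ - v)` over the points `v` of the configuration `σ`. -/
def sumErase {A : Type*} [AddCommMonoid A] (G : ℝ → Multiset ℝ → A) (σ : Multiset ℝ) : A :=
  (σ.map fun v => G v (σ.erase v)).sum

@[simp] theorem sumErase_zero {A : Type*} [AddCommMonoid A] (G : ℝ → Multiset ℝ → A) :
    sumErase G 0 = 0 := rfl

theorem sumErase_cons {A : Type*} [AddCommMonoid A] (G : ℝ → Multiset ℝ → A) (u : ℝ)
    (σ : Multiset ℝ) :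
    sumErase G (u ::ₘ σ) = G u σ + sumErase (fun v τ => G v (u ::ₘ τ)) σ := by
  simp only [sumErase, Multiset.map_cons, Multiset.sum_cons, Multiset.erase_cons_head]
  congr 2
  refine Multiset.map_congr rfl fun v hv => ?_
  -- `erase` removes a single copy: if the new point coincides with a point `v` of `σ`, removing it
  -- leaves `σ`, which is also `u ::ₘ σ.erase v`.
  by_cases h : u = v
  · subst h
    rw [Multiset.erase_cons_head, Multiset.cons_erase hv]
  · rw [Multiset.erase_cons_tail _ h]

theorem sumErase_congr {A : Type*} [AddCommMonoid A] {G G' : ℝ → Multiset ℝ → A} {σ : Multiset ℝ}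
    (h : ∀ v ∈ σ, G v (σ.erase v) = G' v (σ.erase v)) : sumErase G σ = sumErase G' σ := by
  unfold sumErase
  rw [Multiset.map_congr rfl h]

theorem sumErase_ofFn {A : Type*} [AddCommMonoid A] (G : ℝ → Multiset ℝ → A) {n : ℕ}
    (s : Fin (n + 1) → ℝ) :
    sumErase G (List.ofFn s) = ∑ i, G (s i) (List.ofFn fun j => s (i.succAbove j)) := by
  have h : (List.ofFn s : Multiset ℝ) = Finset.univ.val.map s := by
    rw [List.ofFn_eq_map, ← Multiset.map_coe]; rfl
  rw [sumErase]
  conv_lhs => rw [h]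
  rw [Multiset.map_map, Finset.sum]
  congr 1
  refine Multiset.map_congr rfl fun i _ => ?_
  simp only [Function.comp]
  rw [← h, coe_ofFn_eq_cons s i, Multiset.erase_cons_head]

omit [NormedSpace ℂ E] in
theorem isConf_sumErase {G : ℝ → Multiset ℝ → E} (hG : IsConf G) :
    IsConf fun _ : Unit => sumErase G := by
  refine ⟨fun n => ?_, fun n => ?_⟩
  · cases n with
    | zero => simp
    | succ n =>
      simp only [sumErase_ofFn]
      refine Finset.stronglyMeasurable_fun_sum _ fun i _ => ?_
      exact (hG.meas n).comp_measurable
        (g := fun p : Unit × (Fin (n + 1) → ℝ) => (p.2 i, fun j => p.2 (i.succAbove j)))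
        (by fun_prop)
  · cases n with
    | zero => exact ⟨0, fun _ σ hσ => by simp [Multiset.card_eq_zero.1 hσ]⟩
    | succ n =>
      obtain ⟨C, hC⟩ := hG.bdd n
      refine ⟨∑ _ : Fin (n + 1), C, fun _ σ hσ => ?_⟩
      obtain ⟨s, rfl⟩ : ∃ s : Fin (n + 1) → ℝ, (List.ofFn s : Multiset ℝ) = σ :=
        hσ ▸ exists_ofFn_eq σ
      rw [sumErase_ofFn]
      exact norm_sum_le_of_le _ fun i _ => hC _ _ (by simp)

theorem integral_multiset_sum {X : Type*} [MeasurableSpace X] {μ : Measure X} {f : ℝ → X → E}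
    (hf : ∀ v, Integrable (f v) μ) (s : Multiset ℝ) :
    Integrable (fun x => (s.map fun v => f v x).sum) μ ∧
      ∫ x, (s.map fun v => f v x).sum ∂μ = (s.map fun v => ∫ x, f v x ∂μ).sum := by
  induction s using Multiset.induction with
  | empty => simp
  | cons a s ih =>
    simp only [Multiset.map_cons, Multiset.sum_cons]
    exact ⟨(hf a).add ih.1, by rw [integral_add (hf a) ih.1, ih.2]⟩

/-- The integral of a family of functions of configurations over its parameter. -/
def IsConf.paramIntegral {G : ℝ → Multiset ℝ → E} (hG : IsConf G) (μ : Measure ℝ)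
    [IsFiniteMeasure μ] : confSpace E :=
  IsConf.toSpace (F := fun σ => ∫ v, G v σ ∂μ)
    (IsConf.integral (hG.comp (f := fun p : Unit × ℝ => p.2) (by fun_prop)) μ)

theorem IsConf.paramIntegral_apply {G : ℝ → Multiset ℝ → E} (hG : IsConf G) (μ : Measure ℝ)
    [IsFiniteMeasure μ] (σ : Multiset ℝ) : hG.paramIntegral μ σ = ∫ v, G v σ ∂μ := rfl

variable (μ : Measure ℝ) [IsFiniteMeasure μ]

theorem pointOp_paramIntegral [CompleteSpace E] {G : ℝ → Multiset ℝ → E} (hG : IsConf G) :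
    pointOp μ (hG.paramIntegral μ) = (hG.cons.integral μ).paramIntegral μ := by
  ext σ
  simp only [pointOp_apply, IsConf.paramIntegral_apply]
  exact (hG.cons.integral_integral_swap μ μ σ).symm

theorem pointOp_pow_paramIntegral [CompleteSpace E] {G : ℝ → Multiset ℝ → E} (hG : IsConf G)
    (n : ℕ) (σ : Multiset ℝ) :
    (pointOp μ ^ n) (hG.paramIntegral μ) σ = ∫ v, (pointOp μ ^ n) (hG.slice v).toSpace σ ∂μ := by
  induction n generalizing G with
  | zero => rfl
  | succ n ih =>
    rw [pow_succ, Module.End.mul_apply, pointOp_paramIntegral, ih]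
    refine integral_congr_ae (Filter.Eventually.of_forall fun v => ?_)
    simp only [Module.End.mul_apply]
    congr 2
    ext τ
    simp [pointOp_apply]

/-- Either the integrated point is the distinguished one, or it is an ordinary point of the
configuration left after removing the distinguished one. -/
theorem pointOp_sumErase [CompleteSpace E] {G : ℝ → Multiset ℝ → E} (hG : IsConf G) :
    pointOp μ (isConf_sumErase hG).toSpace =
      hG.paramIntegral μ + (isConf_sumErase (hG.cons.integral μ)).toSpace := by
  ext σ
  simp only [pointOp_apply, confSpace.add_apply, IsConf.toSpace_apply, IsConf.paramIntegral_apply,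
    sumErase_cons]
  have h := integral_multiset_sum (μ := μ) (f := fun v u => G v (u ::ₘ (σ.erase v)))
    (fun v => (hG.cons.comp (f := fun u : ℝ => (v, u)) (by fun_prop)).integrable μ _) σ
  exact (integral_add (hG.integrable μ σ) h.1).trans (congrArg _ h.2)

/-- Integrating a sum over the points of a configuration amounts to integrating over one additional
point. -/
theorem pointOp_pow_sumErase [CompleteSpace E] {G : ℝ → Multiset ℝ → E} (hG : IsConf G) (n : ℕ) :
    (pointOp μ ^ (n + 1)) (isConf_sumErase hG).toSpace 0 =
      ((n : ℂ) + 1) • (pointOp μ ^ n) (hG.paramIntegral μ) 0 := by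
  induction n generalizing G with
  | zero =>
    rw [zero_add, pow_one, pointOp_sumErase μ hG]
    simp
  | succ n ih =>
    -- The distinguished new point contributes one term, and the induction hypothesis `n + 1` equal
    -- ones, since integrating out an ordinary point commutes with the parameter integral.
    rw [pow_succ, Module.End.mul_apply, pointOp_sumErase μ hG, map_add, confSpace.add_apply,
      ih (hG.cons.integral μ), ← pointOp_paramIntegral μ hG, ← Module.End.mul_apply, ← pow_succ]
    push_cast
    module

end Mecke

/-! ### Sums over pairings -/

section Hafnian

theorem sumErase_add {A : Type*} [AddCommMonoid A] (G G' : ℝ → Multiset ℝ → A) (σ : Multiset ℝ) :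
    sumErase (fun v τ => G v τ + G' v τ) σ = sumErase G σ + sumErase G' σ :=
  Multiset.sum_map_add

theorem mul_sumErase (c : ℂ) (G : ℝ → Multiset ℝ → ℂ) (σ : Multiset ℝ) :
    c * sumErase G σ = sumErase (fun v τ => c * G v τ) σ :=
  Multiset.sum_map_mul_left.symm

theorem sumErase_comm {A : Type*} [AddCommMonoid A] (F : ℝ → ℝ → Multiset ℝ → A)
    (σ : Multiset ℝ) :
    sumErase (fun v => sumErase (F v)) σ = sumErase (fun v => sumErase fun w => F w v) σ := by
  induction σ using Multiset.induction generalizing F with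
  | empty => rfl
  | cons a σ ih =>
    simp only [sumErase_cons, sumErase_add]
    rw [ih fun v w τ => F v w (a ::ₘ τ)]
    abel

/-- The sum over the pairings of a configuration, with fuel. -/
def hafAux (B : ℝ → ℝ → ℂ) : ℕ → Multiset ℝ → ℂ
  | 0, _ => 1
  | n + 1, σ => if σ = 0 then 1 else
      sumErase (fun v τ => B ((σ.sort (· ≤ ·)).headD 0) v * hafAux B n τ)
        (σ.erase ((σ.sort (· ≤ ·)).headD 0))

/-- The hafnian: the sum over the partitions of a configuration into pairs of the products of the
values of `B` at the pairs. -/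
def haf (B : ℝ → ℝ → ℂ) (σ : Multiset ℝ) : ℂ := hafAux B (Multiset.card σ) σ

theorem headD_sort_mem {σ : Multiset ℝ} (h : σ ≠ 0) : (σ.sort (· ≤ ·)).headD 0 ∈ σ := by
  rw [← Multiset.mem_sort (r := (· ≤ ·))]
  have : σ.sort (· ≤ ·) ≠ [] := fun h' => h (by rw [← Multiset.sort_eq σ (· ≤ ·), h']; rfl)
  cases h2 : σ.sort (· ≤ ·) with
  | nil => exact absurd h2 this
  | cons a l => simp

theorem hafAux_eq (B : ℝ → ℝ → ℂ) (n m : ℕ) (σ : Multiset ℝ) (hn : Multiset.card σ ≤ n)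
    (hm : Multiset.card σ ≤ m) : hafAux B n σ = hafAux B m σ := by
  induction n generalizing m σ with
  | zero =>
    have : σ = 0 := Multiset.card_eq_zero.1 (by omega)
    cases m <;> simp [hafAux, this]
  | succ n ih =>
    by_cases h : σ = 0
    · cases m <;> simp [hafAux, h]
    obtain ⟨m, rfl⟩ : ∃ k, m = k + 1 :=
      Nat.exists_eq_succ_of_ne_zero fun h0 => h (Multiset.card_eq_zero.1 (by omega))
    simp only [hafAux, h, if_false]
    refine sumErase_congr fun v hv => ?_
    have h1 := Multiset.card_erase_add_one (headD_sort_mem h)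
    have h2 := Multiset.card_erase_add_one hv
    rw [ih m _ (by omega) (by omega)]

@[simp] theorem haf_zero (B : ℝ → ℝ → ℂ) : haf B 0 = 1 := rfl

theorem haf_eq_of_ne_zero (B : ℝ → ℝ → ℂ) {σ : Multiset ℝ} (h : σ ≠ 0) :
    ∃ c ∈ σ, haf B σ = sumErase (fun v τ => B c v * haf B τ) (σ.erase c) := by
  refine ⟨_, headD_sort_mem h, ?_⟩
  have h0 : Multiset.card σ ≠ 0 := fun h' => h (Multiset.card_eq_zero.1 h')
  rw [haf, hafAux_eq B _ (Multiset.card σ + 1) σ le_rfl (by omega)]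
  simp only [hafAux, h, if_false]
  refine sumErase_congr fun v hv => ?_
  have h1 := Multiset.card_erase_add_one (headD_sort_mem h)
  have h2 := Multiset.card_erase_add_one hv
  rw [haf, hafAux_eq B (Multiset.card σ) _ _ (by omega) le_rfl]

/-- The definition expands along the least point `c`; the expansion along any other point `u` agrees
with it. Apart from the pair `{u, c}`, expanding once more gives in both cases the sum over the
partners `v`, `w` of `c` and `u`, and the order of the two removals is immaterial. -/
theorem haf_cons {B : ℝ → ℝ → ℂ} (hB : ∀ u v, B u v = B v u) (u : ℝ) (σ : Multiset ℝ) :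
    haf B (u ::ₘ σ) = sumErase (fun v τ => B u v * haf B τ) σ := by
  induction hn : Multiset.card σ using Nat.strong_induction_on generalizing u σ with
  | h n ih =>
    subst hn
    obtain ⟨c, hc, h⟩ := haf_eq_of_ne_zero B (Multiset.cons_ne_zero (a := u) (m := σ))
    by_cases hcu : c = u
    · subst hcu
      rwa [Multiset.erase_cons_head] at h
    have hcσ : c ∈ σ := (Multiset.mem_cons.1 hc).resolve_left hcu
    obtain ⟨ρ, rfl⟩ := Multiset.exists_cons_of_mem hcσ
    rw [Multiset.cons_swap] at h ⊢
    rw [Multiset.erase_cons_head, sumErase_cons] at h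
    rw [h, sumErase_cons, hB c u]
    congr 1
    have key : ∀ a b : ℝ, sumErase (fun v τ => B a v * haf B (b ::ₘ τ)) ρ =
        sumErase (fun v => sumErase fun w τ => B a v * (B b w * haf B τ)) ρ := by
      intro a b
      refine sumErase_congr fun v hv => ?_
      have h1 := Multiset.card_erase_add_one hv
      have h2 := Multiset.card_pos_iff_exists_mem.2 ⟨v, hv⟩
      rw [ih _ (by simp only [Multiset.card_cons]; omega) b _ rfl, mul_sumErase]
    rw [key, key, sumErase_comm]
    refine sumErase_congr fun v _ => sumErase_congr fun w _ => ?_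
    ring

theorem norm_sumErase_le {G : ℝ → Multiset ℝ → ℂ} {σ : Multiset ℝ} {C : ℝ}
    (h : ∀ v ∈ σ, ‖G v (σ.erase v)‖ ≤ C) : ‖sumErase G σ‖ ≤ Multiset.card σ * C := by
  refine (norm_multiset_sum_le _).trans ?_
  rw [Multiset.map_map]
  refine (Multiset.sum_le_card_nsmul _ C fun x hx => ?_).trans (by simp)
  obtain ⟨v, hv, rfl⟩ := Multiset.mem_map.1 hx
  exact h v hv

theorem exists_cons_of_card_succ {σ : Multiset ℝ} {n : ℕ} (h : Multiset.card σ = n + 1) :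
    ∃ u ρ, u ::ₘ ρ = σ ∧ Multiset.card ρ = n := by
  obtain ⟨u, hu⟩ := Multiset.card_pos_iff_exists_mem.1 (show 0 < Multiset.card σ by omega)
  obtain ⟨ρ, rfl⟩ := Multiset.exists_cons_of_mem hu
  exact ⟨u, ρ, rfl, by simpa using h⟩

/-- The bound `(2 C) ^ n * n!` for a hafnian of `2 n` points. -/
theorem norm_haf_le {B : ℝ → ℝ → ℂ} (hB : ∀ u v, B u v = B v u) {C : ℝ}
    (hC : ∀ u v, ‖B u v‖ ≤ C) (n : ℕ) (σ : Multiset ℝ) (hσ : Multiset.card σ = 2 * n) :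
    ‖haf B σ‖ ≤ (2 * C) ^ n * n.factorial := by
  have hC0 : 0 ≤ C := (norm_nonneg _).trans (hC 0 0)
  induction n generalizing σ with
  | zero =>
    obtain rfl : σ = 0 := Multiset.card_eq_zero.1 (by omega)
    simp
  | succ n ih =>
    obtain ⟨u, ρ, hρ⟩ := exists_cons_of_card_succ (show Multiset.card σ = 2 * n + 1 + 1 by omega)
    rw [← hρ.1, haf_cons hB]
    refine (norm_sumErase_le (C := C * ((2 * C) ^ n * n.factorial)) fun v hv => ?_).trans ?_
    · rw [norm_mul]
      have h2 := Multiset.card_erase_add_one hv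
      exact mul_le_mul (hC _ _) (ih _ (by omega)) (norm_nonneg _) hC0
    · rw [hρ.2, Nat.factorial_succ]
      push_cast
      have : (0 : ℝ) ≤ C * ((2 * C) ^ n * n.factorial) := by positivity
      calc (2 * (n : ℝ) + 1) * (C * ((2 * C) ^ n * n.factorial))
          ≤ (2 * (n : ℝ) + 2) * (C * ((2 * C) ^ n * n.factorial)) := by gcongr; norm_num
        _ = _ := by ring

theorem haf_eq_zero_of_odd {B : ℝ → ℝ → ℂ} (hB : ∀ u v, B u v = B v u) (n : ℕ) (σ : Multiset ℝ)
    (hσ : Multiset.card σ = 2 * n + 1) : haf B σ = 0 := by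
  induction n generalizing σ with
  | zero =>
    obtain ⟨u, rfl⟩ := Multiset.card_eq_one.1 hσ
    rw [← Multiset.cons_zero, haf_cons hB, sumErase_zero]
  | succ n ih =>
    obtain ⟨u, ρ, hρ⟩ := exists_cons_of_card_succ (show Multiset.card σ = 2 * n + 2 + 1 by omega)
    rw [← hρ.1, haf_cons hB, sumErase_congr (G' := fun _ _ => 0) fun v hv => ?_]
    · simp [sumErase]
    · have h2 := Multiset.card_erase_add_one hv
      rw [ih _ (by omega), mul_zero]

theorem isConf_haf {B : ℝ → ℝ → ℂ} (hB : ∀ u v, B u v = B v u)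
    (hBm : Measurable (Function.uncurry B)) {C : ℝ} (hC : ∀ u v, ‖B u v‖ ≤ C) :
    IsConf fun _ : Unit => haf B := by
  have hm : ∀ n, Measurable fun s : Fin n → ℝ => haf B (List.ofFn s : Multiset ℝ) := by
    intro n
    induction n using Nat.twoStepInduction with
    | zero => simp
    | one =>
      have h0 : ∀ s : Fin 1 → ℝ, haf B (List.ofFn s : Multiset ℝ) = 0 := fun s =>
        haf_eq_zero_of_odd hB 0 _ (by simp)
      simp only [h0, measurable_const]
    | more n ih _ =>
      simp only [List.ofFn_succ (n := n + 1), ← Multiset.cons_coe, haf_cons hB, sumErase_ofFn]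
      refine Finset.measurable_fun_sum _ fun i _ => Measurable.mul ?_ ?_
      · exact hBm.comp (f := fun s : Fin (n + 2) → ℝ => (s 0, s i.succ)) (by fun_prop)
      · exact ih.comp (f := fun s : Fin (n + 2) → ℝ => fun j => s (i.succAbove j).succ)
          (by fun_prop)
  refine ⟨fun n => ((hm n).comp measurable_snd).stronglyMeasurable, fun n => ?_⟩
  obtain ⟨k, rfl | rfl⟩ := Nat.even_or_odd' n
  · exact ⟨_, fun _ σ hσ => norm_haf_le hB hC k σ hσ⟩
  · exact ⟨0, fun _ σ hσ => by rw [haf_eq_zero_of_odd hB k σ hσ, norm_zero]⟩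

end Hafnian

/-! ### Integrals of hafnians -/

section PairOp

variable {E : Type*} [NormedAddCommGroup E] [NormedSpace ℂ E]

/-- Integration over two additional points, with weight `B / 2`. -/
def pairKernel (μ : Measure ℝ) [IsFiniteMeasure μ] (B : ℝ → ℝ → ℂ)
    (hBm : Measurable (Function.uncurry B)) (hC : ∃ C, ∀ u v, ‖B u v‖ ≤ C) :
    PointKernel (ℝ × ℝ) 2 where
  measure := μ.prod μ
  -- Each unordered pair of points occurs in both orders in the product measure.
  coeff p := 2⁻¹ * B p.1 p.2
  pts p := ![p.1, p.2]
  finite := inferInstance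
  measurable_coeff := measurable_const.mul hBm
  bdd_coeff := hC.imp fun C h p => by
    rw [norm_mul]
    have := h p.1 p.2
    norm_num
    linarith [norm_nonneg (B p.1 p.2)]
  measurable_pts := by fun_prop

variable (μ : Measure ℝ) [IsFiniteMeasure μ] {B : ℝ → ℝ → ℂ}
    (hBm : Measurable (Function.uncurry B)) (hC : ∃ C, ∀ u v, ‖B u v‖ ≤ C)

theorem pairKernel_op_apply (h : confSpace E) (σ : Multiset ℝ) :
    (pairKernel μ B hBm hC).op h σ =
      (2 : ℂ)⁻¹ • ∫ v, ∫ u, B u v • h (u ::ₘ v ::ₘ σ) ∂μ ∂μ := by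
  have h1 := (pairKernel μ B hBm hC).integrable h σ
  rw [PointKernel.op_apply]
  simp only [pairKernel, mul_smul] at h1 ⊢
  rw [integral_smul]
  congr 1
  have h2 := ((integrable_smul_iff (c := (2 : ℂ)⁻¹) (by norm_num) _).1 h1)
  rw [integral_prod_symm _ h2]
  simp [← Multiset.cons_coe, Multiset.cons_add]

/-- Multiplication of functions of configurations by a scalar function. -/
def confMul (c : confSpace ℂ) (h : confSpace E) : confSpace E :=
  ((isConf_coe c).smul (isConf_coe h)).toSpace

@[simp] theorem confMul_apply (c : confSpace ℂ) (h : confSpace E) (σ : Multiset ℝ) :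
    confMul c h σ = c σ • h σ := rfl

/-- One integrated point `u` is singled out and the hafnian is expanded over its partner `v`. By
`pointOp_pow_sumErase` the sum over `v` among the remaining `m + 1` points becomes `m + 1` times an
integral over `v`; the factor `2` compensates the weight `B / 2`. -/
theorem pointOp_pow_haf_step [CompleteSpace E] (hB : ∀ u v, B u v = B v u)
    (H : confSpace ℂ) (hH : ∀ σ, H σ = haf B σ)
    (h : confSpace E) (m : ℕ) :
    (pointOp μ ^ (m + 2)) (confMul H h) 0 =
      (2 * ((m : ℂ) + 1)) • (pointOp μ ^ m) (confMul H ((pairKernel μ B hBm hC).op h)) 0 := by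
  have hI : IsConf fun (p : ℝ × ℝ) σ => B p.2 p.1 • h (p.2 ::ₘ p.1 ::ₘ σ) := by
    refine IsConf.smul (c := fun (p : ℝ × ℝ) _ => B p.2 p.1) (isConf_param ?_ ?_)
      ((isConf_coe h).cons.cons.comp (f := fun p : ℝ × ℝ => (((), p.2), p.1)) (by fun_prop))
    · exact (hBm.comp measurable_swap).stronglyMeasurable
    · exact hC.imp fun C h p => h _ _
  have hG : IsConf fun v σ => haf B σ • ∫ u, B u v • h (u ::ₘ v ::ₘ σ) ∂μ := by
    have hH' : IsConf fun (_ : ℝ) σ => haf B σ := (isConf_coe' H).congr fun _ σ => hH σ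
    exact hH'.smul (hI.integral μ)
  have h1 : pointOp μ (confMul H h) = (isConf_sumErase hG).toSpace := by
    ext σ
    simp only [pointOp_apply, confMul_apply, hH, haf_cons hB, IsConf.toSpace_apply]
    have hf : ∀ v, Integrable (fun u => haf B (σ.erase v) • B u v • h (u ::ₘ σ)) μ := by
      intro v
      refine Integrable.smul _ ?_
      refine (IsConf.smul (c := fun (u : ℝ) _ => B u v) (isConf_param ?_ ?_)
        ((isConf_coe h).cons.comp (f := fun u : ℝ => ((), u)) (by fun_prop))).integrable μ σ
      · exact (hBm.comp (f := fun u : ℝ => (u, v)) (by fun_prop)).stronglyMeasurable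
      · exact hC.imp fun C h p => h _ _
    have key := (integral_multiset_sum hf σ).2
    refine Eq.trans (integral_congr_ae (Filter.Eventually.of_forall fun u => ?_)) (key.trans ?_)
    · simp only [sumErase, Multiset.sum_smul, Multiset.map_map, Function.comp_def]
      simp only [mul_comm (B u _), mul_smul]
    · refine congrArg Multiset.sum (Multiset.map_congr rfl fun v hv => ?_)
      rw [integral_smul]
      simp only [Multiset.cons_erase hv]
  have h2 : hG.paramIntegral μ = (2 : ℂ) • confMul H ((pairKernel μ B hBm hC).op h) := by
    ext σ
    rw [IsConf.paramIntegral_apply, integral_smul, confSpace.smul_apply, confMul_apply, hH,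
      pairKernel_op_apply]
    rw [smul_comm (haf B σ), smul_smul]
    norm_num
  rw [pow_succ, Module.End.mul_apply, h1, pointOp_pow_sumErase μ hG, h2, map_smul,
    confSpace.smul_apply, smul_smul, mul_comm]

/-- Every two points are traded for one application of the pair operator. Of `(2 p + 2)(2 p + 1)` in
the factorial, the factor `2 (2 p + 1)` is cancelled by `pointOp_pow_haf_step` and `p + 1` remains,
so an integral of hafnians becomes a term of an exponential series. -/
theorem pointOp_pow_haf_even [CompleteSpace E] (hB : ∀ u v, B u v = B v u)
    (H : confSpace ℂ) (hH : ∀ σ, H σ = haf B σ)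
    (h : confSpace E) (p : ℕ) :
    ((2 * p).factorial : ℂ)⁻¹ • (pointOp μ ^ (2 * p)) (confMul H h) 0 =
      (p.factorial : ℂ)⁻¹ • ((pairKernel μ B hBm hC).op ^ p) h 0 := by
  induction p generalizing h with
  | zero => simp [hH]
  | succ p ih =>
    rw [show 2 * (p + 1) = 2 * p + 2 by ring, pointOp_pow_haf_step μ hBm hC hB H hH h,
      pow_succ, Module.End.mul_apply]
    have h1 : ((p + 1).factorial : ℂ)⁻¹ = ((p : ℂ) + 1)⁻¹ * (p.factorial : ℂ)⁻¹ := by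
      rw [Nat.factorial_succ]
      push_cast
      rw [mul_inv]
    have h2 : ((2 * p + 2).factorial : ℂ)⁻¹ * (2 * (((2 * p : ℕ) : ℂ) + 1)) =
        ((p : ℂ) + 1)⁻¹ * ((2 * p).factorial : ℂ)⁻¹ := by
      have h3 : (2 * (p : ℂ) + 1) ≠ 0 := by exact_mod_cast Nat.succ_ne_zero (2 * p)
      have h4 : (p : ℂ) + 1 ≠ 0 := by exact_mod_cast Nat.succ_ne_zero p
      have h5 : ((2 * p).factorial : ℂ) ≠ 0 := Nat.cast_ne_zero.2 (Nat.factorial_ne_zero _)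
      have h6 : (2 * (p : ℂ) + 1 + 1) = 2 * (p + 1) := by ring
      rw [Nat.factorial_succ, Nat.factorial_succ]
      push_cast
      rw [h6]
      field_simp
    rw [smul_smul, h2, h1, mul_smul, mul_smul, ih]

theorem pointOp_pow_haf_odd [CompleteSpace E] (hB : ∀ u v, B u v = B v u)
    (H : confSpace ℂ) (hH : ∀ σ, H σ = haf B σ)
    (h : confSpace E) (p : ℕ) : (pointOp μ ^ (2 * p + 1)) (confMul H h) 0 = 0 := by
  rw [pointOp_pow_congr μ (h' := 0) (P := fun _ => True) (by simp) (2 * p + 1) 0]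
  · simp; rfl
  · intro τ hτ _
    rw [add_zero, confMul_apply, hH, haf_eq_zero_of_odd hB p τ hτ, zero_smul]
    rfl

end PairOp
end

noncomputable section

/-! ### Pairings by recursion on the partner of the first point -/

section Pairings

theorem mem_pairings {m : ℕ} {q : Finset (Fin m × Fin m)} :
    q ∈ pairings m ↔
      (∀ p ∈ q, p.1 < p.2) ∧ ∀ i, ∃! p, p ∈ q ∧ (p.1 = i ∨ p.2 = i) := by
  simp [pairings]

/-- The order embedding of `m` points into `m + 2` points that omits `0` and `j + 1`. -/
def skipTwo {m : ℕ} (j : Fin (m + 1)) : Fin m ↪o Fin (m + 2) :=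
  j.succAboveOrderEmb.trans (Fin.succOrderEmb (m + 1))

theorem skipTwo_apply {m : ℕ} (j : Fin (m + 1)) (i : Fin m) :
    skipTwo j i = (j.succAbove i).succ := rfl

theorem skipTwo_ne_zero {m : ℕ} (j : Fin (m + 1)) (i : Fin m) : skipTwo j i ≠ 0 :=
  Fin.succ_ne_zero _

theorem skipTwo_ne_succ {m : ℕ} (j : Fin (m + 1)) (i : Fin m) : skipTwo j i ≠ j.succ := by
  rw [skipTwo_apply, Ne, Fin.succ_inj]
  exact Fin.succAbove_ne j i

theorem eq_zero_or_succ_or_skipTwo {m : ℕ} (j : Fin (m + 1)) (i : Fin (m + 2)) :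
    i = 0 ∨ i = j.succ ∨ ∃ k, i = skipTwo j k := by
  refine Fin.cases (Or.inl rfl) (fun i => Or.inr ?_) i
  rcases Fin.eq_self_or_eq_succAbove j i with rfl | ⟨k, rfl⟩
  · exact Or.inl rfl
  · exact Or.inr ⟨k, rfl⟩

/-- The extension of a pairing of `m` points by the pair `(0, j + 1)`. -/
def extendPairing {m : ℕ} (j : Fin (m + 1)) (q : Finset (Fin m × Fin m)) :
    Finset (Fin (m + 2) × Fin (m + 2)) :=
  insert (0, j.succ) (q.map ((skipTwo j).toEmbedding.prodMap (skipTwo j).toEmbedding))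

theorem mem_extendPairing {m : ℕ} {j : Fin (m + 1)} {q : Finset (Fin m × Fin m)}
    {p : Fin (m + 2) × Fin (m + 2)} :
    p ∈ extendPairing j q ↔
      p = (0, j.succ) ∨ ∃ a b, (a, b) ∈ q ∧ p = (skipTwo j a, skipTwo j b) := by
  simp only [extendPairing, Finset.mem_insert, Finset.mem_map, Prod.exists]
  refine or_congr Iff.rfl (exists_congr fun a => exists_congr fun b => and_congr Iff.rfl ?_)
  exact eq_comm

theorem skip_mem_extendPairing {m : ℕ} {j : Fin (m + 1)} {q : Finset (Fin m × Fin m)}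
    {a b : Fin m} : (skipTwo j a, skipTwo j b) ∈ extendPairing j q ↔ (a, b) ∈ q := by
  rw [mem_extendPairing]
  constructor
  · rintro (h | ⟨a', b', h, h'⟩)
    · exact absurd (Prod.ext_iff.1 h).1 (skipTwo_ne_zero j a)
    · obtain ⟨h1, h2⟩ := Prod.ext_iff.1 h'
      rw [(skipTwo j).injective h1, (skipTwo j).injective h2]
      exact h
  · exact fun h => Or.inr ⟨a, b, h, rfl⟩

theorem extendPairing_mem_pairings {m : ℕ} {j : Fin (m + 1)} {q : Finset (Fin m × Fin m)}
    (hq : q ∈ pairings m) : extendPairing j q ∈ pairings (m + 2) := by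
  rw [mem_pairings] at hq ⊢
  refine ⟨fun p hp => ?_, fun i => ?_⟩
  · rcases mem_extendPairing.1 hp with rfl | ⟨a, b, h, rfl⟩
    · exact Fin.succ_pos j
    · exact (skipTwo j).lt_iff_lt.2 (hq.1 _ h)
  · rcases eq_zero_or_succ_or_skipTwo j i with rfl | rfl | ⟨k, rfl⟩
    · refine ⟨(0, j.succ), ⟨mem_extendPairing.2 (Or.inl rfl), Or.inl rfl⟩, ?_⟩
      rintro p ⟨hp, h⟩
      rcases mem_extendPairing.1 hp with rfl | ⟨a, b, _, rfl⟩
      · rfl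
      · exact (h.elim (skipTwo_ne_zero j a) (skipTwo_ne_zero j b)).elim
    · refine ⟨(0, j.succ), ⟨mem_extendPairing.2 (Or.inl rfl), Or.inr rfl⟩, ?_⟩
      rintro p ⟨hp, h⟩
      rcases mem_extendPairing.1 hp with rfl | ⟨a, b, _, rfl⟩
      · rfl
      · exact (h.elim (skipTwo_ne_succ j a) (skipTwo_ne_succ j b)).elim
    · obtain ⟨⟨a, b⟩, ⟨hab, hk⟩, hu⟩ := hq.2 k
      refine ⟨(skipTwo j a, skipTwo j b), ⟨skip_mem_extendPairing.2 hab,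
        hk.imp (fun h => congrArg (skipTwo j) h) fun h => congrArg (skipTwo j) h⟩, ?_⟩
      rintro p ⟨hp, h⟩
      rcases mem_extendPairing.1 hp with rfl | ⟨a', b', h', rfl⟩
      · exact (h.elim (skipTwo_ne_zero j k).symm.elim (skipTwo_ne_succ j k).symm.elim)
      · have := hu (a', b') ⟨h', h.imp (fun h => (skipTwo j).injective h)
          (fun h => (skipTwo j).injective h)⟩
        obtain ⟨rfl, rfl⟩ := Prod.ext_iff.1 this
        rfl

theorem exists_eq_extendPairing {m : ℕ} {q : Finset (Fin (m + 2) × Fin (m + 2))}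
    (hq : q ∈ pairings (m + 2)) : ∃ j, ∃ q' ∈ pairings m, extendPairing j q' = q := by
  rw [mem_pairings] at hq
  have huniq : ∀ {i p p'}, p ∈ q → p' ∈ q → (p.1 = i ∨ p.2 = i) → (p'.1 = i ∨ p'.2 = i) →
      p = p' := fun {i p p'} h1 h2 h3 h4 => (hq.2 i).unique ⟨h1, h3⟩ ⟨h2, h4⟩
  obtain ⟨⟨z, w⟩, ⟨hzw, h0⟩, -⟩ := hq.2 0
  have hlt := hq.1 _ hzw
  obtain rfl : z = 0 := h0.resolve_right fun h => by
    simp only at h hlt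
    rw [h] at hlt
    exact absurd hlt (Fin.not_lt_zero z)
  obtain ⟨j, rfl⟩ := Fin.exists_succ_eq.2 (ne_of_gt hlt)
  have hcover : ∀ {p}, p ∈ q → p ≠ (0, j.succ) → ∃ a b, p = (skipTwo j a, skipTwo j b) := by
    rintro ⟨a, b⟩ hp hne
    have h1 : ∀ {i}, (a = i ∨ b = i) → i ≠ 0 ∧ i ≠ j.succ := fun {i} hi =>
      ⟨fun h => hne (huniq hp hzw hi (Or.inl h.symm)),
        fun h => hne (huniq hp hzw hi (Or.inr h.symm))⟩
    obtain ⟨a', rfl⟩ := ((eq_zero_or_succ_or_skipTwo j a).resolve_left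
      (h1 (Or.inl rfl)).1).resolve_left (h1 (Or.inl rfl)).2
    obtain ⟨b', rfl⟩ := ((eq_zero_or_succ_or_skipTwo j b).resolve_left
      (h1 (Or.inr rfl)).1).resolve_left (h1 (Or.inr rfl)).2
    exact ⟨a', b', rfl⟩
  refine ⟨j, Finset.univ.filter fun p => (skipTwo j p.1, skipTwo j p.2) ∈ q, ?_, ?_⟩
  · rw [mem_pairings]
    refine ⟨fun p hp => (skipTwo j).lt_iff_lt.1 (hq.1 _ (Finset.mem_filter.1 hp).2), fun k => ?_⟩
    obtain ⟨p, ⟨hp, hk⟩, -⟩ := hq.2 (skipTwo j k)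
    obtain ⟨a, b, rfl⟩ := hcover hp fun h => by
      subst h
      exact hk.elim (skipTwo_ne_zero j k).symm.elim (skipTwo_ne_succ j k).symm.elim
    refine ⟨(a, b), ⟨Finset.mem_filter.2 ⟨Finset.mem_univ _, hp⟩,
      hk.imp (fun h => (skipTwo j).injective h) fun h => (skipTwo j).injective h⟩, ?_⟩
    rintro ⟨a', b'⟩ ⟨h, h'⟩
    have := huniq (Finset.mem_filter.1 h).2 hp
      (h'.imp (fun h => congrArg (skipTwo j) h) fun h => congrArg (skipTwo j) h) hk
    obtain ⟨h1, h2⟩ := Prod.ext_iff.1 this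
    exact Prod.ext ((skipTwo j).injective h1) ((skipTwo j).injective h2)
  · ext p
    constructor
    · intro hp
      rcases mem_extendPairing.1 hp with rfl | ⟨a, b, h, rfl⟩
      · exact hzw
      · exact (Finset.mem_filter.1 h).2
    · intro hp
      by_cases h : p = (0, j.succ)
      · exact mem_extendPairing.2 (Or.inl h)
      · obtain ⟨a, b, rfl⟩ := hcover hp h
        exact skip_mem_extendPairing.2 (Finset.mem_filter.2 ⟨Finset.mem_univ _, hp⟩)

/-- A pairing is the same as the partner `j + 1` of the point `0` together with a pairing of the
remaining `m` points, relabelled in increasing order by `skipTwo`. -/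
theorem sum_pairings_add_two {m : ℕ} (b : Fin (m + 2) → Fin (m + 2) → ℂ) :
    ∑ q ∈ pairings (m + 2), ∏ p ∈ q, b p.1 p.2 =
      ∑ j : Fin (m + 1), b 0 j.succ *
        ∑ q ∈ pairings m, ∏ p ∈ q, b (skipTwo j p.1) (skipTwo j p.2) := by
  simp_rw [Finset.mul_sum]
  rw [← Finset.sum_product']
  symm
  refine Finset.sum_bij (fun x _ => extendPairing x.1 x.2) ?_ ?_ ?_ ?_
  · rintro ⟨j, q⟩ h
    exact extendPairing_mem_pairings (Finset.mem_product.1 h).2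
  · rintro ⟨j, q⟩ _ ⟨j', q'⟩ _ h
    have hj : j = j' := by
      have h1 : ((0 : Fin (m + 2)), j.succ) ∈ extendPairing j' q' := by
        rw [← h]
        exact mem_extendPairing.2 (Or.inl rfl)
      rcases mem_extendPairing.1 h1 with h2 | ⟨a, b, _, h2⟩
      · exact Fin.succ_injective _ (Prod.ext_iff.1 h2).2
      · exact absurd (Prod.ext_iff.1 h2).1.symm (skipTwo_ne_zero _ _)
    subst hj
    congr 1
    ext ⟨a, b⟩
    rw [← skip_mem_extendPairing (j := j), ← skip_mem_extendPairing (j := j)]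
    simp only at h
    rw [h]
  · intro q hq
    obtain ⟨j, q', hq', rfl⟩ := exists_eq_extendPairing hq
    exact ⟨(j, q'), by simpa using hq', rfl⟩
  · rintro ⟨j, q⟩ _
    rw [extendPairing, Finset.prod_insert, Finset.prod_map]
    · rfl
    · simp only [Finset.mem_map, not_exists, not_and]
      rintro ⟨a, b⟩ _ h
      exact skipTwo_ne_zero j a (Prod.ext_iff.1 h).1

/-- Both sides satisfy the same recursion in the first point, so the hafnian is the right-hand side
of Wick's theorem. -/
theorem sum_pairings_eq_haf {B : ℝ → ℝ → ℂ} (hB : ∀ u v, B u v = B v u) (m : ℕ)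
    (s : Fin m → ℝ) :
    ∑ q ∈ pairings m, ∏ p ∈ q, B (s p.1) (s p.2) = haf B (List.ofFn s) := by
  induction m using Nat.twoStepInduction with
  | zero =>
    have : pairings 0 = {∅} := by
      ext q
      rw [mem_pairings, Finset.mem_singleton]
      exact ⟨fun _ => Finset.eq_empty_of_isEmpty q, fun _ => ⟨fun p => p.1.elim0, fun i => i.elim0⟩⟩
    simp [this]
  | one =>
    rw [haf_eq_zero_of_odd hB 0 _ (by simp)]
    refine Finset.sum_eq_zero fun q hq => ?_
    obtain ⟨p, ⟨hp, -⟩, -⟩ := (mem_pairings.1 hq).2 0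
    have := (mem_pairings.1 hq).1 p hp
    omega
  | more m ih _ =>
    rw [sum_pairings_add_two fun a b => B (s a) (s b), List.ofFn_succ (n := m + 1),
      ← Multiset.cons_coe, haf_cons hB, sumErase_ofFn]
    refine Finset.sum_congr rfl fun j _ => ?_
    rw [ih fun i => s (skipTwo j i)]
    rfl

end Pairings
end

noncomputable section

/-! ### Exponentials of commuting integral operators -/

section Perturbation

theorem hasSum_antidiagonal {E : Type*} [NormedAddCommGroup E] {f : ℕ × ℕ → E} {a : E}
    (h : HasSum f a) :
    HasSum (fun n => ∑ p ∈ Finset.HasAntidiagonal.antidiagonal n, f p) a := by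
  have h1 := (Finset.HasAntidiagonal.sigmaAntidiagonalEquivProd (A := ℕ)).hasSum_iff.2 h
  refine h1.sigma fun n => ?_
  rw [← Finset.sum_coe_sort]
  exact hasSum_fintype _

/-- Evaluation of a function of configurations. -/
def confEval {E : Type*} [NormedAddCommGroup E] [NormedSpace ℂ E] (σ : Multiset ℝ) :
    confSpace E →ₗ[ℂ] E where
  toFun h := h σ
  map_add' _ _ := rfl
  map_smul' _ _ := rfl

theorem confEval_apply {E : Type*} [NormedAddCommGroup E] [NormedSpace ℂ E] (σ : Multiset ℝ)
    (h : confSpace E) : confEval σ h = h σ := rfl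

variable {Y Y' : Type*} [MeasurableSpace Y] [MeasurableSpace Y']

/-- Each application adds `d` points and so costs `M ^ d` times the total weight of the kernel; the
form of the bound is preserved, which closes the induction. -/
theorem PointKernel.norm_op_pow_le {d : ℕ} (κ : PointKernel Y d) {h : confSpace ℂ} {K M : ℝ}
    (hh : ∀ σ, ‖h σ‖ ≤ K * M ^ Multiset.card σ) (n : ℕ) (σ : Multiset ℝ) :
    ‖(κ.op ^ n) h σ‖ ≤
      (K * ((∫ y, ‖κ.coeff y‖ ∂κ.measure) * M ^ d) ^ n) * M ^ Multiset.card σ := by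
  induction n generalizing σ with
  | zero => simpa using hh σ
  | succ n ih =>
    rw [pow_succ', Module.End.mul_apply]
    refine (κ.norm_op_le _ (β := (K * ((∫ y, ‖κ.coeff y‖ ∂κ.measure) * M ^ d) ^ n) *
      M ^ (d + Multiset.card σ)) (Filter.Eventually.of_forall fun y => ?_)).trans (le_of_eq ?_)
    · simpa using ih (↑(List.ofFn (κ.pts y)) + σ)
    · ring

theorem isConf_tsum {h : ℕ → confSpace ℂ} {K M : ℝ} {b : ℕ → ℝ} (hb : Summable b)
    (hh : ∀ l σ, ‖h l σ‖ ≤ b l * (K * M ^ Multiset.card σ)) :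
    ∃ H : confSpace ℂ, ConfHasSum h H ∧ ∀ σ, H σ = ∑' l, h l σ := by
  have hs : ∀ σ, Summable fun l => h l σ := fun σ =>
    (hb.mul_right (K * M ^ Multiset.card σ)).of_norm_bounded fun l => hh l σ
  have hbd : ∀ n, ∃ C, ∀ (F : Finset ℕ) (σ : Multiset ℝ), Multiset.card σ = n →
      ∑ i ∈ F, ‖h i σ‖ ≤ C := by
    intro n
    refine ⟨∑' l, ‖b l * (K * M ^ n)‖, fun F σ hσ => ?_⟩
    refine (Finset.sum_le_sum fun l _ => (hh l σ).trans (le_abs_self _)).trans ?_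
    rw [hσ]
    exact (hb.mul_right (K * M ^ n)).norm.sum_le_tsum F fun _ _ => abs_nonneg _
  have hconf : IsConf fun _ : Unit => fun σ => ∑' l, h l σ := by
    refine ⟨fun n => ?_, fun n => (hbd n).imp fun C hC _ σ hσ => ?_⟩
    · refine stronglyMeasurable_of_tendsto Filter.atTop
        (fun N => Finset.stronglyMeasurable_fun_sum (Finset.range N)
          fun l _ => (isConf_coe (h l)).meas n) ?_
      exact tendsto_pi_nhds.2 fun p => (hs _).hasSum.tendsto_sum_nat
    · refine le_of_tendsto (hs σ).hasSum.norm (Filter.Eventually.of_forall fun F => ?_)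
      exact (norm_sum_le _ _).trans (hC F σ hσ)
  exact ⟨hconf.toSpace, ⟨fun σ => (hs σ).hasSum, hbd⟩, fun σ => rfl⟩

/-- Perturbation bound for the exponential of an integral operator on functions of
configurations. -/
theorem norm_exp_op_sub_le {d : ℕ} (κ : PointKernel Y d) (κ' : PointKernel Y' d)
    (J' : Module.End ℂ (confSpace ℂ)) (hJ : J' = κ'.op + κ.op) (f : confSpace ℂ) {K M : ℝ}
    (hM : 0 ≤ M) (hf : ∀ σ, ‖f σ‖ ≤ K * M ^ Multiset.card σ)
    (hg : ∀ σ, ‖∑' l : ℕ, (l.factorial : ℂ)⁻¹ • (κ.op ^ l) f σ‖ ≤ K * M ^ Multiset.card σ) :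
    ‖∑' p : ℕ, (p.factorial : ℂ)⁻¹ • (J' ^ p) f 0 -
        ∑' l : ℕ, (l.factorial : ℂ)⁻¹ • (κ.op ^ l) f 0‖
      ≤ K * (Real.exp ((∫ y, ‖κ'.coeff y‖ ∂κ'.measure) * M ^ d) - 1) := by
  set a := (∫ y, ‖κ'.coeff y‖ ∂κ'.measure) * M ^ d with ha
  set b := (∫ y, ‖κ.coeff y‖ ∂κ.measure) * M ^ d with hb
  have ha0 : 0 ≤ a := mul_nonneg (integral_nonneg fun _ => norm_nonneg _) (pow_nonneg hM d)
  have hb0 : 0 ≤ b := mul_nonneg (integral_nonneg fun _ => norm_nonneg _) (pow_nonneg hM d)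
  -- Here `g` is `exp(κ) f`. Its series converges because of the bound on `f`, but its size is
  -- controlled by the hypothesis `hg`, without a factor `exp b`.
  obtain ⟨g, hgs, hgv⟩ := isConf_tsum (h := fun l : ℕ => (l.factorial : ℂ)⁻¹ • (κ.op ^ l) f)
    (K := K) (M := M) (Real.summable_pow_div_factorial b) fun l σ => by
      rw [confSpace.smul_apply, norm_smul, norm_inv, Complex.norm_natCast]
      calc _ ≤ ((l.factorial : ℝ))⁻¹ * (K * b ^ l * M ^ Multiset.card σ) := by
            gcongr
            exact κ.norm_op_pow_le hf l σ
        _ = _ := by ring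
  have hgb : ∀ σ, ‖g σ‖ ≤ K * M ^ Multiset.card σ := fun σ => by
    rw [hgv]
    exact hg σ
  -- The double series of `exp(κ') exp(κ) f`; grouped along antidiagonals it is `exp(J') f`, since
  -- the operators commute.
  set T : ℕ × ℕ → ℂ := fun p => ((p.1.factorial : ℂ)⁻¹ * (p.2.factorial : ℂ)⁻¹) •
    (κ'.op ^ p.1) ((κ.op ^ p.2) f) 0 with hT
  have hTs : Summable T := by
    refine (((Real.summable_pow_div_factorial a).mul_of_nonneg (Real.summable_pow_div_factorial b)
      (fun n => by positivity) (fun n => by positivity)).mul_left K).of_norm_bounded fun p => ?_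
    rw [hT]
    simp only [norm_smul, norm_mul, norm_inv, Complex.norm_natCast]
    calc _ ≤ ((p.1.factorial : ℝ)⁻¹ * (p.2.factorial : ℝ)⁻¹) *
          ((K * b ^ p.2 * a ^ p.1) * M ^ Multiset.card (0 : Multiset ℝ)) := by
          gcongr
          exact κ'.norm_op_pow_le (κ.norm_op_pow_le hf p.2) p.1 0
      _ = _ := by simp; ring
  have h1 : ∑' p : ℕ, (p.factorial : ℂ)⁻¹ • (J' ^ p) f 0 = ∑' p, T p := by
    rw [← (hasSum_antidiagonal hTs.hasSum).tsum_eq]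
    refine tsum_congr fun p => ?_
    have := congrArg (fun h : confSpace ℂ => h 0)
      (pow_div_factorial_add (κ'.op_commute κ) p f)
    rw [hJ]
    refine this.trans ?_
    rw [← confEval_apply, map_sum]
    rfl
  have h2 : ∀ n, HasSum (fun l => T (n, l)) ((n.factorial : ℂ)⁻¹ • (κ'.op ^ n) g 0) := by
    intro n
    have := ((hgs.op_pow κ' n).hasSum 0).const_smul (n.factorial : ℂ)⁻¹
    simpa [hT, mul_assoc] using this
  have h3 := hTs.hasSum.prod_fiberwise h2
  have h4 := h3.summable.tsum_eq_zero_add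
  rw [h1, ← h3.tsum_eq, h4]
  have h5 : ((0 : ℕ).factorial : ℂ)⁻¹ • (κ'.op ^ 0) g 0 =
      ∑' l : ℕ, (l.factorial : ℂ)⁻¹ • (κ.op ^ l) f 0 := by
    simpa using hgv 0
  rw [h5, add_sub_cancel_left]
  have h6 : HasSum (fun n : ℕ => K * (a ^ (n + 1) / (n + 1).factorial)) (K * (Real.exp a - 1)) := by
    have h7 := NormedSpace.expSeries_div_hasSum_exp (𝔸 := ℝ) a
    rw [← Real.exp_eq_exp_ℝ] at h7
    have h8 := (hasSum_nat_add_iff' 1).2 h7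
    simpa using h8.mul_left K
  -- The term `n = 0` has been cancelled by `exp(κ) f`. The others are powers of `κ'` applied to
  -- `g`, so `b` does not enter the result.
  refine tsum_of_norm_bounded h6 fun n => ?_
  rw [norm_smul, norm_inv, Complex.norm_natCast]
  calc _ ≤ ((n + 1).factorial : ℝ)⁻¹ *
        (K * a ^ (n + 1) * M ^ Multiset.card (0 : Multiset ℝ)) := by
        gcongr
        exact κ'.norm_op_pow_le hgb (n + 1) 0
    _ = _ := by simp; ring

end Perturbation

/-! ### Functions of the forward and the backward part of a configuration -/

section Contour

theorem IsConf.filter {X E : Type*} [MeasurableSpace X] [NormedAddCommGroup E]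
    {G : X → Multiset ℝ → E} (hG : IsConf G) (P : ℝ → Prop) [DecidablePred P]
    (hP : MeasurableSet {u | P u}) : IsConf fun x σ => G x (σ.filter P) := by
  refine ⟨fun n => ?_, fun n => ?_⟩
  · induction n generalizing X with
    | zero =>
      simpa using hG.meas 0
    | succ n ih =>
      have h1 := (ih hG.cons).comp_measurable
        (g := fun p : X × (Fin (n + 1) → ℝ) => ((p.1, p.2 0), fun i : Fin n => p.2 i.succ))
        (by fun_prop)
      have h2 := (ih hG).comp_measurable
        (g := fun p : X × (Fin (n + 1) → ℝ) => (p.1, fun i : Fin n => p.2 i.succ)) (by fun_prop)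
      have h3 : StronglyMeasurable fun p : X × (Fin (n + 1) → ℝ) => if P (p.2 0)
          then G p.1 (p.2 0 ::ₘ Multiset.filter P ↑(List.ofFn fun i : Fin n => p.2 i.succ))
          else G p.1 (Multiset.filter P ↑(List.ofFn fun i : Fin n => p.2 i.succ)) :=
        StronglyMeasurable.ite (hP.preimage (f := fun p : X × (Fin (n + 1) → ℝ) => p.2 0)
          (by fun_prop)) h1 h2
      convert h3 using 2 with p
      rw [List.ofFn_succ, ← Multiset.cons_coe, Multiset.filter_cons]
      split_ifs <;> simp
  · choose C hC using hG.bdd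
    refine ⟨∑ k ∈ Finset.range (n + 1), |C k|, fun x σ hσ => ?_⟩
    refine (hC (Multiset.card (σ.filter P)) x _ rfl).trans ((le_abs_self _).trans ?_)
    refine Finset.single_le_sum (f := fun k => |C k|) (fun _ _ => abs_nonneg _)
      (Finset.mem_range.2 ?_)
    have := Multiset.card_le_card (Multiset.filter_le P σ)
    omega

theorem IsConf.map {X E : Type*} [MeasurableSpace X] [NormedAddCommGroup E]
    {G : X → Multiset ℝ → E} (hG : IsConf G) {φ : ℝ → ℝ} (hφ : Measurable φ) :
    IsConf fun x σ => G x (σ.map φ) := by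
  refine ⟨fun n => ?_, fun n => (hG.bdd n).imp fun C h x σ hσ => h x _ (by simpa using hσ)⟩
  have := (hG.meas n).comp_measurable
    (g := fun p : X × (Fin n → ℝ) => (p.1, fun i => φ (p.2 i))) (by fun_prop)
  simpa only [Multiset.map_coe, List.map_ofFn, Function.comp_def] using this

/-- The points of a configuration on the forward branch of the contour. -/
def fwd (t : ℝ) (σ : Multiset ℝ) : Multiset ℝ := σ.filter (· < t)

/-- The points of a configuration on the backward branch of the contour, as times. -/
def bwd (t : ℝ) (σ : Multiset ℝ) : Multiset ℝ := (σ.filter fun u => ¬u < t).map fun u => 2 * t - u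

@[simp] theorem fwd_zero (t : ℝ) : fwd t 0 = 0 := rfl
@[simp] theorem bwd_zero (t : ℝ) : bwd t 0 = 0 := rfl

theorem fwd_add (t : ℝ) (σ τ : Multiset ℝ) : fwd t (σ + τ) = fwd t σ + fwd t τ :=
  Multiset.filter_add _ _ _

theorem bwd_add (t : ℝ) (σ τ : Multiset ℝ) : bwd t (σ + τ) = bwd t σ + bwd t τ := by
  simp [bwd, Multiset.filter_add]

theorem fwd_cons_of_lt {t u : ℝ} (h : u < t) (σ : Multiset ℝ) : fwd t (u ::ₘ σ) = u ::ₘ fwd t σ :=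
  Multiset.filter_cons_of_pos _ h

theorem fwd_cons_of_le {t u : ℝ} (h : t ≤ u) (σ : Multiset ℝ) : fwd t (u ::ₘ σ) = fwd t σ :=
  Multiset.filter_cons_of_neg _ h.not_gt

theorem bwd_cons_of_lt {t u : ℝ} (h : u < t) (σ : Multiset ℝ) : bwd t (u ::ₘ σ) = bwd t σ := by
  rw [bwd, Multiset.filter_cons_of_neg (p := fun u => ¬u < t) _ (not_not.2 h), bwd]

theorem bwd_cons_of_le {t u : ℝ} (h : t ≤ u) (σ : Multiset ℝ) :
    bwd t (u ::ₘ σ) = (2 * t - u) ::ₘ bwd t σ := by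
  rw [bwd, Multiset.filter_cons_of_pos (p := fun u => ¬u < t) _ h.not_gt, Multiset.map_cons, bwd]

theorem card_fwd_add_card_bwd (t : ℝ) (σ : Multiset ℝ) :
    Multiset.card (fwd t σ) + Multiset.card (bwd t σ) = Multiset.card σ := by
  rw [fwd, bwd, Multiset.card_map, ← Multiset.card_add, Multiset.filter_add_not]

variable {E : Type*} [NormedAddCommGroup E] [InnerProductSpace ℂ E] (t : ℝ) (T : E →L[ℂ] E)

theorem isConf_contourPair (P Q : confSpace E) :
    IsConf fun _ : Unit => fun σ => inner ℂ (P (bwd t σ)) (T (Q (fwd t σ))) := by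
  have h1 : IsConf fun _ : Unit => fun σ => P (bwd t σ) :=
    ((isConf_coe P).map (φ := fun u => 2 * t - u) (by fun_prop)).filter (fun u => ¬u < t)
      measurableSet_Iio.compl
  have h2 : IsConf fun _ : Unit => fun σ => Q (fwd t σ) :=
    (isConf_coe Q).filter (fun u => u < t) measurableSet_Iio
  refine h1.map₂ h2 (φ := fun a b => inner ℂ a (T b)) ?_ (norm_nonneg T) fun a b => ?_
  · exact continuous_fst.inner (T.continuous.comp continuous_snd)
  · calc ‖(inner ℂ a (T b) : ℂ)‖ ≤ ‖a‖ * (‖T‖ * ‖b‖) :=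
          (norm_inner_le_norm _ _).trans (by gcongr; exact T.le_opNorm b)
      _ = _ := by ring

/-- The function of configurations on the contour that is the matrix element of `T` between the
values of `P` at the backward part and of `Q` at the forward part. -/
def contourPair (P Q : confSpace E) : confSpace ℂ := (isConf_contourPair t T P Q).toSpace

theorem contourPair_apply (P Q : confSpace E) (σ : Multiset ℝ) :
    contourPair t T P Q σ = inner ℂ (P (bwd t σ)) (T (Q (fwd t σ))) := rfl

theorem integrable_cons (μ : Measure ℝ) [IsFiniteMeasure μ] (Q : confSpace E)
    (σ : Multiset ℝ) : Integrable (fun u => Q (u ::ₘ σ)) μ :=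
  ((isConf_coe Q).cons.comp (f := fun u : ℝ => ((), u)) (by fun_prop)).integrable μ σ

/-- A point before the turning time `t` enters only the forward argument, so its integral passes
through the bounded operator and the inner product. -/
theorem pointOp_contourPair_fwd [CompleteSpace E] (P Q : confSpace E) :
    pointOp (volume.restrict (Set.Ioo 0 t)) (contourPair t T P Q) =
      contourPair t T P (pointOp (volume.restrict (Set.Ioo 0 t)) Q) := by
  ext σ
  rw [pointOp_apply, contourPair_apply, pointOp_apply,
    ← T.integral_comp_comm (integrable_cons _ Q _), ← integral_inner
      (T.integrable_comp (integrable_cons _ Q _))]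
  refine setIntegral_congr_fun measurableSet_Ioo fun u hu => ?_
  simp only [contourPair_apply, fwd_cons_of_lt hu.2, bwd_cons_of_lt hu.2]

theorem setIntegral_reflect {F : Type*} [NormedAddCommGroup F] [NormedSpace ℝ F] {t : ℝ}
    (ht : 0 ≤ t) (f : ℝ → F) :
    ∫ u in Set.Ioo t (2 * t), f (2 * t - u) = ∫ u in Set.Ioo 0 t, f u := by
  rw [← integral_Ioc_eq_integral_Ioo, ← integral_Ioc_eq_integral_Ioo,
    ← intervalIntegral.integral_of_le (by linarith), ← intervalIntegral.integral_of_le ht,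
    intervalIntegral.integral_comp_sub_left (fun u => f u)]
  ring_nf

/-- A point after `t` enters only the backward argument, as `2 t - u`; the reflection preserves
Lebesgue measure, and the conjugate-linear slot is reached by complex conjugation. -/
theorem pointOp_contourPair_bwd [CompleteSpace E] (ht : 0 ≤ t) (P Q : confSpace E) :
    pointOp (volume.restrict (Set.Ioo t (2 * t))) (contourPair t T P Q) =
      contourPair t T (pointOp (volume.restrict (Set.Ioo 0 t)) P) Q := by
  ext σ
  rw [pointOp_apply, contourPair_apply, pointOp_apply, ← inner_conj_symm,
    ← integral_inner (integrable_cons _ P _), ← integral_conj,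
    ← setIntegral_reflect ht]
  refine setIntegral_congr_fun measurableSet_Ioo fun u hu => ?_
  simp only [contourPair_apply, fwd_cons_of_le hu.1.le, bwd_cons_of_le hu.1.le, inner_conj_symm]

theorem pointOp_pow_contourPair [CompleteSpace E] (ht : 0 ≤ t) (P Q : confSpace E) (a b : ℕ) :
    (pointOp (volume.restrict (Set.Ioo 0 t)) ^ a)
      ((pointOp (volume.restrict (Set.Ioo t (2 * t))) ^ b) (contourPair t T P Q)) =
      contourPair t T ((pointOp (volume.restrict (Set.Ioo 0 t)) ^ b) P)
        ((pointOp (volume.restrict (Set.Ioo 0 t)) ^ a) Q) := by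
  have h1 : (pointOp (volume.restrict (Set.Ioo t (2 * t))) ^ b) (contourPair t T P Q) =
      contourPair t T ((pointOp (volume.restrict (Set.Ioo 0 t)) ^ b) P) Q := by
    induction b with
    | zero => rfl
    | succ b ih =>
      rw [pow_succ', pow_succ', Module.End.mul_apply, Module.End.mul_apply, ih,
        pointOp_contourPair_bwd t T ht]
  rw [h1]
  induction a with
  | zero => rfl
  | succ a ih =>
    rw [pow_succ', pow_succ', Module.End.mul_apply, Module.End.mul_apply, ih,
      pointOp_contourPair_fwd]

omit E [NormedAddCommGroup E] [InnerProductSpace ℂ E] t T in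
theorem restrict_Ioo_split {a b c : ℝ} (hab : a ≤ b) (hbc : b ≤ c) :
    (volume.restrict (Set.Ioo a c) : Measure ℝ) =
      volume.restrict (Set.Ioo a b) + volume.restrict (Set.Ioo b c) := by
  rw [← Measure.restrict_union (Set.disjoint_left.2 fun u h h' => lt_asymm h.2 h'.1)
    measurableSet_Ioo]
  refine Measure.restrict_congr_set ?_
  have h1 : ∀ᵐ u : ℝ, u ≠ b := by simp [ae_iff]
  refine Filter.eventuallyEq_set.2 (h1.mono fun u hu => ?_)
  simp only [Set.mem_Ioo, Set.mem_union]
  constructor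
  · rintro ⟨h, h'⟩
    rcases lt_or_gt_of_ne hu with h2 | h2
    · exact Or.inl ⟨h, h2⟩
    · exact Or.inr ⟨h2, h'⟩
  · rintro (h | h)
    · exact ⟨h.1, by linarith [h.2]⟩
    · exact ⟨by linarith [h.1], h.2⟩

end Contour
end

noncomputable section

/-! ### Elementary tensors and operators on the composite system -/

section Tensor

variable {S K : Type*} [NormedAddCommGroup S] [InnerProductSpace ℂ S]
  [NormedAddCommGroup K] [InnerProductSpace ℂ K]

/-- The elementary tensors, as a continuous bilinear map. -/
def tensL (S K : Type*) [NormedAddCommGroup S] [InnerProductSpace ℂ S]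
    [NormedAddCommGroup K] [InnerProductSpace ℂ K] : S →L[ℂ] K →L[ℂ] Joint S K :=
  (ContinuousLinearMap.compL ℂ K (S ⊗[ℂ] K) (Joint S K) UniformSpace.Completion.toComplL).comp
    (TensorProduct.mkL ℂ S K)

theorem tensL_apply (x : S) (y : K) : tensL S K x y = tens x y := rfl

theorem inner_tens (x x' : S) (y y' : K) :
    inner ℂ (tens x y) (tens x' y') = inner ℂ x x' * inner ℂ y y' := by
  rw [tens, tens, UniformSpace.Completion.inner_coe, TensorProduct.inner_tmul]

theorem norm_tens (x : S) (y : K) : ‖tens x y‖ = ‖x‖ * ‖y‖ := by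
  rw [tens, UniformSpace.Completion.norm_coe, TensorProduct.norm_tmul]

theorem continuous_tens : Continuous fun p : S × K => tens p.1 p.2 :=
  (tensL S K).continuous₂

theorem denseRange_toComplL :
    DenseRange (UniformSpace.Completion.toComplL (𝕜 := ℂ) (E := S ⊗[ℂ] K)) :=
  UniformSpace.Completion.denseRange_coe

theorem opTensor_coe (A : S →L[ℂ] S) (B : K →L[ℂ] K) (x : S ⊗[ℂ] K) :
    opTensor A B (x : Joint S K) = (TensorProduct.mapL A B x : S ⊗[ℂ] K) :=
  ContinuousLinearMap.extend_eq _ denseRange_toComplL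
    (UniformSpace.Completion.isUniformInducing_coe _) x

theorem opTensor_tens (A : S →L[ℂ] S) (B : K →L[ℂ] K) (x : S) (y : K) :
    opTensor A B (tens x y) = tens (A x) (B y) := by
  rw [tens, opTensor_coe, TensorProduct.mapL_tmul, tens]

theorem norm_opTensor_le (A : S →L[ℂ] S) (B : K →L[ℂ] K) : ‖opTensor A B‖ ≤ ‖A‖ * ‖B‖ := by
  refine ContinuousLinearMap.opNorm_le_bound _ (by positivity) fun v => ?_
  induction v using UniformSpace.Completion.induction_on with
  | hp => exact isClosed_le (by fun_prop) (by fun_prop)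
  | ih x =>
    rw [opTensor_coe, UniformSpace.Completion.norm_coe, UniformSpace.Completion.norm_coe]
    exact (ContinuousLinearMap.le_opNorm _ _).trans
      (mul_le_mul_of_nonneg_right (TensorProduct.norm_mapL_le A B) (norm_nonneg _))

theorem norm_opTensor_one_le (A : S →L[ℂ] S) : ‖opTensor A (1 : K →L[ℂ] K)‖ ≤ ‖A‖ :=
  (norm_opTensor_le A 1).trans
    (mul_le_of_le_one_right (norm_nonneg _) ContinuousLinearMap.norm_id_le)

theorem clm_ext_tens {F : Type*} [NormedAddCommGroup F] [NormedSpace ℂ F]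
    {f g : Joint S K →L[ℂ] F} (h : ∀ x y, f (tens x y) = g (tens x y)) : f = g := by
  ext v
  induction v using UniformSpace.Completion.induction_on with
  | hp => exact isClosed_eq f.continuous g.continuous
  | ih x =>
    induction x using TensorProduct.induction_on with
    | zero => rw [UniformSpace.Completion.coe_zero, map_zero, map_zero]
    | tmul x y => exact h x y
    | add a b ha hb => rw [UniformSpace.Completion.coe_add, map_add, map_add, ha, hb]

end Tensor

/-! ### One-parameter groups and self-adjoint operators -/

section Group

variable {E : Type*} [NormedAddCommGroup E] [InnerProductSpace ℂ E] [CompleteSpace E]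
  {H : E →ₗ.[ℂ] E} {U : ℝ → E →L[ℂ] E}

namespace IsEvolutionGroup

variable (hU : IsEvolutionGroup H U)
include hU

theorem apply_add (σ τ : ℝ) (x : E) : U (σ + τ) x = U σ (U τ x) := by rw [hU.add]; rfl

theorem apply_zero (x : E) : U 0 x = x := by rw [hU.zero]; rfl

theorem norm_apply (τ : ℝ) (x : E) : ‖U τ x‖ = ‖x‖ :=
  ContinuousLinearMap.norm_map_of_mem_unitary (hU.unitary τ) x

theorem norm_le_one (τ : ℝ) : ‖U τ‖ ≤ 1 :=
  ContinuousLinearMap.opNorm_le_bound _ zero_le_one fun x => by rw [hU.norm_apply, one_mul]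

theorem inner_apply_apply (τ : ℝ) (x y : E) : inner ℂ (U τ x) (U τ y) = inner ℂ x y :=
  ContinuousLinearMap.inner_map_map_of_mem_unitary (hU.unitary τ) x y

theorem inner_apply_left (τ : ℝ) (x y : E) : inner ℂ (U τ x) y = inner ℂ x (U (-τ) y) := by
  rw [← hU.inner_apply_apply (-τ), ← hU.apply_add, neg_add_cancel, hU.apply_zero]

theorem apply_neg_apply (τ : ℝ) (x : E) : U τ (U (-τ) x) = x := by
  rw [← hU.apply_add, add_neg_cancel, hU.apply_zero]

theorem continuous_uncurry : Continuous fun p : ℝ × E => U p.1 p.2 := by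
  rw [continuous_iff_continuousAt]
  rintro ⟨τ, x⟩
  rw [ContinuousAt, tendsto_iff_norm_sub_tendsto_zero]
  have h1 : Filter.Tendsto (fun p : ℝ × E => ‖p.2 - x‖ + ‖U p.1 x - U τ x‖) (nhds (τ, x))
      (nhds 0) := by
    have : Continuous fun p : ℝ × E => ‖p.2 - x‖ + ‖U p.1 x - U τ x‖ :=
      (continuous_snd.sub continuous_const).norm.add
        (((hU.continuous x).comp continuous_fst).sub continuous_const).norm
    simpa using this.tendsto (τ, x)
  refine squeeze_zero (fun _ => norm_nonneg _) (fun p => ?_) h1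
  calc ‖U p.1 p.2 - U τ x‖ = ‖U p.1 (p.2 - x) + (U p.1 x - U τ x)‖ := by rw [map_sub]; abel_nf
    _ ≤ _ := (norm_add_le _ _).trans (by rw [hU.norm_apply])

theorem apply_mem_graph {x y : E} (h : (x, y) ∈ H.graph) (s : ℝ) : (U s x, U s y) ∈ H.graph := by
  rw [hU.generator] at h ⊢
  have h1 := ((U s).restrictScalars ℝ).hasFDerivAt.comp_hasDerivAt (0 : ℝ) h
  have h2 : (fun τ => U τ (U s x)) = fun τ => U s (U τ x) := funext fun τ => by
    rw [← hU.apply_add, ← hU.apply_add, add_comm]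
  rw [h2]
  simpa [Function.comp_def] using h1

theorem hasDerivAt {x y : E} (h : (x, y) ∈ H.graph) (s : ℝ) :
    HasDerivAt (fun τ => U τ x) (-(Complex.I • U s y)) s := by
  have h1 := (hU.generator _ _).1 (hU.apply_mem_graph h s)
  have h2 : HasDerivAt (fun τ : ℝ => τ - s) 1 s := (hasDerivAt_id s).sub_const s
  have h3 := HasDerivAt.scomp s (h := fun τ : ℝ => τ - s)
    (by simpa using h1) h2
  simpa [Function.comp_def, ← hU.apply_add] using h3

/-- The function `exp (i ε τ) U τ x` has derivative zero. -/
theorem apply_eigenvector {x : E} {ε : ℝ} (h : (x, (ε : ℂ) • x) ∈ H.graph) (s : ℝ) :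
    ∃ c : ℂ, U s x = c • x := by
  have h1 : ∀ τ, HasDerivAt (fun τ : ℝ => Complex.exp (Complex.I * ε * τ) • U τ x) 0 τ := by
    intro τ
    have h2 : HasDerivAt (fun τ : ℝ => Complex.exp (Complex.I * ε * τ))
        (Complex.exp (Complex.I * ε * τ) * (Complex.I * ε)) τ := by
      have h3 : HasDerivAt (fun τ : ℝ => Complex.I * ε * (τ : ℂ)) (Complex.I * ε) τ := by
        simpa using (Complex.ofRealCLM.hasDerivAt (x := τ)).const_mul (Complex.I * ε)
      exact h3.cexp
    refine (h2.fun_smul (hU.hasDerivAt h τ)).congr_deriv ?_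
    rw [map_smul]
    module
  have h4 := is_const_of_deriv_eq_zero (fun τ => (h1 τ).differentiableAt)
    (fun τ => (h1 τ).deriv) s 0
  refine ⟨(Complex.exp (Complex.I * ε * s))⁻¹, ?_⟩
  rw [eq_inv_smul_iff₀ (Complex.exp_ne_zero _)]
  simpa [hU.apply_zero] using h4

end IsEvolutionGroup

theorem symmetric_of_isSelfAdjoint (hH : IsSelfAdjoint H) {x x' y y' : E}
    (hx : (x, x') ∈ H.graph) (hy : (y, y') ∈ H.graph) : inner ℂ x' y = inner ℂ x y' := by
  have h := LinearPMap.adjoint_isFormalAdjoint hH.dense_domain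
  rw [LinearPMap.isSelfAdjoint_def.1 hH] at h
  obtain ⟨a, rfl, rfl⟩ := (LinearPMap.mem_graph_iff H).1 hx
  obtain ⟨b, rfl, rfl⟩ := (LinearPMap.mem_graph_iff H).1 hy
  exact h a b

/-- The graph of a self-adjoint operator equals that of its adjoint, so membership can be tested
weakly. This brings integrals of vectors of the domain into the domain. -/
theorem mem_graph_of_isSelfAdjoint (hH : IsSelfAdjoint H) {y v : E}
    (h : ∀ x x', (x, x') ∈ H.graph → inner ℂ x' y = inner ℂ x v) : (y, v) ∈ H.graph := by
  have h1 : ∀ x : H.domain, inner ℂ v (x : E) = inner ℂ y (H x) := fun x => by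
    rw [← inner_conj_symm, ← h x (H x) (H.mem_graph x), inner_conj_symm]
  have h2 : y ∈ H.adjoint.domain := H.mem_adjoint_domain_of_exists y ⟨v, h1⟩
  have h3 := LinearPMap.adjoint_apply_eq hH.dense_domain ⟨y, h2⟩ h1
  have h4 : (y, v) ∈ H.adjoint.graph := (LinearPMap.mem_graph_iff _).2 ⟨⟨y, h2⟩, rfl, h3⟩
  rwa [LinearPMap.isSelfAdjoint_def.1 hH] at h4

omit [CompleteSpace E] in
theorem applyOp_mem_graph {W : E →ₗ.[ℂ] E} {x : E} (h : x ∈ W.domain) :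
    (x, applyOp W x) ∈ W.graph := by
  rw [applyOp, dif_pos h]
  exact W.mem_graph ⟨x, h⟩

omit [CompleteSpace E] in
theorem eq_applyOp_of_mem_graph {W : E →ₗ.[ℂ] E} {x y : E} (h : (x, y) ∈ W.graph) :
    x ∈ W.domain ∧ y = applyOp W x := by
  obtain ⟨a, rfl, rfl⟩ := (LinearPMap.mem_graph_iff W).1 h
  exact ⟨a.2, by rw [applyOp, dif_pos a.2]⟩

theorem inner_applyOp (hH : IsSelfAdjoint H) {x y : E} (hx : x ∈ H.domain) (hy : y ∈ H.domain) :
    inner ℂ (applyOp H x) y = inner ℂ x (applyOp H y) :=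
  symmetric_of_isSelfAdjoint hH (applyOp_mem_graph hx) (applyOp_mem_graph hy)

end Group
end

noncomputable section

/-! ### Duhamel's formula with an unbounded bath coupling -/

section Duhamel

variable {S K ι : Type*}
    [NormedAddCommGroup S] [InnerProductSpace ℂ S] [CompleteSpace S]
    [NormedAddCommGroup K] [InnerProductSpace ℂ K] [CompleteSpace K]
    {Hs : S →ₗ.[ℂ] S} {Us : ℝ → S →L[ℂ] S} {Ws : S →L[ℂ] S}
    {Hb : K →ₗ.[ℂ] K} {Ub : ℝ → K →L[ℂ] K} {Wb : K →ₗ.[ℂ] K}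
    {H : Joint S K →ₗ.[ℂ] Joint S K} {U : ℝ → Joint S K →L[ℂ] Joint S K}

/-- The orbit `r ↦ exp (-i r Hb) y` stays in the domain of `Wb` for `0 < r < T`, and its image is
bounded. -/
structure CouplingDomain (Ub : ℝ → K →L[ℂ] K) (Wb : K →ₗ.[ℂ] K) (y : K) (T : ℝ) : Prop where
  mem : ∀ r, 0 < r → r < T → Ub r y ∈ Wb.domain
  bdd : ∃ M, ∀ r, 0 < r → r < T → ‖applyOp Wb (Ub r y)‖ ≤ M

theorem intervalIntegrable_of_norm_le {F : Type*} [NormedAddCommGroup F] {f : ℝ → F}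
    (hf : StronglyMeasurable f) {C : ℝ} (hC : ∀ r, ‖f r‖ ≤ C) (a b : ℝ) :
    IntervalIntegrable f volume a b :=
  (intervalIntegrable_const (c := C)).mono_fun hf.aestronglyMeasurable
    (Filter.Eventually.of_forall fun r => (hC r).trans (le_abs_self C))

/-- The operator `Wb` is not continuous, but its coefficients `⟪e j, Wb v⟫ = ⟪Wb (e j), v⟫` are
continuous in `v`, since the basis vectors lie in the domain. The image is therefore a pointwise
limit of measurable finite sums. -/
theorem stronglyMeasurable_applyOp (hWb : IsSelfAdjoint Wb) [Countable ι]
    (e : HilbertBasis ι ℂ K) (he : ∀ j, e j ∈ Wb.domain) {X : Type*} [MeasurableSpace X]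
    {C : Set X} (hC : MeasurableSet C) {v : X → K} (hv : StronglyMeasurable v)
    (hmem : ∀ x ∈ C, v x ∈ Wb.domain) :
    StronglyMeasurable (C.indicator fun x => applyOp Wb (v x)) := by
  refine stronglyMeasurable_of_tendsto (Filter.atTop : Filter (Finset ι))
    (f := fun F => C.indicator fun x => ∑ j ∈ F, inner ℂ (applyOp Wb (e j)) (v x) • e j)
    (fun F => StronglyMeasurable.indicator ?_ hC) (tendsto_pi_nhds.2 fun x => ?_)
  · refine Finset.stronglyMeasurable_fun_sum _ fun j _ => ?_
    have h : Continuous fun z : K => inner ℂ (applyOp Wb (e j)) z • e j := by fun_prop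
    exact h.comp_stronglyMeasurable hv
  · by_cases hx : x ∈ C
    · simp only [Set.indicator_of_mem hx]
      have h := e.hasSum_repr (applyOp Wb (v x))
      simp only [HilbertBasis.repr_apply_apply, ← inner_applyOp hWb (he _) (hmem x hx)] at h
      exact h
    · simp only [Set.indicator_of_notMem hx, tendsto_const_nhds]

/-- The coupling operator applied along an orbit. -/
def coupled (Ub : ℝ → K →L[ℂ] K) (Wb : K →ₗ.[ℂ] K) (y : K) (T : ℝ) : ℝ → K :=
  (Set.Ioo 0 T).indicator fun r => applyOp Wb (Ub r y)

omit [CompleteSpace K] in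
theorem CouplingDomain.norm_coupled_le {y : K} {T : ℝ} (hy : CouplingDomain Ub Wb y T) :
    ∃ M, 0 ≤ M ∧ ∀ r, ‖coupled Ub Wb y T r‖ ≤ M := by
  obtain ⟨M, hM⟩ := hy.bdd
  refine ⟨|M|, abs_nonneg M, fun r => ?_⟩
  by_cases h : r ∈ Set.Ioo 0 T
  · rw [coupled, Set.indicator_of_mem h]
    exact (hM r h.1 h.2).trans (le_abs_self M)
  · rw [coupled, Set.indicator_of_notMem h, norm_zero]
    exact abs_nonneg M

variable (hUb : IsEvolutionGroup Hb Ub) (hWb : IsSelfAdjoint Wb)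
  [Countable ι] (e : HilbertBasis ι ℂ K) (he : ∀ j, e j ∈ Wb.domain)

include hUb hWb he in
theorem CouplingDomain.stronglyMeasurable_coupled {y : K} {T : ℝ}
    (hy : CouplingDomain Ub Wb y T) : StronglyMeasurable (coupled Ub Wb y T) :=
  stronglyMeasurable_applyOp hWb e he measurableSet_Ioo
    (hUb.continuous y).stronglyMeasurable fun r hr => hy.mem r hr.1 hr.2

/-- The average (up to normalization) of an orbit over `[q, q + δ]`. -/
def smear (Ub : ℝ → K →L[ℂ] K) (y : K) (δ q : ℝ) : K := ∫ τ in q..q + δ, Ub τ y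

include hUb in
theorem apply_smear (y : K) (δ q : ℝ) : Ub q (smear Ub y δ 0) = smear Ub y δ q := by
  rw [smear, ← ContinuousLinearMap.intervalIntegral_comp_comm _
    ((hUb.continuous y).intervalIntegrable _ _)]
  simp only [← hUb.apply_add]
  rw [intervalIntegral.integral_comp_add_left (fun τ => Ub τ y), smear]
  simp

-- Time averages of an orbit lie in the domain of `Hb` even if the vector itself does not:
-- translating the interval differentiates the integral at its two ends.
include hUb in
theorem smear_mem_graph (y : K) (δ : ℝ) :
    (smear Ub y δ 0, Complex.I • (Ub δ y - y)) ∈ Hb.graph := by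
  rw [hUb.generator]
  simp only [apply_smear hUb]
  have hi : ∀ a b, IntervalIntegrable (fun τ => Ub τ y) volume a b := fun a b =>
    (hUb.continuous y).intervalIntegrable a b
  have h1 : smear Ub y δ = fun q =>
      (∫ τ in (0 : ℝ)..q + δ, Ub τ y) - ∫ τ in (0 : ℝ)..q, Ub τ y := by
    ext q
    rw [intervalIntegral.integral_interval_sub_left (hi _ _) (hi _ _), smear]
  rw [h1]
  have h2 : ∀ q, HasDerivAt (fun q => ∫ τ in (0 : ℝ)..q, Ub τ y) (Ub q y) q := fun q =>
    intervalIntegral.integral_hasDerivAt_right (hi _ _)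
      (hUb.continuous y).stronglyMeasurable.stronglyMeasurableAtFilter
      (hUb.continuous y).continuousAt
  have h3 := ((h2 (0 + δ)).comp_add_const 0 δ).sub (h2 0)
  refine h3.congr_deriv ?_
  rw [hUb.apply_zero, zero_add, smul_smul, Complex.I_mul_I]
  simp

-- The same averages lie in the domain of `Wb`, by the weak criterion. They are thus vectors on
-- which all summands of the total Hamiltonian make sense.
include hUb hWb he in
theorem CouplingDomain.smear_mem_graph {y : K} {T : ℝ} (hy : CouplingDomain Ub Wb y T) {q δ : ℝ}
    (hq : 0 ≤ q) (hδ : 0 ≤ δ) (hqδ : q + δ < T) :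
    (smear Ub y δ q, ∫ τ in q..q + δ, coupled Ub Wb y T τ) ∈ Wb.graph := by
  refine mem_graph_of_isSelfAdjoint hWb fun x x' hx => ?_
  obtain ⟨M, -, hM⟩ := hy.norm_coupled_le
  have h1 := (innerSL ℂ x').intervalIntegral_comp_comm (μ := volume)
    ((hUb.continuous y).intervalIntegrable q (q + δ))
  have h2 := (innerSL ℂ x).intervalIntegral_comp_comm (μ := volume)
    (intervalIntegrable_of_norm_le (hy.stronglyMeasurable_coupled hUb hWb e he) hM q (q + δ))
  simp only [innerSL_apply_apply] at h1 h2
  rw [smear, ← h1, ← h2]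
  refine intervalIntegral.integral_congr_ae (Filter.Eventually.of_forall fun τ hτ => ?_)
  rw [Set.uIoc_of_le (by linarith)] at hτ
  have hτ' : τ ∈ Set.Ioo 0 T := ⟨by linarith [hτ.1], by linarith [hτ.2]⟩
  rw [coupled, Set.indicator_of_mem hτ']
  exact symmetric_of_isSelfAdjoint hWb hx (applyOp_mem_graph (hy.mem τ hτ'.1 hτ'.2))

variable (hUs : IsEvolutionGroup Hs Us) (hU : IsEvolutionGroup H U)
  (hH : ExtendsTotalHamiltonian Hs Hb Wb Ws H)

-- Since `H` is symmetric and acts on the product vector as the prescribed sum, the derivatives of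
-- the two free evolutions cancel against parts of that of `U`; only the coupling term survives.
include hUs hUb hU hH in
theorem hasDerivAt_inner_product_evolution {ψ ψ' : Joint S K} (hψ : (ψ, ψ') ∈ H.graph) {a a' : S}
    (ha : (a, a') ∈ Hs.graph) {w w' : K} (hw : (w, w') ∈ Hb.graph) {q : ℝ}
    (hq : Ub q w ∈ Wb.domain) :
    HasDerivAt (fun q => inner ℂ (U q ψ) (tens (Us q a) (Ub q w)))
      (Complex.I * inner ℂ (U q ψ) (tens (Ws (Us q a)) (applyOp Wb (Ub q w)))) q := by
  have h1 := hU.hasDerivAt hψ q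
  have h2 := hUs.hasDerivAt ha q
  have h3 := hUb.hasDerivAt hw q
  have h4 : HasDerivAt (fun q => tens (Us q a) (Ub q w))
      (tens (Us q a) (-(Complex.I • Ub q w')) + tens (-(Complex.I • Us q a')) (Ub q w)) q := by
    have hb := ((tensL S K).isBoundedBilinearMap).hasFDerivAt (Us q a, Ub q w)
    exact ((hb.restrictScalars ℝ).comp_hasDerivAt q (h2.prodMk h3))
  refine (h1.inner ℂ h4).congr_deriv ?_
  obtain ⟨hx, hx'⟩ := eq_applyOp_of_mem_graph (hUs.apply_mem_graph ha q)
  obtain ⟨hy, hy'⟩ := eq_applyOp_of_mem_graph (hUb.apply_mem_graph hw q)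
  have h5 := hH _ _ hx hy hq
  rw [applyOp, dif_pos hx] at hx'
  rw [applyOp, dif_pos hy] at hy'
  rw [← hx', ← hy'] at h5
  have h6 := symmetric_of_isSelfAdjoint hU.selfAdjoint (hU.apply_mem_graph hψ q) h5
  rw [applyOp, dif_pos hq]
  have e1 : tens (Us q a) (-(Complex.I • Ub q w')) = -(Complex.I • tens (Us q a) (Ub q w')) := by
    simp only [← tensL_apply, map_neg, map_smul]
  have e2 : tens (-(Complex.I • Us q a')) (Ub q w) = -(Complex.I • tens (Us q a') (Ub q w)) := by
    simp only [← tensL_apply, map_neg, map_smul, neg_apply,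
      smul_apply]
  rw [e1, e2]
  simp only [inner_add_right, inner_neg_right, inner_smul_right, inner_neg_left, inner_smul_left,
    Complex.conj_I] at h6 ⊢
  linear_combination Complex.I * h6

include hUb hWb he hUs hU hH in
theorem CouplingDomain.inner_smear_sub {ψ ψ' : Joint S K} (hψ : (ψ, ψ') ∈ H.graph) {a a' : S}
    (ha : (a, a') ∈ Hs.graph) {y : K} {T : ℝ} (hy : CouplingDomain Ub Wb y T) {r δ : ℝ}
    (hr : 0 ≤ r) (hδ : 0 ≤ δ) (hrδ : r + δ < T) :
    inner ℂ (U r ψ) (tens (Us r a) (smear Ub y δ r)) - inner ℂ ψ (tens a (smear Ub y δ 0)) =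
      ∫ q in (0 : ℝ)..r, Complex.I * inner ℂ (U q ψ)
        (tens (Ws (Us q a)) (∫ τ in q..q + δ, coupled Ub Wb y T τ)) := by
  obtain ⟨M, -, hM⟩ := hy.norm_coupled_le
  have hm := hy.stronglyMeasurable_coupled hUb hWb e he
  have hint := intervalIntegrable_of_norm_le hm hM
  have h1 : ∀ q ∈ Set.uIcc 0 r, HasDerivAt
      (fun q => inner ℂ (U q ψ) (tens (Us q a) (Ub q (smear Ub y δ 0))))
      (Complex.I * inner ℂ (U q ψ)
        (tens (Ws (Us q a)) (∫ τ in q..q + δ, coupled Ub Wb y T τ))) q := fun q hq => by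
    rw [Set.uIcc_of_le hr] at hq
    obtain ⟨h2, h3⟩ := eq_applyOp_of_mem_graph
      (hy.smear_mem_graph hUb hWb e he hq.1 hδ (by linarith [hq.2]))
    rw [h3, ← apply_smear hUb y δ q]
    rw [← apply_smear hUb y δ q] at h2
    exact hasDerivAt_inner_product_evolution hUb hUs hU hH hψ ha
      (OpenQuantum.smear_mem_graph hUb y δ) h2
  have hc : Continuous fun q : ℝ => ∫ τ in q..q + δ, coupled Ub Wb y T τ := by
    have h0 : (fun q : ℝ => ∫ τ in q..q + δ, coupled Ub Wb y T τ) = fun q =>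
        (∫ τ in (0 : ℝ)..q + δ, coupled Ub Wb y T τ) - ∫ τ in (0 : ℝ)..q, coupled Ub Wb y T τ := by
      ext q
      rw [intervalIntegral.integral_interval_sub_left (hint _ _) (hint _ _)]
    have h00 := intervalIntegral.continuous_primitive hint 0
    rw [h0]
    exact (h00.comp (continuous_add_const δ)).sub h00
  have h2 : Continuous fun q => Complex.I * inner ℂ (U q ψ)
        (tens (Ws (Us q a)) (∫ τ in q..q + δ, coupled Ub Wb y T τ)) :=
    continuous_const.mul ((hU.continuous ψ).inner
      (continuous_tens.comp ((Ws.continuous.comp (hUs.continuous a)).prodMk hc)))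
  rw [intervalIntegral.integral_eq_sub_of_hasDerivAt h1 (h2.intervalIntegrable _ _)]
  simp only [apply_smear hUb, hU.apply_zero, hUs.apply_zero]

-- Divide the formula for averages by `δ` and let `δ` tend to `0`. The coupled orbit is only bounded
-- and measurable, so its averages converge almost everywhere, by Lebesgue's differentiation
-- theorem; dominated convergence does the rest.
include hUb hWb he hUs hU hH in
theorem CouplingDomain.inner_evolution_sub {ψ ψ' : Joint S K} (hψ : (ψ, ψ') ∈ H.graph) {a a' : S}
    (ha : (a, a') ∈ Hs.graph) {y : K} {T : ℝ} (hy : CouplingDomain Ub Wb y T) {r : ℝ}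
    (hr : 0 ≤ r) (hrT : r < T) :
    inner ℂ (U r ψ) (tens (Us r a) (Ub r y)) - inner ℂ ψ (tens a y) =
      ∫ q in (0 : ℝ)..r, Complex.I * inner ℂ (U q ψ)
        (tens (Ws (Us q a)) (coupled Ub Wb y T q)) := by
  obtain ⟨M, hM0, hM⟩ := hy.norm_coupled_le
  have hm := hy.stronglyMeasurable_coupled hUb hWb e he
  have hint := intervalIntegrable_of_norm_le hm hM
  have hsm : ∀ q, Filter.Tendsto (fun δ : ℝ => δ⁻¹ • smear Ub y δ q) (nhdsWithin 0 (Set.Ioi 0))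
      (nhds (Ub q y)) := fun q => by
    have h2 : HasDerivAt (fun x => ∫ τ in q..x, Ub τ y) (Ub q y) q :=
      intervalIntegral.integral_hasDerivAt_right ((hUb.continuous y).intervalIntegrable _ _)
      (hUb.continuous y).stronglyMeasurable.stronglyMeasurableAtFilter
      (hUb.continuous y).continuousAt
    simpa [smear] using h2.tendsto_slope_zero_right
  have hco : ∀ᵐ q, Filter.Tendsto (fun δ : ℝ => δ⁻¹ • ∫ τ in q..q + δ, coupled Ub Wb y T τ)
      (nhdsWithin 0 (Set.Ioi 0)) (nhds (coupled Ub Wb y T q)) := by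
    have hl : LocallyIntegrable (coupled Ub Wb y T) volume :=
      (locallyIntegrable_const M).mono hm.aestronglyMeasurable
        (Filter.Eventually.of_forall fun r => (hM r).trans (le_abs_self M))
    filter_upwards [_root_.LocallyIntegrable.ae_hasDerivAt_integral hl] with q hq
    simpa using (hq q).tendsto_slope_zero_right
  set B : ℝ → K → ℂ := fun q z => Complex.I * inner ℂ (U q ψ) (tens (Ws (Us q a)) z) with hB
  have hBc : ∀ q, Continuous (B q) := fun q => by
    simp only [hB, ← tensL_apply]
    fun_prop
  have hBs : ∀ q (δ : ℝ) z, B q (δ • z) = δ • B q z := fun q δ z => by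
    simp only [hB, ← tensL_apply]
    rw [← Complex.coe_smul, map_smul, inner_smul_right, Complex.real_smul]
    ring
  have h1 : Filter.Tendsto (fun δ : ℝ => δ⁻¹ •
      (inner ℂ (U r ψ) (tens (Us r a) (smear Ub y δ r)) - inner ℂ ψ (tens a (smear Ub y δ 0))))
      (nhdsWithin 0 (Set.Ioi 0))
      (nhds (inner ℂ (U r ψ) (tens (Us r a) (Ub r y)) - inner ℂ ψ (tens a y))) := by
    have hA : ∀ (φ : Joint S K) (b : S) (z : K) (δ : ℝ),
        inner ℂ φ (tens b (δ • z)) = δ • inner ℂ φ (tens b z) := fun φ b z δ => by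
      simp only [← tensL_apply]
      rw [← Complex.coe_smul, map_smul, inner_smul_right, Complex.real_smul]
    have hA' : ∀ (φ : Joint S K) (b : S), Continuous fun z : K => inner ℂ φ (tens b z) :=
      fun φ b => by
        simp only [← tensL_apply]
        fun_prop
    have h0 := hsm 0
    rw [hUb.apply_zero] at h0
    have h3 := (((hA' (U r ψ) (Us r a)).tendsto _).comp (hsm r)).sub
      (((hA' ψ a).tendsto _).comp h0)
    refine h3.congr fun δ => ?_
    simp only [Function.comp_apply, hA, smul_sub]
  refine tendsto_nhds_unique_of_eventuallyEq h1
    (g := fun δ : ℝ => ∫ q in (0 : ℝ)..r, B q (δ⁻¹ • ∫ τ in q..q + δ, coupled Ub Wb y T τ)) ?_ ?_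
  · refine intervalIntegral.tendsto_integral_filter_of_dominated_convergence
      (fun _ => ‖ψ‖ * (‖Ws‖ * ‖a‖ * M)) (Filter.Eventually.of_forall fun δ => ?_) ?_
      intervalIntegrable_const ?_
    · have hc : Continuous fun q : ℝ => ∫ τ in q..q + δ, coupled Ub Wb y T τ := by
        have h0 : (fun q : ℝ => ∫ τ in q..q + δ, coupled Ub Wb y T τ) = fun q =>
            (∫ τ in (0 : ℝ)..q + δ, coupled Ub Wb y T τ) -
              ∫ τ in (0 : ℝ)..q, coupled Ub Wb y T τ := by
          ext q
          rw [intervalIntegral.integral_interval_sub_left (hint _ _) (hint _ _)]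
        have h00 := intervalIntegral.continuous_primitive hint 0
        rw [h0]
        exact (h00.comp (continuous_add_const δ)).sub h00
      exact (continuous_const.mul ((hU.continuous ψ).inner
        (continuous_tens.comp ((Ws.continuous.comp (hUs.continuous a)).prodMk
          (hc.const_smul δ⁻¹))))).aestronglyMeasurable
    · filter_upwards [self_mem_nhdsWithin] with δ hδ
      refine Filter.Eventually.of_forall fun q _ => ?_
      have hδ' : (0 : ℝ) < δ := hδ
      have h4 : ‖δ⁻¹ • ∫ τ in q..q + δ, coupled Ub Wb y T τ‖ ≤ M := by
        rw [norm_smul, Real.norm_eq_abs, abs_of_pos (inv_pos.2 hδ'), inv_mul_le_iff₀ hδ']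
        have := intervalIntegral.norm_integral_le_of_norm_le_const (a := q) (b := q + δ)
          (fun τ _ => hM τ)
        rw [add_sub_cancel_left, abs_of_pos hδ'] at this
        linarith
      rw [hB, norm_mul, Complex.norm_I, one_mul]
      refine (norm_inner_le_norm _ _).trans ?_
      rw [hU.norm_apply, norm_tens]
      gcongr
      exact (Ws.le_opNorm _).trans (by rw [hUs.norm_apply])
    · filter_upwards [hco] with q hq _
      exact ((hBc q).tendsto _).comp hq
  -- The averages reach up to `r + δ`, which has to stay below `T`.
  · have : ∀ᶠ δ : ℝ in nhdsWithin 0 (Set.Ioi 0), δ < T - r :=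
      nhdsWithin_le_nhds (eventually_lt_nhds (by linarith))
    filter_upwards [this, self_mem_nhdsWithin] with δ h5 hδ
    rw [hy.inner_smear_sub hUb hWb e he hUs hU hH hψ ha hr (le_of_lt hδ) (by linarith),
      ← intervalIntegral.integral_smul]
    simp only [hBs]
    rfl

omit [CompleteSpace K] in
include hUs hU in
theorem stronglyMeasurable_duhamel_integrand (a : S) {g : ℝ → K} (hg : StronglyMeasurable g) :
    StronglyMeasurable fun q => Complex.I • U (-q) (tens (Ws (Us q a)) (g q)) := by
  have h1 : Continuous fun q => Ws (Us q a) := Ws.continuous.comp (hUs.continuous a)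
  have h2 : StronglyMeasurable fun q => tens (Ws (Us q a)) (g q) :=
    continuous_tens.comp_stronglyMeasurable (h1.stronglyMeasurable.prodMk hg)
  have h3 : StronglyMeasurable fun q => U (-q) (tens (Ws (Us q a)) (g q)) :=
    hU.continuous_uncurry.comp_stronglyMeasurable
      (continuous_neg.stronglyMeasurable.prodMk h2)
  exact h3.const_smul Complex.I

-- The weak formula holds for test vectors in the domain of `H` and for `a` in the domain of `Hs`.
-- Both domains are dense and both sides are continuous in these vectors.
include hUb hWb he hUs hU hH in
theorem CouplingDomain.evolution_tens {a : S} {y : K} {T : ℝ} (hy : CouplingDomain Ub Wb y T)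
    (hT : 0 < T) {r : ℝ} (hr : r ∈ Set.Icc 0 T) :
    U (-r) (tens (Us r a) (Ub r y)) = tens a y +
      ∫ q in (0 : ℝ)..r, Complex.I • U (-q) (tens (Ws (Us q a)) (coupled Ub Wb y T q)) := by
  obtain ⟨M, hM0, hM⟩ := hy.norm_coupled_le
  have hm := hy.stronglyMeasurable_coupled hUb hWb e he
  have hJm : ∀ a, StronglyMeasurable fun q =>
      Complex.I • U (-q) (tens (Ws (Us q a)) (coupled Ub Wb y T q)) := fun a =>
    stronglyMeasurable_duhamel_integrand hUs hU a hm
  have hJb : ∀ a q, ‖Complex.I • U (-q) (tens (Ws (Us q a)) (coupled Ub Wb y T q))‖ ≤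
      ‖Ws‖ * ‖a‖ * M := fun a q => by
    rw [norm_smul, Complex.norm_I, one_mul, hU.norm_apply, norm_tens]
    gcongr
    · exact (Ws.le_opNorm _).trans (by rw [hUs.norm_apply])
    · exact hM q
  have hJi : ∀ a r, IntervalIntegrable (fun q =>
      Complex.I • U (-q) (tens (Ws (Us q a)) (coupled Ub Wb y T q))) volume 0 r := fun a r =>
    intervalIntegrable_of_norm_le (hJm a) (hJb a) _ _
  have hcont : Continuous fun r => tens a y +
      ∫ q in (0 : ℝ)..r, Complex.I • U (-q) (tens (Ws (Us q a)) (coupled Ub Wb y T q)) :=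
    continuous_const.add (intervalIntegral.continuous_primitive
      (fun _ _ => intervalIntegrable_of_norm_le (hJm a) (hJb a) _ _) 0)
  have hcont' : Continuous fun r => U (-r) (tens (Us r a) (Ub r y)) :=
    hU.continuous_uncurry.comp (continuous_neg.prodMk
      (continuous_tens.comp ((hUs.continuous a).prodMk (hUb.continuous y))))
  -- The averaging argument needs `r < T`; the endpoint `r = T` follows by continuity.
  suffices h : Set.EqOn (fun r => U (-r) (tens (Us r a) (Ub r y))) (fun r => tens a y +
      ∫ q in (0 : ℝ)..r, Complex.I • U (-q) (tens (Ws (Us q a)) (coupled Ub Wb y T q)))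
      (Set.Ico 0 T) by
    have h' := h.closure hcont' hcont
    rw [closure_Ico hT.ne] at h'
    exact h' hr
  clear hr
  intro r hr
  have hclosed : IsClosed {a : S | U (-r) (tens (Us r a) (Ub r y)) = tens a y +
      ∫ q in (0 : ℝ)..r, Complex.I • U (-q) (tens (Ws (Us q a)) (coupled Ub Wb y T q))} := by
    refine isClosed_eq ?_ ?_
    · exact (U (-r)).continuous.comp (continuous_tens.comp ((Us r).continuous.prodMk
        continuous_const))
    · refine (continuous_tens.comp (continuous_id.prodMk continuous_const)).add ?_
      refine continuous_iff_continuousAt.2 fun a₀ => ?_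
      refine intervalIntegral.continuousAt_of_dominated_interval
        (bound := fun _ => ‖Ws‖ * (‖a₀‖ + 1) * M)
        (Filter.Eventually.of_forall fun a => (hJm a).aestronglyMeasurable) ?_
        intervalIntegrable_const ?_
      · have : ∀ᶠ a in nhds a₀, ‖a‖ < ‖a₀‖ + 1 :=
          continuous_norm.continuousAt.eventually_lt_const (by linarith)
        filter_upwards [this] with a ha
        refine Filter.Eventually.of_forall fun q _ => (hJb a q).trans ?_
        gcongr
      · refine Filter.Eventually.of_forall fun q _ => Continuous.continuousAt ?_
        have h1 : Continuous fun a => tens (Ws (Us q a)) (coupled Ub Wb y T q) :=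
          continuous_tens.comp ((Ws.continuous.comp (Us q).continuous).prodMk continuous_const)
        have h2 : Continuous fun a => U (-q) (tens (Ws (Us q a)) (coupled Ub Wb y T q)) :=
          (U (-q)).continuous.comp h1
        exact h2.const_smul Complex.I
  have hd := hclosed.closure_subset_iff (s := (Hs.domain : Set S))
  rw [hUs.selfAdjoint.dense_domain.closure_eq] at hd
  refine hd.2 (fun a ha => ?_) (Set.mem_univ a)
  simp only [Set.mem_ofPred_eq]
  refine ext_inner_left ℂ fun φ => ?_
  have hφ : IsClosed {φ : Joint S K | inner ℂ φ (U (-r) (tens (Us r a) (Ub r y))) =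
    inner ℂ φ (tens a y +
      ∫ q in (0 : ℝ)..r, Complex.I • U (-q) (tens (Ws (Us q a)) (coupled Ub Wb y T q)))} :=
    isClosed_eq (continuous_id.inner continuous_const) (continuous_id.inner continuous_const)
  have hd := hφ.closure_subset_iff (s := (H.domain : Set (Joint S K)))
  rw [hU.selfAdjoint.dense_domain.closure_eq] at hd
  refine hd.2 (fun ψ hψ => ?_) (Set.mem_univ φ)
  have h7 := hy.inner_evolution_sub hUb hWb e he hUs hU hH (H.mem_graph ⟨ψ, hψ⟩)
    (Hs.mem_graph ⟨a, ha⟩) hr.1 hr.2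
  have h8 := (innerSL ℂ ψ).intervalIntegral_comp_comm (μ := volume) (hJi a r)
  simp only [innerSL_apply_apply] at h8
  simp only [Set.mem_ofPred_eq]
  rw [inner_add_right, ← h8, ← hU.inner_apply_left, ← sub_eq_iff_eq_add', h7]
  simp only [hU.inner_apply_left, inner_smul_right]

include hUb hWb he hUs hU hH in
/-- Duhamel's formula on elementary tensors. -/
theorem CouplingDomain.duhamel (a : S) {y : K} {T : ℝ} (hy : CouplingDomain Ub Wb y T)
    (hT : 0 < T) {r : ℝ} (hr : r ∈ Set.Icc 0 T) :
    U r (tens a y) = tens (Us r a) (Ub r y) +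
      ∫ q in (0 : ℝ)..r, U (r - q) (tens ((-Complex.I • Ws) (Us q a)) (coupled Ub Wb y T q)) := by
  have h := congrArg (U r) (hy.evolution_tens hUb hWb e he hUs hU hH (a := a) hT hr)
  rw [hU.apply_neg_apply, map_add] at h
  rw [h, add_assoc]
  refine (add_eq_left.2 ?_).symm
  obtain ⟨M, hM0, hM⟩ := hy.norm_coupled_le
  have hm := hy.stronglyMeasurable_coupled hUb hWb e he
  have hi : IntervalIntegrable (fun q =>
      Complex.I • U (-q) (tens (Ws (Us q a)) (coupled Ub Wb y T q))) volume 0 r := by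
    refine intervalIntegrable_of_norm_le (C := ‖Ws‖ * ‖a‖ * M) ?_ (fun q => ?_) _ _
    · exact stronglyMeasurable_duhamel_integrand hUs hU a hm
    · rw [norm_smul, Complex.norm_I, one_mul, hU.norm_apply, norm_tens]
      gcongr
      · exact (Ws.le_opNorm _).trans (by rw [hUs.norm_apply])
      · exact hM q
  rw [← ContinuousLinearMap.intervalIntegral_comp_comm _ hi]
  have h9 : ∀ q, U (r - q) (tens ((-Complex.I • Ws) (Us q a)) (coupled Ub Wb y T q)) =
      -(U r) (Complex.I • U (-q) (tens (Ws (Us q a)) (coupled Ub Wb y T q))) := fun q => by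
    have : (-Complex.I • Ws) (Us q a) = -(Complex.I • Ws (Us q a)) := by
      rw [neg_smul, neg_apply, smul_apply]
    rw [map_smul, ← hU.apply_add, ← sub_eq_add_neg, this]
    simp only [← tensL_apply, map_neg, map_smul, smul_apply, neg_apply]
  simp only [h9, intervalIntegral.integral_neg, add_neg_cancel]

end Duhamel
end

/-! ### Evolutions with insertions -/

noncomputable section

/-- The evolution `G` from time `s` to time `t`, interrupted by the operator `C` at the times of
the (increasing) list. -/
def insertedEvolution {E : Type*} [NormedAddCommGroup E] [NormedSpace ℂ E]
    (G : ℝ → E →L[ℂ] E) (C : E →L[ℂ] E) (t : ℝ) : ℝ → List ℝ → E →L[ℂ] E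
  | s, [] => G (t - s)
  | s, r :: l => insertedEvolution G C t r l * C * G (r - s)

section Inserted

variable {E : Type*} [NormedAddCommGroup E] [NormedSpace ℂ E]
  {G : ℝ → E →L[ℂ] E} {C : E →L[ℂ] E}

theorem insertedEvolution_cons_apply (t s r : ℝ) (l : List ℝ) (x : E) :
    insertedEvolution G C t s (r :: l) x = insertedEvolution G C t r l (C (G (r - s) x)) := rfl

theorem norm_insertedEvolution_le (hG : ∀ r, ‖G r‖ ≤ 1) {M : ℝ} (hC : ‖C‖ ≤ M) (t s : ℝ)
    (l : List ℝ) : ‖insertedEvolution G C t s l‖ ≤ M ^ l.length := by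
  have hM : 0 ≤ M := (norm_nonneg _).trans hC
  induction l generalizing s with
  | nil => exact (hG (t - s)).trans_eq (by simp)
  | cons r l ih =>
    rw [insertedEvolution, List.length_cons, pow_succ]
    have h1 : ‖insertedEvolution G C t r l * C‖ ≤ M ^ l.length * M :=
      (norm_mul_le _ _).trans (mul_le_mul (ih r) hC (norm_nonneg _) (by positivity))
    exact (norm_mul_le _ _).trans ((mul_le_mul h1 (hG _) (norm_nonneg _)
      (by positivity)).trans_eq (mul_one _))

theorem insertedEvolution_append (t s u : ℝ) (l l' : List ℝ) :
    insertedEvolution G C t s (l ++ u :: l') =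
      insertedEvolution G C t u l' * C * insertedEvolution G C u s l := by
  induction l generalizing s with
  | nil => rfl
  | cons r l ih => rw [List.cons_append, insertedEvolution, ih, insertedEvolution]; rfl

end Inserted

theorem IsEvolutionGroup.stronglyMeasurable_apply {E X : Type*} [NormedAddCommGroup E]
    [InnerProductSpace ℂ E] [CompleteSpace E] [MeasurableSpace X] {H : E →ₗ.[ℂ] E}
    {U : ℝ → E →L[ℂ] E} (hU : IsEvolutionGroup H U) {f : X → ℝ} (hf : Measurable f) {v : X → E}
    (hv : StronglyMeasurable v) : StronglyMeasurable fun x => U (f x) (v x) :=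
  hU.continuous_uncurry.comp_stronglyMeasurable (hf.stronglyMeasurable.prodMk hv)

theorem stronglyMeasurable_tens {S K X : Type*} [NormedAddCommGroup S] [InnerProductSpace ℂ S]
    [NormedAddCommGroup K] [InnerProductSpace ℂ K] [MeasurableSpace X] {f : X → S} {g : X → K}
    (hf : StronglyMeasurable f) (hg : StronglyMeasurable g) :
    StronglyMeasurable fun x => tens (f x) (g x) :=
  continuous_tens.comp_stronglyMeasurable (hf.prodMk hg)

section Duhamel

variable {S K ι : Type*}
    [NormedAddCommGroup S] [InnerProductSpace ℂ S] [CompleteSpace S]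
    [NormedAddCommGroup K] [InnerProductSpace ℂ K] [CompleteSpace K]
    {Hs : S →ₗ.[ℂ] S} {Us : ℝ → S →L[ℂ] S} {Ws : S →L[ℂ] S}
    {Hb : K →ₗ.[ℂ] K} {Ub : ℝ → K →L[ℂ] K} {Wb : K →ₗ.[ℂ] K}
    {H : Joint S K →ₗ.[ℂ] Joint S K} {U : ℝ → Joint S K →L[ℂ] Joint S K}
  (hUb : IsEvolutionGroup Hb Ub) (hWb : IsSelfAdjoint Wb)
  [Countable ι] (e : HilbertBasis ι ℂ K) (he : ∀ j, e j ∈ Wb.domain)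
  (hUs : IsEvolutionGroup Hs Us) (hU : IsEvolutionGroup H U)
  (hH : ExtendsTotalHamiltonian Hs Hb Wb Ws H)

include hUb in
theorem CouplingDomain.shift {y : K} {T : ℝ} (hy : CouplingDomain Ub Wb y T) {r : ℝ}
    (hr : 0 < r) : CouplingDomain Ub Wb (Ub r y) (T - r) := by
  obtain ⟨M, hM⟩ := hy.bdd
  refine ⟨fun q h1 h2 => ?_, M, fun q h1 h2 => ?_⟩
  · rw [← hUb.apply_add]
    exact hy.mem _ (by linarith) (by linarith)
  · rw [← hUb.apply_add]
    exact hM _ (by linarith) (by linarith)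

include hUb in
theorem coupled_shift {y : K} {T r q : ℝ} (hr : 0 < r) (hq : 0 < q) :
    coupled Ub Wb (Ub r y) (T - r) q = coupled Ub Wb y T (q + r) := by
  by_cases h : q < T - r
  · rw [coupled, coupled, Set.indicator_of_mem (Set.mem_Ioo.2 ⟨hq, h⟩),
      Set.indicator_of_mem (Set.mem_Ioo.2 ⟨by linarith, by linarith⟩), ← hUb.apply_add]
  · rw [coupled, coupled, Set.indicator_of_notMem fun h' => h h'.2,
      Set.indicator_of_notMem fun h' => h (by linarith [h'.2])]

include hUb hWb he hUs hU hH in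
/-- Duhamel's formula, for a general initial time. -/
theorem CouplingDomain.duhamel_Ioo (C : S →L[ℂ] S) (hC : C = -Complex.I • Ws) {s t r : ℝ} (a : S)
    {y : K} (hy : CouplingDomain Ub Wb y (t - s)) (hsr : s < r) (hrt : r ≤ t) :
    IntegrableOn (fun u => U (r - u) (tens (C (Us (u - s) a))
      (coupled Ub Wb y (t - s) (u - s)))) (Set.Ioo s r) ∧
    U (r - s) (tens a y) = tens (Us (r - s) a) (Ub (r - s) y) +
      ∫ u in Set.Ioo s r, U (r - u) (tens (C (Us (u - s) a))
        (coupled Ub Wb y (t - s) (u - s))) := by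
  obtain ⟨M, hM0, hM⟩ := hy.norm_coupled_le
  have hm := hy.stronglyMeasurable_coupled hUb hWb e he
  have hm' : StronglyMeasurable fun u => coupled Ub Wb y (t - s) (u - s) :=
    hm.comp_measurable (measurable_id.sub_const s)
  constructor
  · refine Measure.integrableOn_of_bounded (M := ‖C‖ * ‖a‖ * M) (by simp) ?_
      (Filter.Eventually.of_forall fun u => ?_)
    · have h0 : Continuous fun u : ℝ => Us (u - s) a :=
        (hUs.continuous a).comp (continuous_id.sub continuous_const)
      have h1 : Continuous fun u => C (Us (u - s) a) := C.continuous.comp h0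
      have h2 := hU.stronglyMeasurable_apply (measurable_const.sub measurable_id)
        (stronglyMeasurable_tens h1.stronglyMeasurable hm') (f := fun u => r - u)
      exact h2.aestronglyMeasurable
    · rw [hU.norm_apply, norm_tens]
      gcongr
      · exact (C.le_opNorm _).trans (by rw [hUs.norm_apply])
      · exact hM _
  · have h := intervalIntegral.integral_comp_sub_right (a := s) (b := r) (fun q =>
      U (r - s - q) (tens (C (Us q a)) (coupled Ub Wb y (t - s) q))) s
    rw [sub_self] at h
    simp only [sub_sub_sub_cancel_right] at h
    rw [hy.duhamel hUb hWb e he hUs hU hH a (by linarith) (r := r - s)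
      ⟨by linarith, by linarith⟩, ← integral_Ioc_eq_integral_Ioo,
      ← intervalIntegral.integral_of_le hsr.le, h, hC]

include hUb hWb he hUs hU hH in
/-- Duhamel's formula for an evolution with insertions. -/
theorem CouplingDomain.duhamel_inserted {t : ℝ} (l : List ℝ) {s : ℝ} (hst : s < t)
    (hl : l.Pairwise (· < ·)) (hls : ∀ r ∈ l, s < r ∧ r < t) (a : S) {y : K}
    (hy : CouplingDomain Ub Wb y (t - s)) :
    IntegrableOn (fun u => insertedEvolution U (opTensor (-Complex.I • Ws) 1) t u
      (l.filter (u < ·)) (tens ((-Complex.I • Ws)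
        (insertedEvolution Us (-Complex.I • Ws) u s (l.filter (· < u)) a))
        (coupled Ub Wb y (t - s) (u - s)))) (Set.Ioo s t) ∧
    insertedEvolution U (opTensor (-Complex.I • Ws) 1) t s l (tens a y) =
      tens (insertedEvolution Us (-Complex.I • Ws) t s l a) (Ub (t - s) y) +
      ∫ u in Set.Ioo s t, insertedEvolution U (opTensor (-Complex.I • Ws) 1) t u
        (l.filter (u < ·)) (tens ((-Complex.I • Ws)
          (insertedEvolution Us (-Complex.I • Ws) u s (l.filter (· < u)) a))
          (coupled Ub Wb y (t - s) (u - s))) := by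
  set C : S →L[ℂ] S := -Complex.I • Ws with hC
  set C' : Joint S K →L[ℂ] Joint S K := opTensor C 1
  induction l generalizing s a y with
  | nil => exact hy.duhamel_Ioo hUb hWb e he hUs hU hH C rfl a hst le_rfl
  | cons r l ih =>
    have hr := hls r (by simp)
    rw [List.pairwise_cons] at hl
    obtain ⟨h1, h2⟩ := hy.duhamel_Ioo hUb hWb e he hUs hU hH C rfl a hr.1 hr.2.le
    have hy' : CouplingDomain Ub Wb (Ub (r - s) y) (t - r) := by
      have := hy.shift hUb (r := r - s) (by linarith [hr.1])
      rwa [sub_sub_sub_cancel_right] at this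
    obtain ⟨h3, h4⟩ := ih hr.2 hl.2 (fun q hq => ⟨hl.1 q hq, (hls q (by simp [hq])).2⟩)
      (C (Us (r - s) a)) hy'
    set P := insertedEvolution U C' t r l * C' with hP
    -- Before the first coupling time `u` of the bath the system evolves freely and meets the
    -- earlier insertions; the later ones belong to the full evolution.
    set f : ℝ → Joint S K := fun u => insertedEvolution U C' t u
      ((r :: l).filter (u < ·)) (tens (C
        (insertedEvolution Us C u s ((r :: l).filter (· < u)) a))
        (coupled Ub Wb y (t - s) (u - s))) with hf
    -- If `u` precedes the first insertion `r`, all insertions are later than `u`: this part comes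
    -- from Duhamel's formula on `[s, r]`.
    have f1 : Set.EqOn (fun u => P (U (r - u) (tens (C (Us (u - s) a))
        (coupled Ub Wb y (t - s) (u - s))))) f (Set.Ioo s r) := fun u hu => by
      have e1 : (r :: l).filter (u < ·) = r :: l := List.filter_eq_self.2 fun q hq => by
        rcases List.mem_cons.1 hq with rfl | hq
        · simpa using hu.2
        · simpa using hu.2.trans (hl.1 q hq)
      have e2 : (r :: l).filter (· < u) = [] := List.filter_eq_nil_iff.2 fun q hq => by
        rcases List.mem_cons.1 hq with rfl | hq
        · simpa using hu.2.le
        · simpa using (hu.2.trans (hl.1 q hq)).le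
      simp only [hf, e1, e2]
      rfl
    -- If `u` follows `r`, the insertion at `r` is already absorbed into the free system vector:
    -- this part comes from the induction hypothesis, started at `r`.
    have f2 : Set.EqOn (fun u => insertedEvolution U C' t u (l.filter (u < ·)) (tens (C
        (insertedEvolution Us C u r (l.filter (· < u)) (C (Us (r - s) a))))
        (coupled Ub Wb (Ub (r - s) y) (t - r) (u - r)))) f (Set.Ioo r t) := fun u hu => by
      have e1 : (r :: l).filter (u < ·) = l.filter (u < ·) :=
        List.filter_cons_of_neg (by simpa using hu.1.le)
      have e2 : (r :: l).filter (· < u) = r :: l.filter (· < u) :=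
        List.filter_cons_of_pos (by simpa using hu.1)
      have e3 := coupled_shift (Wb := Wb) hUb (y := y) (T := t - s) (r := r - s) (q := u - r)
        (by linarith [hr.1]) (by linarith [hu.1])
      rw [sub_sub_sub_cancel_right, sub_add_sub_cancel] at e3
      simp only [hf, e1, e2, e3]
      rfl
    have g1 : IntegrableOn f (Set.Ioo s r) :=
      IntegrableOn.congr_fun (P.integrable_comp h1) f1 measurableSet_Ioo
    have g2 : IntegrableOn f (Set.Ioo r t) := h3.congr_fun f2 measurableSet_Ioo
    have hsplit := restrict_Ioo_split hr.1.le hr.2.le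
    constructor
    · rw [IntegrableOn, hsplit]
      exact Integrable.add_measure g1 g2
    · change P (U (r - s) (tens a y)) = _
      rw [h2, map_add, ← P.integral_comp_comm h1, setIntegral_congr_fun measurableSet_Ioo f1,
        hsplit, integral_add_measure g1 g2, ← setIntegral_congr_fun measurableSet_Ioo f2]
      have h5 : P (tens (Us (r - s) a) (Ub (r - s) y)) =
          insertedEvolution U C' t r l (tens (C (Us (r - s) a)) (Ub (r - s) y)) := by
        rw [hP, mul_apply_eq_comp, opTensor_tens]
        rfl
      rw [h5, h4, ← hUb.apply_add, sub_add_sub_cancel, add_assoc,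
        add_comm (∫ u in Set.Ioo s r, f u)]
      rfl

end Duhamel
end

noncomputable section

/-! ### Sorted configurations -/

theorem sort_ofFn {n : ℕ} (x : Fin n → ℝ) :
    (List.ofFn x : Multiset ℝ).sort = List.ofFn (x ∘ Tuple.sort x) := by
  refine List.Perm.eq_of_pairwise (le := (· ≤ ·)) (fun _ _ _ _ h h' => le_antisymm h h')
    (Multiset.pairwise_sort _ _) ?_ ?_
  · exact List.pairwise_ofFn.2 fun i j hij => Tuple.monotone_sort x hij.le
  · rw [← Multiset.coe_eq_coe, Multiset.sort_eq, Multiset.coe_eq_coe]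
    exact ((Tuple.sort x).ofFn_comp_perm x).symm

theorem measurableSet_sort_eq {n : ℕ} (π : Equiv.Perm (Fin n)) :
    MeasurableSet {x : Fin n → ℝ | π = Tuple.sort x} := by
  have h : {x : Fin n → ℝ | π = Tuple.sort x} =
      {x | ∀ i j, (i ≤ j → x (π i) ≤ x (π j)) ∧ (i < j → x (π i) = x (π j) → π i < π j)} := by
    ext x
    simp only [Set.mem_ofPred_eq, Tuple.eq_sort_iff, forall_and]
    rfl
  rw [h, measurableSet_setOfPred]
  refine Measurable.forall fun i => Measurable.forall fun j => Measurable.and ?_ ?_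
  · exact measurable_const.imp
      (measurableSet_setOfPred.1 (measurableSet_le (by fun_prop) (by fun_prop)))
  · exact measurable_const.imp
      ((measurableSet_setOfPred.1 (measurableSet_eq_fun (by fun_prop) (by fun_prop))).imp
        measurable_const)

/-- The sorting permutation of a tuple takes finitely many values, each on a measurable set, so a
measurable function of lists gives a measurable function of sorted configurations. -/
theorem isConf_sort {E : Type*} [NormedAddCommGroup E] {Φ : List ℝ → E}
    (hm : ∀ n, StronglyMeasurable fun x : Fin n → ℝ => Φ (List.ofFn x))
    (hb : ∀ n, ∃ C, ∀ l : List ℝ, l.length = n → ‖Φ l‖ ≤ C) :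
    IsConf fun (_ : Unit) (τ : Multiset ℝ) => Φ τ.sort := by
  refine ⟨fun n => ?_, fun n => (hb n).imp fun C h _ τ hτ => h _ (by simpa using hτ)⟩
  let g : (Fin n → ℝ) → E := fun x => ∑ π : Equiv.Perm (Fin n),
    {x : Fin n → ℝ | π = Tuple.sort x}.indicator (fun x => Φ (List.ofFn (x ∘ π))) x
  have h1 : StronglyMeasurable g := by
    refine Finset.stronglyMeasurable_fun_sum _ fun π _ => ?_
    refine StronglyMeasurable.indicator ?_ (measurableSet_sort_eq π)
    exact (hm n).comp_measurable (g := fun x : Fin n → ℝ => x ∘ π) (by fun_prop)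
  have h2 : StronglyMeasurable fun p : Unit × (Fin n → ℝ) => g p.2 :=
    h1.comp_measurable measurable_snd
  refine (congrArg StronglyMeasurable (funext fun p => ?_)).mp h2
  have h3 : ∀ π, π ≠ Tuple.sort p.2 → {x : Fin n → ℝ | π = Tuple.sort x}.indicator
      (fun x => Φ (List.ofFn (x ∘ π))) p.2 = 0 := fun π hπ => by
    rw [Set.indicator_of_notMem]
    exact hπ
  have h4 : {x : Fin n → ℝ | Tuple.sort p.2 = Tuple.sort x}.indicator
      (fun x => Φ (List.ofFn (x ∘ Tuple.sort p.2))) p.2 = Φ (List.ofFn (p.2 ∘ Tuple.sort p.2)) :=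
    by rw [Set.indicator_of_mem (by simp)]
  simp only [g]
  rw [Finset.sum_eq_single (Tuple.sort p.2) (fun π _ => h3 π)
    (fun h => absurd (Finset.mem_univ _) h), h4, sort_ofFn]

/-- The points of a configuration, in decreasing order. -/
def descList (τ : Multiset ℝ) : List ℝ := τ.sort.reverse

theorem coe_descList (τ : Multiset ℝ) : (descList τ : Multiset ℝ) = τ := by
  rw [descList, Multiset.coe_reverse, Multiset.sort_eq]

theorem mem_descList {τ : Multiset ℝ} {s : ℝ} : s ∈ descList τ ↔ s ∈ τ := by
  rw [← Multiset.mem_coe, coe_descList]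

theorem descList_coe {l : List ℝ} (hl : l.Pairwise (· > ·)) : descList (l : Multiset ℝ) = l := by
  rw [descList, ← List.reverse_inj, List.reverse_reverse]
  refine List.Perm.eq_of_pairwise (le := (· ≤ ·)) (fun _ _ _ _ h h' => le_antisymm h h')
    (Multiset.pairwise_sort _ _) (List.pairwise_reverse.2 (hl.imp fun h => h.le)) ?_
  rw [← Multiset.coe_eq_coe, Multiset.sort_eq, Multiset.coe_reverse]

theorem pairwise_descList {τ : Multiset ℝ} : (descList τ).Pairwise (· > ·) ↔ τ.Nodup := by
  constructor
  · intro h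
    rw [← coe_descList τ]
    exact Multiset.coe_nodup.2 (h.imp fun h => h.ne')
  · intro h
    have h1 : (descList τ).Nodup := by rwa [← Multiset.coe_nodup, coe_descList]
    have h2 : (descList τ).Pairwise (· ≥ ·) := by
      rw [descList, List.pairwise_reverse]
      exact Multiset.pairwise_sort τ (· ≤ ·)
    exact (h2.and h1).imp fun h => lt_of_le_of_ne h.1 h.2.symm

/-- A configuration of distinct times between `0` and `t`. -/
def IsForward (t : ℝ) (τ : Multiset ℝ) : Prop := τ.Nodup ∧ ∀ s ∈ τ, 0 < s ∧ s < t

/-- A configuration of distinct times of the contour, different from the turning point. -/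
def IsGeneric (t : ℝ) (τ : Multiset ℝ) : Prop :=
  τ.Nodup ∧ ∀ s ∈ τ, 0 < s ∧ s < 2 * t ∧ s ≠ t

theorem IsGeneric.isContourTimes {t : ℝ} {τ : Multiset ℝ} (h : IsGeneric t τ) :
    IsContourTimes t (descList τ) :=
  ⟨pairwise_descList.2 h.1, fun s hs => (h.2 s (mem_descList.1 hs)).imp id And.left⟩

/-! ### The bath vectors -/

section Bath

variable {K ι : Type*} [NormedAddCommGroup K] [InnerProductSpace ℂ K] [CompleteSpace K]
  {Hb : K →ₗ.[ℂ] K} {Ub : ℝ → K →L[ℂ] K} {Wb : K →ₗ.[ℂ] K} {e : HilbertBasis ι ℂ K}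
  {β : ℝ} {ε : ι → ℝ} {t : ℝ}

open scoped Classical in
/-- The bath vector obtained from `x` by applying the coupling at the times of the configuration,
evolved to time `t`. -/
def bathVector (Ub : ℝ → K →L[ℂ] K) (Wb : K →ₗ.[ℂ] K) (t : ℝ) (x : K) (τ : Multiset ℝ) : K :=
  if IsForward t τ then Ub (t - (descList τ).headD 0) (bathWord Ub Wb t (descList τ) x) else 0

omit [CompleteSpace K] in
theorem bathVector_coe {x : K} {l : List ℝ} (hl : l.Pairwise (· > ·))
    (hl' : ∀ s ∈ l, 0 < s ∧ s < t) :
    bathVector Ub Wb t x l = Ub (t - l.headD 0) (bathWord Ub Wb t l x) := by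
  have : IsForward t (l : Multiset ℝ) :=
    ⟨Multiset.coe_nodup.2 (hl.imp fun h => h.ne'), fun s hs => hl' s (by simpa using hs)⟩
  rw [bathVector, if_pos this, descList_coe hl]

variable (hUb : IsEvolutionGroup Hb Ub) (hWb : IsSelfAdjoint Wb)
  (hdef : BathFunctionalDefined e β ε Ub Wb t)

-- The couplings on the backward branch are moved one at a time, the latest contour time first, to
-- the left side of the inner product. Self-adjointness of `Wb` and unitarity of `Ub` make a
-- coupling at `s` into a forward coupling at `2 t - s`. The list `L` collects those already moved.
include hUb hWb hdef in
theorem inner_bathWord_append (ht : 0 < t) (k : ι) (q : List ℝ) (hq : ∀ s ∈ q, s < t) (p L : List ℝ)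
    (hp : ∀ s ∈ p, t < s) (hpq : IsContourTimes t (p ++ q))
    (hL : ((p.map (2 * t - ·)).reverse ++ L).Pairwise (· > ·)) (hLt : ∀ s ∈ L, 0 < s ∧ s < t) :
    inner ℂ (bathWord Ub Wb t L (e k)) (bathPropagator Ub t (2 * t - L.headD 0)
        ((p ++ q).headD 0) (bathWord Ub Wb t (p ++ q) (e k))) =
      inner ℂ (bathVector Ub Wb t (e k) ↑((p.map (2 * t - ·)).reverse ++ L))
        (bathVector Ub Wb t (e k) q) := by
  induction p generalizing L with
  | nil =>
    -- For an empty list the default `0` is the start of the contour, which lies before `t` because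
    -- `0 < t`.
    have hq0 : q.headD 0 < t := by
      cases q with
      | nil => exact ht
      | cons s q => exact hq s (by simp)
    have hL0 : L.headD 0 < t := by
      cases L with
      | nil => exact ht
      | cons s L => exact (hLt s (by simp)).2
    simp only [List.map_nil, List.reverse_nil, List.nil_append] at hL hpq ⊢
    rw [bathVector_coe hL hLt, bathVector_coe hpq.1 fun s hs => ⟨(hpq.2 s hs).1, hq s hs⟩,
      bathPropagator, if_neg (by linarith), if_neg (by linarith), hUb.inner_apply_left,
      ← hUb.apply_add]
    congr 3
    ring
  | cons s p ih =>
    have hs := hp s (by simp)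
    have hs2 := hpq.2 s (by simp)
    have e1 : ((s :: p).map (2 * t - ·)).reverse ++ L =
        (p.map (2 * t - ·)).reverse ++ ((2 * t - s) :: L) := by simp
    rw [e1] at hL ⊢
    have hcons := (List.pairwise_append.1 hL).2.1
    have hLt' : ∀ r ∈ (2 * t - s) :: L, 0 < r ∧ r < t := fun r hr => by
      rcases List.mem_cons.1 hr with rfl | hr
      · exact ⟨by linarith, by linarith⟩
      · exact hLt r hr
    have h := ih ((2 * t - s) :: L) (fun r hr => hp r (by simp [hr]))
      ⟨(List.pairwise_cons.1 hpq.1).2, fun r hr => hpq.2 r (by simp [hr])⟩ hL hLt'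
    rw [← h]
    have hm1 := hdef.mem_domain (2 * t - s) L k
      ⟨hcons, fun r hr => ⟨(hLt' r hr).1, by linarith [(hLt' r hr).2]⟩⟩
    have hm2 := hdef.mem_domain s (p ++ q) k hpq
    have hL0 : L.headD 0 < t := by
      cases L with
      | nil => exact ht
      | cons s L => exact (hLt s (by simp)).2
    have p1 : bathPropagator Ub t (2 * t - L.headD 0) s = Ub (-(2 * t - s - L.headD 0)) := by
      rw [bathPropagator, if_neg (by linarith), if_pos hs.le]
      congr 1
      ring
    have p2 : bathPropagator Ub t (2 * t - s) (L.headD 0) = Ub (2 * t - s - L.headD 0) := by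
      rw [bathPropagator, if_pos (by linarith)]
    simp only [List.headD_cons, sub_sub_cancel, List.cons_append, bathWord]
    rw [inner_applyOp hWb hm1 hm2, p1, p2, hUb.inner_apply_left]

theorem bwd_eq_coe {p q : List ℝ} (hp : ∀ s ∈ p, t < s) (hq : ∀ s ∈ q, s < t) :
    fwd t ↑(p ++ q) = q ∧ bwd t ↑(p ++ q) = ↑(p.map (2 * t - ·)).reverse := by
  have h1 : (↑(p ++ q) : Multiset ℝ) = ↑p + ↑q := rfl
  have h2 : Multiset.filter (· < t) (p : Multiset ℝ) = 0 :=
    Multiset.filter_eq_nil.2 fun s hs => (hp s hs).le.not_gt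
  have h3 : Multiset.filter (· < t) (q : Multiset ℝ) = q :=
    Multiset.filter_eq_self.2 fun s hs => hq s hs
  have h4 : Multiset.filter (fun u => ¬u < t) (p : Multiset ℝ) = p :=
    Multiset.filter_eq_self.2 fun s hs => (hp s hs).le.not_gt
  have h5 : Multiset.filter (fun u => ¬u < t) (q : Multiset ℝ) = 0 :=
    Multiset.filter_eq_nil.2 fun s hs => not_not.2 (hq s hs)
  rw [fwd, bwd, h1, Multiset.filter_add, Multiset.filter_add, h2, h3, h4, h5]
  simp

-- Each term of the thermal trace is an inner product of two forward vectors, one for each branch. A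
-- generic configuration avoids the turning point, so its times split strictly into the two
-- branches.
include hUb hWb hdef in
theorem bathTerm_descList {τ : Multiset ℝ} (hτ : IsGeneric t τ) (ht : 0 < t) (k : ι) :
    bathTerm e β ε Ub Wb t (descList τ) k = thermalWeight β ε k *
      inner ℂ (bathVector Ub Wb t (e k) (bwd t τ)) (bathVector Ub Wb t (e k) (fwd t τ)) := by
  set p := descList (τ.filter fun u => ¬u < t) with hp
  set q := descList (fwd t τ) with hq
  have hp1 : ∀ s ∈ p, t < s := fun s hs => by
    rw [hp, mem_descList, Multiset.mem_filter] at hs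
    exact lt_of_le_of_ne (not_lt.1 hs.2) (hτ.2 s hs.1).2.2.symm
  have hq1 : ∀ s ∈ q, s < t := fun s hs => by
    rw [hq, mem_descList, fwd, Multiset.mem_filter] at hs
    exact hs.2
  have hpp : p.Pairwise (· > ·) := pairwise_descList.2 (hτ.1.filter _)
  have hqp : q.Pairwise (· > ·) := pairwise_descList.2 (hτ.1.filter _)
  have hpq : (p ++ q).Pairwise (· > ·) :=
    List.pairwise_append.2 ⟨hpp, hqp, fun a ha b hb => (hq1 b hb).trans (hp1 a ha)⟩
  have hτe : τ = ↑(p ++ q) := by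
    rw [← Multiset.coe_add, hp, hq, coe_descList, coe_descList, fwd, add_comm,
      Multiset.filter_add_not]
  have hd : descList τ = p ++ q := by rw [hτe, descList_coe hpq]
  obtain ⟨h1, h2⟩ := bwd_eq_coe hp1 hq1
  have hrev : (p.map (2 * t - ·)).reverse.Pairwise (· > ·) := by
    rw [List.pairwise_reverse, List.pairwise_map]
    exact hpp.imp fun h => by simpa using h
  have h := inner_bathWord_append hUb hWb hdef ht k q hq1 p [] hp1
    (by rw [← hd]; exact hτ.isContourTimes) (by simpa using hrev) (by simp)
  rw [bathTerm, hd]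
  simp only [List.headD_nil, sub_zero, bathWord, List.append_nil] at h
  rw [h, hτe, h1, h2]

/-- The increasing tuples of times between `0` and `t`. -/
def forwardSimplex (t : ℝ) (n : ℕ) : Set (Fin n → ℝ) :=
  {x | (List.ofFn x).reverse.Pairwise (· > ·) ∧ ∀ s ∈ (List.ofFn x).reverse, 0 < s ∧ s < t}

theorem measurableSet_forwardSimplex (t : ℝ) (n : ℕ) : MeasurableSet (forwardSimplex t n) := by
  simp only [forwardSimplex, List.pairwise_reverse, List.pairwise_ofFn, List.mem_reverse,
    List.forall_mem_ofFn_iff]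
  rw [measurableSet_setOfPred]
  refine Measurable.and ?_ ?_
  · exact Measurable.forall fun i => Measurable.forall fun j => measurable_const.imp
      (measurableSet_setOfPred.1 (measurableSet_lt (by fun_prop) (by fun_prop)))
  · exact Measurable.forall fun i =>
      (measurableSet_setOfPred.1 (measurableSet_lt (by fun_prop) (by fun_prop))).and
      (measurableSet_setOfPred.1 (measurableSet_lt (by fun_prop) (by fun_prop)))

theorem reverse_ofFn_succ {n : ℕ} (x : Fin (n + 1) → ℝ) :
    (List.ofFn x).reverse =
      x (Fin.last n) :: (List.ofFn fun i : Fin n => x i.castSucc).reverse := by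
  rw [List.ofFn_succ', List.concat_eq_append, List.reverse_append]
  rfl

theorem measurable_headD_reverse_ofFn (n : ℕ) :
    Measurable fun x : Fin n → ℝ => (List.ofFn x).reverse.headD 0 := by
  cases n with
  | zero => simp
  | succ n =>
    simp only [reverse_ofFn_succ, List.headD_cons]
    fun_prop

include hUb hWb hdef in
theorem stronglyMeasurable_bathWord [Countable ι] (he : ∀ j, e j ∈ Wb.domain) (k : ι) (n : ℕ) :
    StronglyMeasurable ((forwardSimplex t n).indicator
      fun x => bathWord Ub Wb t (List.ofFn x).reverse (e k)) := by
  induction n with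
  | zero =>
    refine StronglyMeasurable.indicator ?_ (measurableSet_forwardSimplex t 0)
    simp
  | succ n ih =>
    have hinit : ∀ x ∈ forwardSimplex t (n + 1),
        (fun i : Fin n => x i.castSucc) ∈ forwardSimplex t n := fun x hx => by
      rw [forwardSimplex, Set.mem_ofPred_eq, reverse_ofFn_succ] at hx
      exact ⟨(List.pairwise_cons.1 hx.1).2, fun s hs => hx.2 s (List.mem_cons_of_mem _ hs)⟩
    have hm : Measurable fun (x : Fin (n + 1) → ℝ) (i : Fin n) => x i.castSucc := by fun_prop
    have hv := hUb.stronglyMeasurable_apply (f := fun x : Fin (n + 1) → ℝ => x (Fin.last n) -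
        (List.ofFn fun i : Fin n => x i.castSucc).reverse.headD 0)
      ((measurable_pi_apply _).sub ((measurable_headD_reverse_ofFn n).comp hm))
      (ih.comp_measurable hm)
    have hx : ∀ x ∈ forwardSimplex t (n + 1), Ub (x (Fin.last n) -
        (List.ofFn fun i : Fin n => x i.castSucc).reverse.headD 0)
          (((forwardSimplex t n).indicator fun x => bathWord Ub Wb t (List.ofFn x).reverse (e k))
            fun i => x i.castSucc) =
        bathPropagator Ub t (x (Fin.last n))
          ((List.ofFn fun i : Fin n => x i.castSucc).reverse.headD 0)
          (bathWord Ub Wb t (List.ofFn fun i : Fin n => x i.castSucc).reverse (e k)) :=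
        fun x hx => by
      rw [Set.indicator_of_mem (hinit x hx), bathPropagator, if_pos]
      rw [forwardSimplex, Set.mem_ofPred_eq, reverse_ofFn_succ] at hx
      exact (hx.2 _ List.mem_cons_self).2
    have h := stronglyMeasurable_applyOp hWb e he (measurableSet_forwardSimplex t (n + 1)) hv
      fun x hx' => by
        rw [Function.comp_apply, hx x hx']
        rw [forwardSimplex, Set.mem_ofPred_eq, reverse_ofFn_succ] at hx'
        exact hdef.mem_domain _ _ k
          ⟨hx'.1, fun s hs => ⟨(hx'.2 s hs).1, by linarith [(hx'.2 s hs).1, (hx'.2 s hs).2]⟩⟩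
    refine (congrArg StronglyMeasurable (Set.indicator_congr fun x hx' => ?_)).mp h
    rw [reverse_ofFn_succ, bathWord, ← hx x hx']
    rfl

include hUb hWb hdef in
theorem isConf_bathVector [Countable ι] (he : ∀ j, e j ∈ Wb.domain) (k : ι)
    (hb : ∀ n, ∃ C, ∀ τ, Multiset.card τ = n → ‖bathVector Ub Wb t (e k) τ‖ ≤ C) :
    IsConf fun (_ : Unit) => bathVector Ub Wb t (e k) := by
  classical
  let Φ : List ℝ → K := fun L =>
    if L.reverse.Pairwise (· > ·) ∧ ∀ s ∈ L.reverse, 0 < s ∧ s < t then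
      bathVector Ub Wb t (e k) L else 0
  have hΦ : ∀ τ : Multiset ℝ, Φ τ.sort = bathVector Ub Wb t (e k) τ := fun τ => by
    have h2 : (↑τ.sort : Multiset ℝ) = τ := Multiset.sort_eq _ _
    simp only [Φ]
    split_ifs with h
    · rw [h2]
    · have h3 : ¬IsForward t τ := fun h' =>
        h ⟨pairwise_descList.2 h'.1, fun s hs => h'.2 s (mem_descList.1 hs)⟩
      rw [bathVector, if_neg h3]
  refine (isConf_sort (Φ := Φ) (fun n => ?_) fun n => ?_).congr fun _ τ => hΦ τ
  · have h1 := hUb.stronglyMeasurable_apply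
      (f := fun x : Fin n → ℝ => t - (List.ofFn x).reverse.headD 0)
      (measurable_const.sub (measurable_headD_reverse_ofFn n))
      (stronglyMeasurable_bathWord hUb hWb hdef he k n)
    have h2 := h1.indicator (measurableSet_forwardSimplex t n)
    refine (congrArg StronglyMeasurable (funext fun x => ?_)).mp h2
    by_cases hx : x ∈ forwardSimplex t n
    · have hx' := hx
      rw [forwardSimplex, Set.mem_ofPred_eq] at hx'
      rw [Set.indicator_of_mem hx, Set.indicator_of_mem hx]
      simp only [Φ]
      rw [if_pos hx', ← Multiset.coe_reverse, bathVector_coe hx'.1 hx'.2]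
    · rw [Set.indicator_of_notMem hx]
      exact (if_neg hx).symm
  · refine (hb n).imp fun C h l hl => ?_
    have h0 := h (l : Multiset ℝ) (by simpa using hl)
    simp only [Φ]
    split_ifs
    · exact h0
    · rw [norm_zero]
      exact (norm_nonneg _).trans h0

end Bath
end

noncomputable section

/-! ### Wick's theorem as a hafnian, and bounds on the bath vectors -/

section Correlation

variable {K ι : Type*} [NormedAddCommGroup K] [InnerProductSpace ℂ K]

open scoped Classical in
/-- The bath correlation function as a symmetric function of two generic contour times, extended
by zero. -/
def symCorrelation (e : HilbertBasis ι ℂ K) (β : ℝ) (ε : ι → ℝ) (Ub : ℝ → K →L[ℂ] K)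
    (Wb : K →ₗ.[ℂ] K) (t u v : ℝ) : ℂ :=
  if IsGeneric t {u, v} then bathFunctional e β ε Ub Wb t (descList {u, v}) else 0

variable {e : HilbertBasis ι ℂ K} {β : ℝ} {ε : ι → ℝ} {Ub : ℝ → K →L[ℂ] K}
  {Wb : K →ₗ.[ℂ] K} {t : ℝ}

theorem symCorrelation_comm (u v : ℝ) :
    symCorrelation e β ε Ub Wb t u v = symCorrelation e β ε Ub Wb t v u := by
  rw [symCorrelation, symCorrelation, Multiset.pair_comm]

theorem isGeneric_pair {u v : ℝ} : IsGeneric t {u, v} ↔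
    u ≠ v ∧ (0 < u ∧ u < 2 * t ∧ u ≠ t) ∧ 0 < v ∧ v < 2 * t ∧ v ≠ t := by
  simp [IsGeneric]

theorem symCorrelation_of_lt {u v : ℝ} (h : IsGeneric t {u, v}) (huv : u < v) :
    symCorrelation e β ε Ub Wb t u v = bathCorrelation e β ε Ub Wb t u v := by
  rw [symCorrelation, if_pos h, bathCorrelation, Multiset.pair_comm]
  congr 1
  exact descList_coe (l := [v, u]) (by simpa using huv)

theorem norm_symCorrelation_le {C : ℝ} (hC : 0 ≤ C) (hB : ∀ τ₁ τ₂ : ℝ, 0 < τ₁ → τ₁ < τ₂ →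
    τ₂ < 2 * t → ‖bathCorrelation e β ε Ub Wb t τ₁ τ₂‖ ≤ C) (u v : ℝ) :
    ‖symCorrelation e β ε Ub Wb t u v‖ ≤ C := by
  by_cases h : IsGeneric t {u, v}
  · have h' := isGeneric_pair.1 h
    rcases lt_or_gt_of_ne h'.1 with huv | huv
    · rw [symCorrelation_of_lt h huv]
      exact hB _ _ h'.2.1.1 huv h'.2.2.2.1
    · rw [symCorrelation_comm, symCorrelation_of_lt (by rwa [Multiset.pair_comm]) huv]
      exact hB _ _ h'.2.2.1 huv h'.2.1.2.1
  · rwa [symCorrelation, if_neg h, norm_zero]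

/-- Sorting a generic configuration gives an increasing tuple, to which Wick's theorem applies; on
its ordered pairs the symmetric extension is the correlation function itself. -/
theorem bathFunctional_descList (hWick : WickTheorem e β ε Ub Wb t) {τ : Multiset ℝ}
    (hτ : IsGeneric t τ) :
    bathFunctional e β ε Ub Wb t (descList τ) = haf (symCorrelation e β ε Ub Wb t) τ := by
  have h1 : List.ofFn τ.sort.get = τ.sort := List.ofFn_get _
  have h2 : τ.sort.Pairwise (· < ·) := by
    have := pairwise_descList.2 hτ.1
    rwa [descList, List.pairwise_reverse] at this
  have hs : StrictMono τ.sort.get := fun i j hij => List.pairwise_iff_get.1 h2 i j hij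
  have hmem : ∀ i, τ.sort.get i ∈ τ := fun i => by
    rw [← Multiset.mem_sort (r := (· ≤ ·))]
    exact List.get_mem _ _
  have h3 := hWick _ τ.sort.get hs fun i => (hτ.2 _ (hmem i)).imp id And.left
  rw [h1] at h3
  rw [descList, h3]
  have h4 := sum_pairings_eq_haf (symCorrelation_comm (e := e) (β := β) (ε := ε) (Ub := Ub)
    (Wb := Wb) (t := t)) _ τ.sort.get
  rw [h1, Multiset.sort_eq] at h4
  rw [← h4]
  classical
  refine Finset.sum_congr rfl fun q hq => Finset.prod_congr rfl fun p hp => ?_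
  have hlt := hs ((Finset.mem_filter.1 hq).2.1 p hp)
  exact (symCorrelation_of_lt
    (isGeneric_pair.2 ⟨hlt.ne, hτ.2 _ (hmem p.1), hτ.2 _ (hmem p.2)⟩) hlt).symm

/-- A forward configuration together with its mirror image on the backward branch. -/
theorem IsForward.isGeneric_double {τ : Multiset ℝ} (hτ : IsForward t τ) :
    IsGeneric t (τ + τ.map fun u => 2 * t - u) ∧
      fwd t (τ + τ.map fun u => 2 * t - u) = τ ∧ bwd t (τ + τ.map fun u => 2 * t - u) = τ := by
  have h1 : ∀ s ∈ τ.map (fun u => 2 * t - u), t < s ∧ s < 2 * t := fun s hs => by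
    obtain ⟨u, hu, rfl⟩ := Multiset.mem_map.1 hs
    have := hτ.2 u hu
    exact ⟨by linarith, by linarith⟩
  have hf : Multiset.filter (· < t) τ = τ := Multiset.filter_eq_self.2 fun s hs => (hτ.2 s hs).2
  have hf' : Multiset.filter (fun u => ¬u < t) τ = 0 :=
    Multiset.filter_eq_nil.2 fun s hs => not_not.2 (hτ.2 s hs).2
  have hb : Multiset.filter (· < t) (τ.map fun u => 2 * t - u) = 0 :=
    Multiset.filter_eq_nil.2 fun s hs => (h1 s hs).1.le.not_gt
  have hb' : Multiset.filter (fun u => ¬u < t) (τ.map fun u => 2 * t - u) =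
      τ.map fun u => 2 * t - u := Multiset.filter_eq_self.2 fun s hs => (h1 s hs).1.le.not_gt
  refine ⟨⟨?_, fun s hs => ?_⟩, ?_, ?_⟩
  · rw [Multiset.nodup_add]
    refine ⟨hτ.1, hτ.1.map fun a b h => by simpa using h, ?_⟩
    exact Multiset.disjoint_left.2 fun {s} hs hs' => lt_asymm (hτ.2 s hs).2 (h1 s hs').1
  · rcases Multiset.mem_add.1 hs with hs | hs
    · have := hτ.2 s hs
      exact ⟨this.1, by linarith, this.2.ne⟩
    · have := h1 s hs
      exact ⟨by linarith, this.2, this.1.ne'⟩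
  · rw [fwd, Multiset.filter_add, hf, hb, add_zero]
  · rw [bwd, Multiset.filter_add, hf', hb', zero_add, Multiset.map_map]
    simp

/-- Read contrapositively: at a configuration that is not generic one of the two bath vectors
vanishes. -/
theorem isGeneric_of_isForward {τ : Multiset ℝ} (hf : IsForward t (fwd t τ))
    (hb : IsForward t (bwd t τ)) : IsGeneric t τ := by
  refine ⟨?_, fun s hs => ?_⟩
  · have h1 : (τ.filter fun u => ¬u < t).Nodup := Multiset.Nodup.of_map _ hb.1
    rw [← Multiset.filter_add_not (· < t) τ, Multiset.nodup_add]
    refine ⟨hf.1, h1, Multiset.disjoint_left.2 fun {s} hs hs' => ?_⟩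
    exact (Multiset.mem_filter.1 hs').2 (Multiset.mem_filter.1 hs).2
  · by_cases h : s < t
    · have := hf.2 s (Multiset.mem_filter.2 ⟨hs, h⟩)
      exact ⟨this.1, by linarith, this.2.ne⟩
    · have := hb.2 (2 * t - s) (Multiset.mem_map.2 ⟨s, Multiset.mem_filter.2 ⟨hs, h⟩, rfl⟩)
      exact ⟨by linarith, by linarith, fun h' => by subst h'; linarith⟩

theorem thermalWeight_pos {Hb : K →ₗ.[ℂ] K} (hβ : HasThermalState Hb β e ε) (k : ι) :
    0 < thermalWeight β ε k :=
  div_pos (Real.exp_pos _) (hβ.summable.tsum_pos (fun _ => (Real.exp_pos _).le) k (Real.exp_pos _))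

theorem hasSum_thermalWeight [Nonempty ι] {Hb : K →ₗ.[ℂ] K} (hβ : HasThermalState Hb β e ε) :
    HasSum (thermalWeight β ε) 1 := by
  obtain ⟨k⟩ := ‹Nonempty ι›
  have := hβ.summable.tsum_pos (fun _ => (Real.exp_pos _).le) k (Real.exp_pos _)
  have h := hβ.summable.hasSum.div_const (∑' j, Real.exp (-β * ε j))
  rwa [div_self this.ne'] at h

theorem countable_of_hasThermalState {Hb : K →ₗ.[ℂ] K} (hβ : HasThermalState Hb β e ε) :
    Countable ι := by
  have h := hβ.summable.countable_support
  rw [show Function.support (fun k => Real.exp (-β * ε k)) = Set.univ from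
    Set.eq_univ_of_forall fun k => (Real.exp_pos _).ne'] at h
  exact Set.countable_univ_iff.1 h

end Correlation

section Bath

variable {K ι : Type*} [NormedAddCommGroup K] [InnerProductSpace ℂ K] [CompleteSpace K]
  {Hb : K →ₗ.[ℂ] K} {Ub : ℝ → K →L[ℂ] K} {Wb : K →ₗ.[ℂ] K} {e : HilbertBasis ι ℂ K}
  {β : ℝ} {ε : ι → ℝ} {t : ℝ}
  (hUb : IsEvolutionGroup Hb Ub) (hWb : IsSelfAdjoint Wb) (hβ : HasThermalState Hb β e ε)
  (hdef : BathFunctionalDefined e β ε Ub Wb t) (hWick : WickTheorem e β ε Ub Wb t)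
  (ht : 0 < t) {C : ℝ} (hC : 0 ≤ C) (hB : ∀ τ₁ τ₂ : ℝ, 0 < τ₁ → τ₁ < τ₂ →
    τ₂ < 2 * t → ‖bathCorrelation e β ε Ub Wb t τ₁ τ₂‖ ≤ C)

-- The product with a single coupling at time `t / 2` is defined on `e k`, so the domain contains
-- `Ub (t / 2) (e k)`, a nonzero multiple of `e k`.
include hUb hβ hdef ht in
theorem eigenbasis_mem_domain (k : ι) : e k ∈ Wb.domain := by
  have h := hdef.mem_domain (t / 2) [] k ⟨by simp, by simp; constructor <;> linarith⟩
  obtain ⟨c, hc⟩ := hUb.apply_eigenvector (hβ.eigenvector k) (t / 2)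
  rw [bathPropagator, if_pos (by linarith), List.headD_nil, sub_zero, bathWord, hc] at h
  have hc0 : c ≠ 0 := by
    rintro rfl
    have h1 := hUb.norm_apply (t / 2) (e k)
    rw [hc, zero_smul, norm_zero, e.orthonormal.1 k] at h1
    exact zero_ne_one h1
  have h2 := Wb.domain.smul_mem c⁻¹ h
  rwa [smul_smul, inv_mul_cancel₀ hc0, one_smul] at h2

include hUb hWb hdef hWick ht in
theorem hasSum_bathVector {τ : Multiset ℝ} (hτ : IsGeneric t τ) :
    HasSum (fun k => (thermalWeight β ε k : ℂ) *
      inner ℂ (bathVector Ub Wb t (e k) (bwd t τ)) (bathVector Ub Wb t (e k) (fwd t τ)))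
      (haf (symCorrelation e β ε Ub Wb t) τ) := by
  have h := (hdef.summable _ hτ.isContourTimes).hasSum
  rw [← bathFunctional, bathFunctional_descList hWick hτ] at h
  exact (congrArg (HasSum · _) (funext (bathTerm_descList hUb hWb hdef hτ ht))).mp h

-- For a forward configuration, the weighted squared norms are the trace terms of the configuration
-- joined with its mirror image on the backward branch. Their full sum is therefore a hafnian of
-- twice as many points, and `norm_haf_le` applies. The resulting growth `√n!` of the norms is weak
-- enough against the factor `1 / n!` of the Dyson series.
include hUb hWb hβ hdef hWick ht hC hB in
theorem sum_norm_sq_bathVector_le (F : Finset ι) (τ : Multiset ℝ) :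
    ∑ k ∈ F, thermalWeight β ε k * ‖bathVector Ub Wb t (e k) τ‖ ^ 2 ≤
      (2 * C) ^ Multiset.card τ * (Multiset.card τ).factorial := by
  by_cases hτ : IsForward t τ
  · obtain ⟨h1, h2, h3⟩ := hτ.isGeneric_double
    have h4 := hasSum_bathVector hUb hWb hdef hWick ht h1
    rw [h2, h3] at h4
    have h5 := Complex.reCLM.hasSum h4
    have h6 : (fun k => thermalWeight β ε k * ‖bathVector Ub Wb t (e k) τ‖ ^ 2) =
        fun k => Complex.reCLM ((thermalWeight β ε k : ℂ) *
          inner ℂ (bathVector Ub Wb t (e k) τ) (bathVector Ub Wb t (e k) τ)) := by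
      ext k
      rw [inner_self_eq_norm_sq_to_K, Complex.reCLM_apply,
        Complex.re_ofReal_mul]
      norm_cast
    have h7 := sum_le_hasSum F (fun k _ => mul_nonneg (thermalWeight_pos hβ k).le (sq_nonneg _))
      (h6.symm ▸ h5 : HasSum _ _)
    refine h7.trans ((Complex.re_le_norm _).trans ?_)
    exact norm_haf_le symCorrelation_comm (norm_symCorrelation_le hC hB) _ _ (by
      rw [Multiset.card_add, Multiset.card_map, two_mul])
  · simp only [bathVector, if_neg hτ, norm_zero]
    simp only [ne_eq, OfNat.ofNat_ne_zero, not_false_eq_true, zero_pow, mul_zero,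
      Finset.sum_const_zero]
    positivity

include hUb hWb hβ hdef hWick ht hC hB in
theorem norm_bathVector_le (k : ι) (τ : Multiset ℝ) : ‖bathVector Ub Wb t (e k) τ‖ ≤
    √((2 * C) ^ Multiset.card τ * (Multiset.card τ).factorial / thermalWeight β ε k) := by
  refine Real.le_sqrt_of_sq_le ?_
  rw [le_div_iff₀' (thermalWeight_pos hβ k)]
  simpa using sum_norm_sq_bathVector_le hUb hWb hβ hdef hWick ht hC hB {k} τ

include hUb hWb hβ hdef hWick ht hC hB in
theorem isConf_bathVector_eigenbasis (k : ι) :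
    IsConf fun (_ : Unit) => bathVector Ub Wb t (e k) := by
  have := countable_of_hasThermalState hβ
  refine isConf_bathVector hUb hWb hdef (eigenbasis_mem_domain hUb hβ hdef ht) k fun n => ?_
  exact ⟨_, fun τ hτ => by
    have := norm_bathVector_le hUb hWb hβ hdef hWick ht hC hB k τ
    rwa [hτ] at this⟩

-- On the measurable set of generic pairs, the correlation is a limit of finite sums over the
-- eigenbasis, whose terms are measurable because the bath vectors are.
include hUb hWb hβ hdef hWick ht hC hB in
theorem measurable_symCorrelation :
    Measurable (Function.uncurry (symCorrelation e β ε Ub Wb t)) := by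
  have := countable_of_hasThermalState hβ
  set P : ι → confSpace K := fun k =>
    (isConf_bathVector_eigenbasis hUb hWb hβ hdef hWick ht hC hB k).toSpace
  have hG : MeasurableSet {p : ℝ × ℝ | IsGeneric t {p.1, p.2}} := by
    simp only [isGeneric_pair]
    rw [measurableSet_setOfPred]
    have hl : ∀ {f g : ℝ × ℝ → ℝ}, Measurable f → Measurable g → Measurable fun p => f p < g p :=
      fun hf hg => measurableSet_setOfPred.1 (measurableSet_lt hf hg)
    have hn : ∀ {f g : ℝ × ℝ → ℝ}, Measurable f → Measurable g → Measurable fun p => f p ≠ g p :=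
      fun hf hg => (measurableSet_setOfPred.1 (measurableSet_eq_fun hf hg)).not
    have m1 : Measurable fun p : ℝ × ℝ => p.1 := measurable_fst
    have m2 : Measurable fun p : ℝ × ℝ => p.2 := measurable_snd
    have mc : ∀ c : ℝ, Measurable fun _ : ℝ × ℝ => c := fun c => measurable_const
    exact (hn m1 m2).and (((hl (mc _) m1).and ((hl m1 (mc _)).and (hn m1 (mc _)))).and
      ((hl (mc _) m2).and ((hl m2 (mc _)).and (hn m2 (mc _)))))
  have hm : ∀ k, Measurable fun p : ℝ × ℝ => contourPair t 1 (P k) (P k) {p.1, p.2} := fun k => by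
    have h1 := ((isConf_coe (contourPair t 1 (P k) (P k))).meas 2).comp_measurable
      (g := fun p : ℝ × ℝ => ((), ![p.1, p.2])) (by fun_prop)
    refine (congrArg Measurable (funext fun p => ?_)).mp h1.measurable
    simp
    rfl
  have hs : StronglyMeasurable ({p : ℝ × ℝ | IsGeneric t {p.1, p.2}}.indicator
      fun p => symCorrelation e β ε Ub Wb t p.1 p.2) := by
    refine stronglyMeasurable_of_tendsto (Filter.atTop : Filter (Finset ι))
      (f := fun F => {p : ℝ × ℝ | IsGeneric t {p.1, p.2}}.indicator fun p => ∑ k ∈ F,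
        (thermalWeight β ε k : ℂ) * contourPair t 1 (P k) (P k) {p.1, p.2})
      (fun F => ?_) (tendsto_pi_nhds.2 fun p => ?_)
    · exact (Finset.measurable_fun_sum _ fun k _ =>
        (hm k).const_mul _).stronglyMeasurable.indicator hG
    · by_cases hp : IsGeneric t {p.1, p.2}
      · have h := hasSum_bathVector hUb hWb hdef hWick ht hp
        rw [← bathFunctional_descList hWick hp] at h
        simp only [Set.indicator_of_mem (show p ∈ {p : ℝ × ℝ | IsGeneric t {p.1, p.2}} from hp)]
        rw [symCorrelation, if_pos hp]
        exact h
      · simp only [Set.indicator_of_notMem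
          (show p ∉ {p : ℝ × ℝ | IsGeneric t {p.1, p.2}} from hp), tendsto_const_nhds]
  refine (congrArg Measurable (funext fun p => ?_)).mp hs.measurable
  by_cases hp : IsGeneric t {p.1, p.2}
  · exact Set.indicator_of_mem (show p ∈ {p : ℝ × ℝ | IsGeneric t {p.1, p.2}} from hp) _
  · rw [Set.indicator_of_notMem (show p ∉ {p : ℝ × ℝ | IsGeneric t {p.1, p.2}} from hp),
      Function.uncurry, symCorrelation, if_neg hp]

end Bath
end

noncomputable section

/-! ### Splitting a configuration at its earliest coupling time -/

theorem sort_eq_of_pairwise {l : List ℝ} (hl : l.Pairwise (· ≤ ·)) : (l : Multiset ℝ).sort = l := by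
  refine List.Perm.eq_of_pairwise (le := (· ≤ ·)) (fun _ _ _ _ h h' => le_antisymm h h')
    (Multiset.pairwise_sort _ _) hl ?_
  rw [← Multiset.coe_eq_coe, Multiset.sort_eq]

theorem sort_filter (σ : Multiset ℝ) (p : ℝ → Prop) [DecidablePred p] :
    (σ.filter p).sort = σ.sort.filter p := by
  rw [← sort_eq_of_pairwise ((Multiset.pairwise_sort σ (· ≤ ·)).filter (fun x => decide (p x))),
    ← Multiset.filter_coe, Multiset.sort_eq]

theorem sort_cons_add {u : ℝ} {σ τ : Multiset ℝ} (hu : u ∉ σ) (hτ : ∀ v ∈ τ, u < v) :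
    (u ::ₘ τ + σ).sort = (σ.filter (· < u)).sort ++ u :: (τ + σ.filter (u < ·)).sort := by
  have h1 : ((σ.filter (· < u)).sort ++ u :: (τ + σ.filter (u < ·)).sort).Pairwise (· ≤ ·) := by
    rw [List.pairwise_append, List.pairwise_cons]
    refine ⟨Multiset.pairwise_sort _ _, ⟨fun v hv => ?_, Multiset.pairwise_sort _ _⟩,
      fun v hv w hw => ?_⟩
    · rw [Multiset.mem_sort, Multiset.mem_add, Multiset.mem_filter] at hv
      exact hv.elim (fun h => (hτ v h).le) fun h => h.2.le
    · rw [Multiset.mem_sort, Multiset.mem_filter] at hv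
      rw [List.mem_cons, Multiset.mem_sort, Multiset.mem_add, Multiset.mem_filter] at hw
      rcases hw with rfl | hw | hw
      · exact hv.2.le
      · exact (hv.2.trans (hτ w hw)).le
      · exact (hv.2.trans hw.2).le
  rw [← sort_eq_of_pairwise h1, ← Multiset.coe_add, ← Multiset.cons_coe, Multiset.sort_eq,
    Multiset.sort_eq]
  have h2 : σ.filter (fun v => ¬v < u) = σ.filter (u < ·) := Multiset.filter_congr fun v hv =>
    not_lt.trans (le_iff_lt_or_eq.trans (or_iff_left fun h => hu (h ▸ hv)))
  conv_lhs => rw [← Multiset.filter_add_not (· < u) σ, h2]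
  rw [Multiset.cons_add, Multiset.add_cons, ← add_assoc, ← add_assoc, add_comm τ]

theorem filter_lt_add_filter_gt {u : ℝ} {σ : Multiset ℝ} (hu : u ∉ σ) :
    σ.filter (· < u) + σ.filter (u < ·) = σ := by
  have h2 : σ.filter (fun v => ¬v < u) = σ.filter (u < ·) := Multiset.filter_congr fun v hv =>
    not_lt.trans (le_iff_lt_or_eq.trans (or_iff_left fun h => hu (h ▸ hv)))
  rw [← h2, Multiset.filter_add_not]

theorem nodup_cons_add_iff {u : ℝ} {σ τ : Multiset ℝ} (hu : u ∉ σ) (hσ : σ.Nodup)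
    (hτ : ∀ v ∈ τ, u < v) : (u ::ₘ τ + σ).Nodup ↔ (τ + σ.filter (u < ·)).Nodup := by
  rw [Multiset.cons_add, Multiset.nodup_cons, Multiset.mem_add, not_or]
  have h1 : u ∉ τ := fun h => lt_irrefl _ (hτ u h)
  simp only [h1, hu, not_false_eq_true, true_and]
  rw [Multiset.nodup_add, Multiset.nodup_add]
  refine and_congr_right fun _ => ?_
  simp only [hσ, hσ.filter (u < ·), true_and, Multiset.disjoint_left, Multiset.mem_filter, not_and]
  exact ⟨fun h v hv hv' => absurd hv' (h hv), fun h v hv hv' => h hv hv' (hτ _ hv)⟩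

section Conf

variable {X E : Type*} [MeasurableSpace X] [NormedAddCommGroup E] [NormedSpace ℂ E]

open scoped Classical in
theorem isConf_nodup : IsConf fun (_ : X) (τ : Multiset ℝ) => if τ.Nodup then (1 : ℂ) else 0 := by
  refine ⟨fun n => Measurable.stronglyMeasurable ?_, fun n => ⟨1, fun x σ _ => ?_⟩⟩
  · refine Measurable.ite ?_ measurable_const measurable_const
    simp only [Multiset.coe_nodup, List.nodup_ofFn, Function.Injective]
    rw [measurableSet_setOfPred]
    exact Measurable.forall fun i => Measurable.forall fun j =>
      (measurableSet_setOfPred.1 (measurableSet_eq_fun (by fun_prop) (by fun_prop))).imp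
        measurable_const
  · split_ifs <;> simp

open scoped Classical in
theorem isConf_forall_lt {f : X → ℝ} (hf : Measurable f) :
    IsConf fun (x : X) (τ : Multiset ℝ) => if ∀ u ∈ τ, f x < u then (1 : ℂ) else 0 := by
  refine ⟨fun n => Measurable.stronglyMeasurable ?_, fun n => ⟨1, fun x σ _ => ?_⟩⟩
  · refine Measurable.ite ?_ measurable_const measurable_const
    simp only [Multiset.mem_coe, List.forall_mem_ofFn_iff]
    rw [measurableSet_setOfPred]
    exact Measurable.forall fun i =>
      measurableSet_setOfPred.1 (measurableSet_lt (by fun_prop) (by fun_prop))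
  · split_ifs <;> simp

theorem isConf_pointOp_pow [CompleteSpace E] (μ : Measure ℝ) [IsFiniteMeasure μ]
    {G : X → Multiset ℝ → E} (hG : IsConf G) (n : ℕ) :
    IsConf fun x σ => (pointOp μ ^ n) (hG.slice x).toSpace σ := by
  induction n with
  | zero => exact hG
  | succ n ih =>
    refine (ih.cons.integral μ).congr fun x σ => ?_
    rw [pow_succ', Module.End.mul_apply, pointOp_apply]

/-- A measure without atoms does not see coincidences among the integrated points or with the given
ones. -/
theorem pointOp_pow_congr_nodup [CompleteSpace E] (μ : Measure ℝ) [IsFiniteMeasure μ]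
    [NullSingletonClass μ] {h h' : confSpace E} {P : ℝ → Prop} (hP : ∀ᵐ u ∂μ, P u) (n : ℕ)
    (σ : Multiset ℝ) (H : ∀ τ : Multiset ℝ, Multiset.card τ = n → τ.Nodup →
      (∀ u ∈ τ, P u ∧ u ∉ σ) → h (τ + σ) = h' (τ + σ)) :
    (pointOp μ ^ n) h σ = (pointOp μ ^ n) h' σ := by
  induction n generalizing σ with
  | zero => simpa using H 0 rfl (by simp) (by simp)
  | succ n ih =>
    simp only [pow_succ', Module.End.mul_apply, pointOp_apply]
    have h1 : ∀ᵐ u ∂μ, u ∉ {v | v ∈ σ} :=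
      (σ.toFinset.countable_toSet.mono fun v hv => by simpa using hv).ae_notMem μ
    refine integral_congr_ae ?_
    filter_upwards [hP, h1] with u hu hu'
    refine ih _ fun τ hτ hn hτP => ?_
    have := H (u ::ₘ τ) (by simp [hτ])
      (Multiset.nodup_cons.2 ⟨fun h => (hτP u h).2 (Multiset.mem_cons_self u σ), hn⟩)
      fun v hv => by
        rcases Multiset.mem_cons.1 hv with rfl | hv
        · exact ⟨hu, hu'⟩
        · exact ⟨(hτP v hv).1, fun h => (hτP v hv).2 (Multiset.mem_cons_of_mem h)⟩
    simpa [Multiset.cons_add, Multiset.add_cons] using this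

omit [NormedSpace ℂ E] in
open scoped Classical in
-- Exactly one point of a configuration of distinct points is smaller than all the others. In this
-- form `pointOp_pow_sumErase` singles out the earliest coupling time.
theorem eq_sumErase_min {F : Multiset ℝ → E} (hF : ∀ τ, ¬τ.Nodup → F τ = 0) {τ : Multiset ℝ}
    (hτ : τ ≠ 0) :
    F τ = sumErase (fun v τ' => if ∀ w ∈ τ', v < w then F (v ::ₘ τ') else 0) τ := by
  have hne : τ.toFinset.Nonempty := by
    obtain ⟨v, hv⟩ := Multiset.exists_mem_of_ne_zero hτ
    exact ⟨v, Multiset.mem_toFinset.2 hv⟩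
  obtain ⟨m, hm, hmin⟩ := τ.toFinset.exists_min_image id hne
  simp only [Multiset.mem_toFinset, id] at hm hmin
  obtain ⟨τ', rfl⟩ := Multiset.exists_cons_of_mem hm
  rw [sumErase_cons, sumErase_congr (G' := fun _ _ => 0)]
  · have h0 : sumErase (fun _ _ => (0 : E)) τ' = 0 := by simp [sumErase]
    rw [h0, add_zero]
    split_ifs with h
    · rfl
    · refine hF _ fun hn => h fun w hw => ?_
      rw [Multiset.nodup_cons] at hn
      exact lt_of_le_of_ne (hmin w (Multiset.mem_cons_of_mem hw)) fun h' => hn.1 (h' ▸ hw)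
  · intro v hv
    exact if_neg fun h => (h m (Multiset.mem_cons_self _ _)).not_ge
      (hmin v (Multiset.mem_cons_of_mem hv))

end Conf

theorem continuous_insertedEvolution {E : Type*} [NormedAddCommGroup E] [InnerProductSpace ℂ E]
    [CompleteSpace E] {H : E →ₗ.[ℂ] E} {U : ℝ → E →L[ℂ] E} (hU : IsEvolutionGroup H U)
    (C : E →L[ℂ] E) (t : ℝ) (n : ℕ) : Continuous fun p : (Fin n → ℝ) × ℝ × E =>
      insertedEvolution U C t p.2.1 (List.ofFn p.1) p.2.2 := by
  induction n with
  | zero =>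
    simp only [List.ofFn_zero, insertedEvolution]
    exact hU.continuous_uncurry.comp (f := fun p : (Fin 0 → ℝ) × ℝ × E => (t - p.2.1, p.2.2))
      (by fun_prop)
  | succ n ih =>
    simp only [List.ofFn_succ, insertedEvolution_cons_apply]
    have h1 : Continuous fun p : (Fin (n + 1) → ℝ) × ℝ × E => U (p.1 0 - p.2.1) p.2.2 :=
      hU.continuous_uncurry.comp (f := fun p : (Fin (n + 1) → ℝ) × ℝ × E =>
        (p.1 0 - p.2.1, p.2.2)) (by fun_prop)
    exact ih.comp (f := fun p : (Fin (n + 1) → ℝ) × ℝ × E =>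
      ((fun i => p.1 i.succ), p.1 0, C (U (p.1 0 - p.2.1) p.2.2)))
      (Continuous.prodMk (by fun_prop) (Continuous.prodMk (by fun_prop) (C.continuous.comp h1)))

theorem isConf_insertedEvolution {E : Type*} [NormedAddCommGroup E] [InnerProductSpace ℂ E]
    [CompleteSpace E] {H : E →ₗ.[ℂ] E} {U : ℝ → E →L[ℂ] E} (hU : IsEvolutionGroup H U)
    (C : E →L[ℂ] E) (t s : ℝ) (a : E) :
    IsConf fun (_ : Unit) (τ : Multiset ℝ) => insertedEvolution U C t s τ.sort a := by
  refine isConf_sort (Φ := fun l => insertedEvolution U C t s l a) (fun n => ?_) fun n => ?_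
  · exact ((continuous_insertedEvolution hU C t n).comp
      (f := fun x : Fin n → ℝ => (x, s, a)) (by fun_prop)).stronglyMeasurable
  · refine ⟨‖C‖ ^ n * ‖a‖, fun l hl => (ContinuousLinearMap.le_opNorm _ _).trans ?_⟩
    gcongr
    rw [← hl]
    exact norm_insertedEvolution_le hU.norm_le_one le_rfl t s l

section Dyson

variable {S K ι : Type*}
    [NormedAddCommGroup S] [InnerProductSpace ℂ S] [CompleteSpace S]
    [NormedAddCommGroup K] [InnerProductSpace ℂ K] [CompleteSpace K]
    {Hs : S →ₗ.[ℂ] S} {Us : ℝ → S →L[ℂ] S} {Ws : S →L[ℂ] S}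
    {Hb : K →ₗ.[ℂ] K} {Ub : ℝ → K →L[ℂ] K} {Wb : K →ₗ.[ℂ] K}
    {H : Joint S K →ₗ.[ℂ] Joint S K} {U : ℝ → Joint S K →L[ℂ] Joint S K}

open scoped Classical in
/-- The integrand of the Dyson series that starts at time `s` from the system vector `a`, with
insertions at the points of `σ` and previous coupling times `ν`. -/
def dysonIntegrand (Us : ℝ → S →L[ℂ] S) (C : S →L[ℂ] S) (Ub : ℝ → K →L[ℂ] K) (Wb : K →ₗ.[ℂ] K)
    (t : ℝ) (x : K) (s : ℝ) (σ : Multiset ℝ) (a : S) (ν τ : Multiset ℝ) : Joint S K :=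
  if (τ + σ).Nodup ∧ ∀ u ∈ τ, s < u then
    tens (insertedEvolution Us C t s (τ + σ).sort a) (bathVector Ub Wb t x (τ + ν)) else 0

omit [CompleteSpace K] in
theorem isConf_dysonIntegrand (hUs : IsEvolutionGroup Hs Us) (C : S →L[ℂ] S) {t : ℝ} {x : K}
    (hx : IsConf fun (_ : Unit) => bathVector Ub Wb t x) (s : ℝ) (σ : Multiset ℝ) (a : S)
    (ν : Multiset ℝ) : IsConf fun (_ : Unit) => dysonIntegrand Us C Ub Wb t x s σ a ν := by
  classical
  have h1 := ((isConf_insertedEvolution hUs C t s a).add_const σ).map₂ (hx.add_const ν)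
    (φ := tens) continuous_tens zero_le_one (fun a b => by rw [norm_tens, one_mul])
  refine (((isConf_nodup (X := Unit)).add_const σ).smul
    ((isConf_forall_lt (f := fun _ : Unit => s) (by fun_prop)).smul h1)).congr fun _ τ => ?_
  rw [dysonIntegrand]
  by_cases h2 : (τ + σ).Nodup <;> by_cases h3 : ∀ u ∈ τ, s < u <;> simp [h2, h3]

omit [CompleteSpace S] [CompleteSpace K] in
open scoped Classical in
-- Splitting at the earliest coupling time `u`: insertions before `u` act on the system vector, then
-- `C` acts, and `u` joins the previous couplings of the bath. What remains is an integrand of the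
-- same kind started at `u`, so the induction for the remainder can run.
theorem dysonIntegrand_cons (C : S →L[ℂ] S) {t : ℝ} {x : K} {s u : ℝ} {σ : Multiset ℝ}
    (hσ : σ.Nodup) (hu : u ∉ σ) (hsu : s < u) (a : S) (ν τ : Multiset ℝ) :
    (if ∀ w ∈ τ, u < w then dysonIntegrand Us C Ub Wb t x s σ a ν (u ::ₘ τ) else 0) =
      dysonIntegrand Us C Ub Wb t x u (σ.filter (u < ·))
        (C (insertedEvolution Us C u s (σ.filter (· < u)).sort a)) (u ::ₘ ν) τ := by
  by_cases h : ∀ w ∈ τ, u < w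
  · have h1 : ∀ w ∈ u ::ₘ τ, s < w := fun w hw => by
      rcases Multiset.mem_cons.1 hw with rfl | hw
      · exact hsu
      · exact hsu.trans (h w hw)
    rw [if_pos h, dysonIntegrand, dysonIntegrand]
    by_cases h2 : (τ + σ.filter (u < ·)).Nodup
    · rw [if_pos ⟨(nodup_cons_add_iff hu hσ h).2 h2, h1⟩, if_pos ⟨h2, h⟩, sort_cons_add hu h,
        insertedEvolution_append, Multiset.cons_add, Multiset.add_cons]
      rfl
    · rw [if_neg fun h' => h2 ((nodup_cons_add_iff hu hσ h).1 h'.1), if_neg fun h' => h2 h'.1]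
  · rw [if_neg h, dysonIntegrand, if_neg fun h' => h h'.2]

end Dyson
end

noncomputable section

/-! ### The remainder of the Dyson series -/

section Dyson

variable {S K ι : Type*}
    [NormedAddCommGroup S] [InnerProductSpace ℂ S] [CompleteSpace S]
    [NormedAddCommGroup K] [InnerProductSpace ℂ K] [CompleteSpace K]
    {Hs : S →ₗ.[ℂ] S} {Us : ℝ → S →L[ℂ] S} {Ws : S →L[ℂ] S}
    {Hb : K →ₗ.[ℂ] K} {Ub : ℝ → K →L[ℂ] K} {Wb : K →ₗ.[ℂ] K}
    {H : Joint S K →ₗ.[ℂ] Joint S K} {U : ℝ → Joint S K →L[ℂ] Joint S K}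
    {e : HilbertBasis ι ℂ K} {β : ℝ} {ε : ι → ℝ} {t : ℝ}

/-- The Dyson integrand as an element of the space of functions of configurations. -/
def dysonSpace (hUs : IsEvolutionGroup Hs Us) (C : S →L[ℂ] S) {x : K}
    (hx : IsConf fun (_ : Unit) => bathVector Ub Wb t x) (s : ℝ) (σ : Multiset ℝ) (a : S)
    (ν : Multiset ℝ) : confSpace (Joint S K) :=
  (isConf_dysonIntegrand hUs C hx s σ a ν).toSpace

theorem integral_Ioo_pow_sub {s t : ℝ} (hst : s ≤ t) (N : ℕ) :
    ∫ u in Set.Ioo s t, (t - u) ^ N / N.factorial = (t - s) ^ (N + 1) / (N + 1).factorial := by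
  rw [← integral_Ioc_eq_integral_Ioo, ← intervalIntegral.integral_of_le hst,
    intervalIntegral.integral_div, intervalIntegral.integral_comp_sub_left (fun u => u ^ N),
    integral_pow, sub_self, Nat.factorial_succ]
  push_cast
  rw [zero_pow (Nat.succ_ne_zero N), sub_zero, div_div]

variable (hUs : IsEvolutionGroup Hs Us) (hUb : IsEvolutionGroup Hb Ub)
  (hU : IsEvolutionGroup H U) (hWb : IsSelfAdjoint Wb)
  (hH : ExtendsTotalHamiltonian Hs Hb Wb Ws H)
  (hdef : BathFunctionalDefined e β ε Ub Wb t) (k : ι)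
  {b : ℕ → ℝ} (hb : ∀ τ, ‖bathVector Ub Wb t (e k) τ‖ ≤ b (Multiset.card τ))

include hUb hb in
theorem norm_bathWord_le {l : List ℝ} (hl : l.Pairwise (· > ·)) (hl' : ∀ s ∈ l, 0 < s ∧ s < t) :
    ‖bathWord Ub Wb t l (e k)‖ ≤ b l.length := by
  have := hb l
  rwa [bathVector_coe hl hl', hUb.norm_apply, Multiset.coe_card] at this

include hUb hdef hb in
theorem couplingDomain_bathWord (ht : 0 < t) {l : List ℝ} (hl : l.Pairwise (· > ·))
    (hl' : ∀ s ∈ l, 0 < s ∧ s < t) :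
    CouplingDomain Ub Wb (bathWord Ub Wb t l (e k)) (t - l.headD 0) ∧
    ∀ u ∈ Set.Ioo (l.headD 0) t, ((u :: l).Pairwise (· > ·) ∧ ∀ s ∈ u :: l, 0 < s ∧ s < t) ∧
      coupled Ub Wb (bathWord Ub Wb t l (e k)) (t - l.headD 0) (u - l.headD 0) =
        bathWord Ub Wb t (u :: l) (e k) := by
  have h0 : ∀ u ∈ Set.Ioo (l.headD 0) t, (u :: l).Pairwise (· > ·) ∧
      ∀ s ∈ u :: l, 0 < s ∧ s < t := by
    intro u hu
    cases l with
    | nil => exact ⟨by simp, by simpa using hu⟩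
    | cons s l =>
      simp only [List.headD_cons] at hu
      have hs := hl' s (by simp)
      refine ⟨List.pairwise_cons.2 ⟨fun r hr => ?_, hl⟩, fun r hr => ?_⟩
      · rcases List.mem_cons.1 hr with rfl | hr
        · exact hu.1
        · exact ((List.pairwise_cons.1 hl).1 r hr).trans hu.1
      · rcases List.mem_cons.1 hr with rfl | hr
        · exact ⟨hs.1.trans hu.1, hu.2⟩
        · exact hl' r hr
  have h1 : ∀ u ∈ Set.Ioo (l.headD 0) t, Ub (u - l.headD 0) (bathWord Ub Wb t l (e k)) ∈
      Wb.domain ∧ applyOp Wb (Ub (u - l.headD 0) (bathWord Ub Wb t l (e k))) =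
        bathWord Ub Wb t (u :: l) (e k) := by
    intro u hu
    obtain ⟨h2, h3⟩ := h0 u hu
    have h4 := hdef.mem_domain u l k ⟨h2, fun r hr => ⟨(h3 r hr).1, by linarith [(h3 r hr).2]⟩⟩
    rw [bathPropagator, if_pos hu.2] at h4
    refine ⟨h4, ?_⟩
    rw [bathWord, bathPropagator, if_pos hu.2]
  refine ⟨⟨fun r hr hrt => ?_, b (l.length + 1), fun r hr hrt => ?_⟩, fun u hu => ⟨h0 u hu, ?_⟩⟩
  · have := (h1 (r + l.headD 0) ⟨by linarith, by linarith⟩).1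
    rwa [add_sub_cancel_right] at this
  · have hmem : r + l.headD 0 ∈ Set.Ioo (l.headD 0) t := ⟨by linarith, by linarith⟩
    have h5 := (h1 _ hmem).2
    rw [add_sub_cancel_right] at h5
    obtain ⟨h2, h3⟩ := h0 _ hmem
    rw [h5]
    exact norm_bathWord_le hUb k hb h2 h3
  · rw [coupled, Set.indicator_of_mem (by
      exact ⟨by linarith [hu.1], by linarith [hu.2]⟩)]
    exact (h1 u hu).2

include hUs hUb hU hWb hH hdef hb in
/-- The remainder of the Dyson series. -/
theorem norm_sub_dyson_le [Countable ι] (he : ∀ j, e j ∈ Wb.domain) (ht : 0 < t)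
    (hx : IsConf fun (_ : Unit) => bathVector Ub Wb t (e k)) (N : ℕ) {l : List ℝ}
    (hl : l.Pairwise (· > ·)) (hl' : ∀ s ∈ l, 0 < s ∧ s < t) {σ : Multiset ℝ} (hσ : σ.Nodup)
    (hσl : ∀ u ∈ σ, l.headD 0 < u ∧ u < t) (a : S) :
    ‖insertedEvolution U (opTensor (-Complex.I • Ws) 1) t (l.headD 0) σ.sort
        (tens a (bathWord Ub Wb t l (e k))) -
      ∑ n ∈ Finset.range N, ((n.factorial : ℂ)⁻¹) •
        (pointOp (volume.restrict (Set.Ioo 0 t)) ^ n)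
          (dysonSpace hUs (-Complex.I • Ws) hx (l.headD 0) σ a l) 0‖ ≤
      ‖Ws‖ ^ Multiset.card σ * ‖a‖ * ‖Ws‖ ^ N * b (l.length + N) *
        ((t - l.headD 0) ^ N / N.factorial) := by
  have hC : ‖-Complex.I • Ws‖ ≤ ‖Ws‖ := by rw [norm_smul, norm_neg, Complex.norm_I, one_mul]
  have hC' : ‖opTensor (-Complex.I • Ws) (1 : K →L[ℂ] K)‖ ≤ ‖Ws‖ :=
    (norm_opTensor_one_le _).trans hC
  induction N generalizing l σ a with
  | zero =>
    rw [Finset.range_zero, Finset.sum_empty, sub_zero, pow_zero, pow_zero, Nat.factorial_zero,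
      Nat.cast_one, div_one, mul_one, mul_one, add_zero]
    refine (ContinuousLinearMap.le_opNorm _ _).trans ?_
    have h1 := norm_insertedEvolution_le hU.norm_le_one hC' t (l.headD 0) σ.sort
    rw [Multiset.length_sort] at h1
    rw [norm_tens, mul_assoc]
    gcongr
    exact norm_bathWord_le hUb k hb hl hl'
  | succ N ih =>
    set C : S →L[ℂ] S := -Complex.I • Ws with hCdef
    set C' : Joint S K →L[ℂ] Joint S K := opTensor C 1
    set s := l.headD 0 with hs
    set μ := (volume.restrict (Set.Ioo 0 t) : Measure ℝ) with hμ
    have hs0 : 0 ≤ s := by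
      cases l with
      | nil => exact le_rfl
      | cons r l => exact (hl' r (by simp)).1.le
    have hst : s < t := by
      cases l with
      | nil => exact ht
      | cons r l => exact (hl' r (by simp)).2
    set y := bathWord Ub Wb t l (e k) with hy
    obtain ⟨hdom, hcoup⟩ := couplingDomain_bathWord hUb hdef k hb ht hl hl'
    obtain ⟨hint, heq⟩ := hdom.duhamel_inserted hUb hWb e he hUs hU hH σ.sort hst
      (by have := pairwise_descList.2 hσ; rwa [descList, List.pairwise_reverse] at this)
      (fun r hr => hσl r (by simpa using hr)) a
    set F := dysonSpace hUs C hx s σ a l with hF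
    classical
    -- In `G v` the point `v` is the earliest coupling time.
    set G : ℝ → Multiset ℝ → Joint S K := fun v τ => if ∀ w ∈ τ, v < w then F (v ::ₘ τ) else 0
      with hG
    have hGc : IsConf G := by
      refine ((isConf_forall_lt (f := fun v : ℝ => v) measurable_id).smul
        ((isConf_coe F).cons.comp (f := fun v : ℝ => ((), v)) (by fun_prop))).congr fun v τ => ?_
      simp only [hG]
      split_ifs <;> simp
    have hFn : ∀ τ : Multiset ℝ, ¬τ.Nodup → F τ = 0 := fun τ hτ => by
      rw [hF, dysonSpace, IsConf.toSpace_apply, dysonIntegrand, if_neg fun h => hτ ?_]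
      exact (Multiset.nodup_add.1 h.1).1
    -- There are `n + 1` candidates for the earliest of `n + 1` points, which turns `1 / (n + 1)!`
    -- into `1 / n!`.
    have hFG : ∀ n, (((n + 1).factorial : ℂ)⁻¹) • (pointOp μ ^ (n + 1)) F 0 =
        ((n.factorial : ℂ)⁻¹) • ∫ v, (pointOp μ ^ n) (hGc.slice v).toSpace 0 ∂μ := fun n => by
      have h1 : (pointOp μ ^ (n + 1)) F 0 =
          (pointOp μ ^ (n + 1)) (isConf_sumErase hGc).toSpace 0 := by
        refine pointOp_pow_congr μ (P := fun _ => True) (by simp) _ _ fun τ hτ _ => ?_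
        rw [add_zero, IsConf.toSpace_apply]
        exact eq_sumErase_min hFn fun h => by simp [h] at hτ
      rw [h1, pointOp_pow_sumErase μ hGc n, pointOp_pow_paramIntegral, smul_smul,
        Nat.factorial_succ]
      congr 1
      push_cast
      have : ((n : ℂ) + 1) ≠ 0 := by exact_mod_cast Nat.succ_ne_zero n
      field_simp
    have hIi : ∀ n, Integrable (fun v => (pointOp μ ^ n) (hGc.slice v).toSpace 0) μ := fun n =>
      (isConf_pointOp_pow μ hGc n).integrable μ 0
    set Q : ℝ → Joint S K := fun v => ∑ n ∈ Finset.range N,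
      ((n.factorial : ℂ)⁻¹) • (pointOp μ ^ n) (hGc.slice v).toSpace 0 with hQ
    have hIs : ∀ n, Integrable (fun v => ((n.factorial : ℂ)⁻¹) •
        (pointOp μ ^ n) (hGc.slice v).toSpace 0) μ := fun n => (hIi n).smul ((n.factorial : ℂ)⁻¹)
    have hQi : Integrable Q μ := integrable_finsetSum _ fun n _ => hIs n
    have hsum : ∑ n ∈ Finset.range (N + 1), ((n.factorial : ℂ)⁻¹) • (pointOp μ ^ n) F 0 =
        tens (insertedEvolution Us C t s σ.sort a) (Ub (t - s) y) + ∫ v in Set.Ioo s t, Q v := by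
      rw [Finset.sum_range_succ', add_comm]
      congr 1
      · rw [Nat.factorial_zero, Nat.cast_one, inv_one, one_smul, pow_zero, Module.End.one_apply, hF,
          dysonSpace, IsConf.toSpace_apply, dysonIntegrand, if_pos (by simpa using hσ), zero_add,
          zero_add, bathVector_coe hl hl']
      -- The integrand vanishes unless all coupling times are later than `s`.
      · have h1 : ∫ v in Set.Ioo 0 t, Q v = ∫ v in Set.Ioo s t, Q v := by
          refine setIntegral_eq_of_subset_of_forall_sdiff_eq_zero measurableSet_Ioo
            (Set.Ioo_subset_Ioo_left hs0) fun v hv => ?_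
          have hvs : ¬s < v := fun h => hv.2 ⟨h, hv.1.2⟩
          have hG0 : (hGc.slice v).toSpace = 0 := by
            ext τ
            rw [IsConf.toSpace_apply]
            simp only [hG]
            split_ifs
            · rw [hF, dysonSpace, IsConf.toSpace_apply, dysonIntegrand,
                if_neg fun h => hvs (h.2 v (Multiset.mem_cons_self _ _))]
              rfl
            · rfl
          simp only [hQ, hG0, map_zero]
          exact Finset.sum_eq_zero fun n _ => smul_zero _
        rw [← h1]
        simp only [hQ]
        rw [integral_finsetSum _ fun n _ => hIs n]
        refine Finset.sum_congr rfl fun n _ => ?_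
        rw [hFG, integral_smul]
    have hQi' : IntegrableOn Q (Set.Ioo s t) :=
      IntegrableOn.mono_set (t := Set.Ioo 0 t) hQi (Set.Ioo_subset_Ioo_left hs0)
    -- The free term of Duhamel's formula cancels the term of order zero. Under the integral over
    -- the first coupling time `u` stands the remainder of order `N` of the evolution restarted at
    -- `u`.
    rw [hsum, heq, add_sub_add_left_eq_sub, ← integral_sub hint hQi']
    have hae : ∀ᵐ u ∂(volume.restrict (Set.Ioo s t) : Measure ℝ), u ∉ {v | v ∈ σ} :=
      (σ.toFinset.countable_toSet.mono fun v hv => by simpa using hv).ae_notMem _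
    set c := ‖Ws‖ ^ Multiset.card σ * ‖a‖ * ‖Ws‖ ^ (N + 1) * b (l.length + (N + 1)) with hc
    have hgi : IntegrableOn (fun u => c * ((t - u) ^ N / N.factorial)) (Set.Ioo s t) := by
      refine (Continuous.integrableOn_Icc (by fun_prop)).mono_set Set.Ioo_subset_Icc_self
    refine (norm_integral_le_of_norm_le hgi ?_).trans_eq ?_
    swap
    · rw [integral_const_mul, integral_Ioo_pow_sub hst.le]
    filter_upwards [hae, ae_restrict_mem measurableSet_Ioo] with u hu hut
    obtain ⟨⟨g1, g2⟩, g3⟩ := hcoup u hut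
    have hGu : (hGc.slice u).toSpace = dysonSpace hUs C hx u (σ.filter (u < ·))
        (C (insertedEvolution Us C u s (σ.filter (· < u)).sort a))
        ((u :: l : List ℝ) : Multiset ℝ) := by
      ext τ
      rw [IsConf.toSpace_apply, dysonSpace, IsConf.toSpace_apply, ← Multiset.cons_coe]
      exact dysonIntegrand_cons C hσ hu hut.1 a l τ
    have h := ih g1 g2 (σ := σ.filter (u < ·)) (hσ.filter _) (fun v hv => by
      rw [Multiset.mem_filter] at hv
      exact ⟨hv.2, (hσl v hv.1).2⟩) (C (insertedEvolution Us C u s (σ.filter (· < u)).sort a))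
    simp only [List.headD_cons] at h
    have e1 := sort_filter σ (u < ·)
    have e2 := sort_filter σ (· < u)
    rw [← e1, ← e2, g3]
    simp only [hQ, hGu]
    refine h.trans ?_
    have h6 : ‖C (insertedEvolution Us C u s (σ.filter (· < u)).sort a)‖ ≤
        ‖Ws‖ * (‖Ws‖ ^ Multiset.card (σ.filter (· < u)) * ‖a‖) := by
      refine (C.le_opNorm _).trans (mul_le_mul hC ?_ (norm_nonneg _) (norm_nonneg _))
      refine (ContinuousLinearMap.le_opNorm _ _).trans
        (mul_le_mul_of_nonneg_right ?_ (norm_nonneg _))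
      have := norm_insertedEvolution_le hUs.norm_le_one hC u s (σ.filter (· < u)).sort
      rwa [Multiset.length_sort] at this
    have hcard : Multiset.card (σ.filter (· < u)) + Multiset.card (σ.filter (u < ·)) =
        Multiset.card σ := by rw [← Multiset.card_add, filter_lt_add_filter_gt hu]
    have hlen : (u :: l).length + N = l.length + (N + 1) := by
      rw [List.length_cons]; ring
    -- Any configuration of this size shows that the bound is nonnegative.
    have hb0 : 0 ≤ b (l.length + (N + 1)) :=
      (norm_nonneg _).trans ((hb (Multiset.replicate (l.length + (N + 1)) 0)).trans_eq (by simp))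
    have hpos : 0 ≤ (t - u) ^ N / (N.factorial : ℝ) :=
      div_nonneg (pow_nonneg (by linarith [hut.2]) _) (Nat.cast_nonneg _)
    rw [hlen]
    calc _ ≤ ‖Ws‖ ^ Multiset.card (σ.filter (u < ·)) *
          (‖Ws‖ * (‖Ws‖ ^ Multiset.card (σ.filter (· < u)) * ‖a‖)) * ‖Ws‖ ^ N *
          b (l.length + (N + 1)) * ((t - u) ^ N / N.factorial) := by gcongr
      _ = _ := by
        rw [hc, ← hcard]
        ring

end Dyson
end

noncomputable section

/-! ### Convergence of the Dyson series -/

/-- By the inequality of arithmetic and geometric means, a term `r` is at most half of `(2 ^ n r)² +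
4 ^ (-n)`, and `(2 ^ n r)²` is a term of an exponential series. -/
theorem summable_pow_mul_sqrt_div_factorial {Z Y : ℝ} (hY : 0 ≤ Y) :
    Summable fun n : ℕ => |Z| ^ n * √(Y ^ n * n.factorial) / n.factorial := by
  refine Summable.of_nonneg_of_le (fun n => by positivity) (fun n => ?_)
    (((Real.summable_pow_div_factorial (4 * (|Z| ^ 2 * Y))).add
      (summable_geometric_of_lt_one (by norm_num) (by norm_num : (4 : ℝ)⁻¹ < 1))).mul_left 2⁻¹)
  set r := |Z| ^ n * √(Y ^ n * n.factorial) / n.factorial with hr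
  have hf : (0 : ℝ) < n.factorial := Nat.cast_pos.2 n.factorial_pos
  have h1 : r ^ 2 = (|Z| ^ 2 * Y) ^ n / n.factorial := by
    rw [hr, div_pow, mul_pow, Real.sq_sqrt (by positivity)]
    field_simp
    ring
  have h2 : (4 * (|Z| ^ 2 * Y)) ^ n / n.factorial = (2 ^ n * r) ^ 2 := by
    rw [mul_pow (2 ^ n) r 2, h1, mul_pow, ← pow_mul, mul_comm n 2, pow_mul]
    norm_num
    ring
  have h3 : ((4 : ℝ)⁻¹) ^ n = ((2 : ℝ)⁻¹ ^ n) ^ 2 := by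
    rw [← pow_mul, mul_comm n 2, pow_mul]; norm_num
  have h4 : (2 : ℝ) ^ n * (2 : ℝ)⁻¹ ^ n = 1 := by rw [← mul_pow]; norm_num
  rw [h2, h3]
  nlinarith [sq_nonneg (2 ^ n * r - (2 : ℝ)⁻¹ ^ n)]

theorem sum_norm_pointOp_pow_le {E I : Type*} [NormedAddCommGroup E] [NormedSpace ℂ E]
    (μ : Measure ℝ) [IsFiniteMeasure μ] (F : Finset I) (h : I → confSpace E) {β : ℝ} (n : ℕ)
    (σ : Multiset ℝ) (hβ : ∀ τ, Multiset.card τ = n → ∑ i ∈ F, ‖h i (τ + σ)‖ ≤ β) :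
    ∑ i ∈ F, ‖(pointOp μ ^ n) (h i) σ‖ ≤ μ.real Set.univ ^ n * β := by
  induction n generalizing σ with
  | zero => simpa using hβ 0 rfl
  | succ n ih =>
    simp only [pow_succ' (pointOp μ) n, Module.End.mul_apply]
    refine ((pointKernel μ).sum_norm_op_le F (fun i => (pointOp μ ^ n) (h i))
      (β := μ.real Set.univ ^ n * β) (Filter.Eventually.of_forall fun u => ?_)).trans_eq ?_
    · refine ih _ fun τ hτ => ?_
      have := hβ (u ::ₘ τ) (by simp [hτ])
      simpa [pointKernel, ← Multiset.cons_coe, Multiset.cons_add, Multiset.add_cons] using this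
    · simp [pointKernel, pow_succ', mul_assoc]

theorem isConf_of_hasSum {E I : Type*} [NormedAddCommGroup E] [NormedSpace ℂ E] [Countable I]
    {h : I → confSpace E} {H : Multiset ℝ → E} (hs : ∀ σ, HasSum (fun i => h i σ) (H σ))
    (hb : ∀ n, ∃ C, ∀ (F : Finset I) (σ : Multiset ℝ), Multiset.card σ = n →
      ∑ i ∈ F, ‖h i σ‖ ≤ C) : IsConf fun (_ : Unit) => H := by
  refine ⟨fun n => ?_, fun n => ?_⟩
  · refine stronglyMeasurable_of_tendsto (Filter.atTop : Filter (Finset I))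
      (f := fun (F : Finset I) (p : Unit × (Fin n → ℝ)) =>
        ∑ i ∈ F, h i (List.ofFn p.2 : Multiset ℝ)) (fun F => ?_)
      (tendsto_pi_nhds.2 fun p => hs (List.ofFn p.2 : Multiset ℝ))
    exact Finset.stronglyMeasurable_fun_sum _ fun i _ => (isConf_coe (h i)).meas n
  · obtain ⟨C, hC⟩ := hb n
    exact ⟨C, fun _ σ hσ => le_of_tendsto (hs σ).norm (Filter.Eventually.of_forall fun F =>
      (norm_sum_le _ _).trans (hC F σ hσ))⟩

open scoped Classical in
theorem isConf_isForward (t : ℝ) :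
    IsConf fun (_ : Unit) (τ : Multiset ℝ) => if IsForward t τ then (1 : ℂ) else 0 := by
  refine ⟨fun n => Measurable.stronglyMeasurable ?_, fun n => ⟨1, fun x σ _ => ?_⟩⟩
  · refine Measurable.ite ?_ measurable_const measurable_const
    simp only [IsForward, Multiset.coe_nodup, List.nodup_ofFn, Function.Injective,
      Multiset.mem_coe, List.forall_mem_ofFn_iff]
    rw [measurableSet_setOfPred]
    refine Measurable.and ?_ ?_
    · exact Measurable.forall fun i => Measurable.forall fun j =>
        (measurableSet_setOfPred.1 (measurableSet_eq_fun (by fun_prop) (by fun_prop))).imp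
          measurable_const
    · exact Measurable.forall fun i =>
        (measurableSet_setOfPred.1 (measurableSet_lt (by fun_prop) (by fun_prop))).and
        (measurableSet_setOfPred.1 (measurableSet_lt (by fun_prop) (by fun_prop)))
  · split_ifs <;> simp

open scoped Classical in
/-- The vector `x` evolved from time `0` to time `t`, interrupted by `C` at the points of a forward
configuration (and zero for other configurations). -/
def forwardEvolution {E : Type*} [NormedAddCommGroup E] [NormedSpace ℂ E]
    (G : ℝ → E →L[ℂ] E) (C : E →L[ℂ] E) (t : ℝ) (x : E) (ρ : Multiset ℝ) : E :=
  if IsForward t ρ then insertedEvolution G C t 0 ρ.sort x else 0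

section Forward

variable {E : Type*} [NormedAddCommGroup E] [InnerProductSpace ℂ E] [CompleteSpace E]
  {H : E →ₗ.[ℂ] E} {U : ℝ → E →L[ℂ] E} (hU : IsEvolutionGroup H U)
include hU

theorem norm_forwardEvolution_le {C : E →L[ℂ] E} {M : ℝ} (hC : ‖C‖ ≤ M) (t : ℝ) (x : E)
    (ρ : Multiset ℝ) : ‖forwardEvolution U C t x ρ‖ ≤ M ^ Multiset.card ρ * ‖x‖ := by
  have hM : 0 ≤ M := (norm_nonneg _).trans hC
  rw [forwardEvolution]
  split_ifs
  · refine (ContinuousLinearMap.le_opNorm _ _).trans ?_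
    have h1 := norm_insertedEvolution_le hU.norm_le_one hC t 0 ρ.sort
    rw [Multiset.length_sort] at h1
    gcongr
  · rw [norm_zero]
    positivity

theorem isConf_forwardEvolution (C : E →L[ℂ] E) (t : ℝ) (x : E) :
    IsConf fun (_ : Unit) => forwardEvolution U C t x := by
  classical
  refine ((isConf_isForward t).smul (isConf_insertedEvolution hU C t 0 x)).congr fun _ τ => ?_
  rw [forwardEvolution]
  split_ifs <;> simp

end Forward

theorem IsForward.of_add {t : ℝ} {τ ρ : Multiset ℝ} (h : IsForward t (τ + ρ)) :
    IsForward t τ ∧ IsForward t ρ :=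
  ⟨⟨(Multiset.nodup_add.1 h.1).1, fun s hs => h.2 s (Multiset.mem_add.2 (Or.inl hs))⟩,
    ⟨(Multiset.nodup_add.1 h.1).2.1, fun s hs => h.2 s (Multiset.mem_add.2 (Or.inr hs))⟩⟩

section Dyson

variable {S K ι : Type*}
    [NormedAddCommGroup S] [InnerProductSpace ℂ S] [CompleteSpace S]
    [NormedAddCommGroup K] [InnerProductSpace ℂ K] [CompleteSpace K]
    {Hs : S →ₗ.[ℂ] S} {Us : ℝ → S →L[ℂ] S} {Ws : S →L[ℂ] S}
    {Hb : K →ₗ.[ℂ] K} {Ub : ℝ → K →L[ℂ] K} {Wb : K →ₗ.[ℂ] K}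
    {H : Joint S K →ₗ.[ℂ] Joint S K} {U : ℝ → Joint S K →L[ℂ] Joint S K}
    {e : HilbertBasis ι ℂ K} {β : ℝ} {ε : ι → ℝ} {t : ℝ}

/-- The product of a system vector with insertions at `ρ` and additional points, and of a bath
vector with couplings at these additional points. -/
def productVector (hUs : IsEvolutionGroup Hs Us) (C : S →L[ℂ] S) (x : S) {y : K}
    (hy : IsConf fun (_ : Unit) => bathVector Ub Wb t y) (ρ : Multiset ℝ) :
    confSpace (Joint S K) :=
  (((isConf_forwardEvolution hUs C t x).add_const ρ).map₂ hy
    (φ := tens) continuous_tens zero_le_one (fun a b => by rw [norm_tens, one_mul])).toSpace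

omit [CompleteSpace K] in
theorem productVector_apply (hUs : IsEvolutionGroup Hs Us) (C : S →L[ℂ] S) (x : S) {y : K}
    (hy : IsConf fun (_ : Unit) => bathVector Ub Wb t y) (ρ τ : Multiset ℝ) :
    productVector hUs C x hy ρ τ =
      tens (forwardEvolution Us C t x (τ + ρ)) (bathVector Ub Wb t y τ) := rfl

omit [CompleteSpace K] in
theorem productVector_eq_dysonSpace (hUs : IsEvolutionGroup Hs Us) (C : S →L[ℂ] S) (x : S) {y : K}
    (hy : IsConf fun (_ : Unit) => bathVector Ub Wb t y) {ρ : Multiset ℝ} (hρ : IsForward t ρ) :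
    productVector hUs C x hy ρ = dysonSpace hUs C hy 0 ρ x 0 := by
  ext τ
  rw [productVector_apply, dysonSpace, IsConf.toSpace_apply, dysonIntegrand, add_zero]
  have tz : ∀ a : S, tens a (0 : K) = 0 := fun a => by rw [← tensL_apply, map_zero]
  have zt : ∀ b : K, tens (0 : S) b = 0 := fun b => by
    rw [← tensL_apply, map_zero]; rfl
  by_cases hτ : IsForward t τ
  · by_cases h : (τ + ρ).Nodup
    · have h1 : IsForward t (τ + ρ) := ⟨h, fun s hs => by
        rcases Multiset.mem_add.1 hs with hs | hs
        · exact hτ.2 s hs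
        · exact hρ.2 s hs⟩
      rw [if_pos ⟨h, fun u hu => (hτ.2 u hu).1⟩, forwardEvolution, if_pos h1]
    · rw [if_neg fun h' => h h'.1, forwardEvolution, if_neg fun h' => h h'.1, zt]
  · rw [bathVector, if_neg hτ, tz, tz, ite_self]

variable (hUs : IsEvolutionGroup Hs Us) (hUb : IsEvolutionGroup Hb Ub)
  (hU : IsEvolutionGroup H U) (hWb : IsSelfAdjoint Wb)
  (hH : ExtendsTotalHamiltonian Hs Hb Wb Ws H)
  (hdef : BathFunctionalDefined e β ε Ub Wb t)

theorem norm_neg_I_smul_le (Ws : S →L[ℂ] S) : ‖-Complex.I • Ws‖ ≤ ‖Ws‖ := by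
  rw [norm_smul, norm_neg, Complex.norm_I, one_mul]

include hUs hUb hU hWb hH hdef in
/-- The Dyson series. -/
theorem hasSum_productVector [Countable ι] (he : ∀ j, e j ∈ Wb.domain) (ht : 0 < t) (k : ι)
    (hy : IsConf fun (_ : Unit) => bathVector Ub Wb t (e k)) {Y c : ℝ} (hY : 0 ≤ Y) (_hc : 0 ≤ c)
    (hb : ∀ τ, ‖bathVector Ub Wb t (e k) τ‖ ≤
      c * √(Y ^ Multiset.card τ * (Multiset.card τ).factorial))
    (x : S) (ρ : Multiset ℝ) :
    Summable (fun n : ℕ => ‖((n.factorial : ℂ)⁻¹) • (pointOp (volume.restrict (Set.Ioo 0 t)) ^ n)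
      (productVector hUs (-Complex.I • Ws) x hy ρ) 0‖) ∧
    HasSum (fun n : ℕ => ((n.factorial : ℂ)⁻¹) • (pointOp (volume.restrict (Set.Ioo 0 t)) ^ n)
      (productVector hUs (-Complex.I • Ws) x hy ρ) 0)
      (forwardEvolution U (opTensor (-Complex.I • Ws) 1) t (tens x (e k)) ρ) := by
  set C : S →L[ℂ] S := -Complex.I • Ws with hC
  have hCW : ‖C‖ ≤ ‖Ws‖ := norm_neg_I_smul_le Ws
  have hsumm := summable_pow_mul_sqrt_div_factorial (Z := t * ‖Ws‖) hY
  rw [abs_of_nonneg (by positivity)] at hsumm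
  have h1 : Summable (fun n : ℕ => ‖((n.factorial : ℂ)⁻¹) •
      (pointOp (volume.restrict (Set.Ioo 0 t)) ^ n) (productVector hUs C x hy ρ) 0‖) := by
    refine Summable.of_nonneg_of_le (fun n => norm_nonneg _) (fun n => ?_)
      (hsumm.mul_left (‖Ws‖ ^ Multiset.card ρ * ‖x‖ * c))
    have h2 := sum_norm_pointOp_pow_le (volume.restrict (Set.Ioo 0 t)) {()}
      (fun _ => productVector hUs C x hy ρ) n 0
      (β := ‖Ws‖ ^ (n + Multiset.card ρ) * ‖x‖ * (c * √(Y ^ n * n.factorial))) fun τ hτ => by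
        rw [Finset.sum_singleton, add_zero, productVector_apply, norm_tens]
        have h3 := norm_forwardEvolution_le hUs hCW t x (τ + ρ)
        have h4 := hb τ
        rw [Multiset.card_add, hτ] at h3
        rw [hτ] at h4
        exact mul_le_mul h3 h4 (norm_nonneg _) (by positivity)
    rw [Finset.sum_singleton, Measure.real, Measure.restrict_apply_univ, Real.volume_Ioo, sub_zero,
      ENNReal.toReal_ofReal ht.le] at h2
    rw [norm_smul, norm_inv, Complex.norm_natCast]
    calc _ ≤ ((n.factorial : ℝ)⁻¹) * (t ^ n * (‖Ws‖ ^ (n + Multiset.card ρ) * ‖x‖ *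
          (c * √(Y ^ n * n.factorial)))) := by gcongr
      _ = _ := by
        rw [pow_add, mul_pow]
        ring
  refine ⟨h1, (Summable.hasSum_iff_tendsto_nat h1.of_norm).2 ?_⟩
  by_cases hρ : IsForward t ρ
  · rw [forwardEvolution, if_pos hρ]
    refine tendsto_iff_norm_sub_tendsto_zero.2 ?_
    -- The bound of the remainder of order `n` is the `n`-th term of the convergent majorant, hence
    -- tends to zero.
    have h5 : Filter.Tendsto (fun n : ℕ => ‖Ws‖ ^ Multiset.card ρ * ‖x‖ * c *
        ((t * ‖Ws‖) ^ n * √(Y ^ n * n.factorial) / n.factorial)) Filter.atTop (nhds 0) := by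
      simpa using hsumm.tendsto_atTop_zero.const_mul (‖Ws‖ ^ Multiset.card ρ * ‖x‖ * c)
    refine squeeze_zero (fun n => norm_nonneg _) (fun n => ?_) h5
    have h6 := norm_sub_dyson_le hUs hUb hU hWb hH hdef k
      (b := fun n => c * √(Y ^ n * n.factorial)) hb he ht hy n (l := []) List.Pairwise.nil
      (by simp) hρ.1 hρ.2 x
    rw [norm_sub_rev, productVector_eq_dysonSpace hUs C x hy hρ]
    refine h6.trans_eq ?_
    simp only [List.headD_nil, List.length_nil, zero_add, sub_zero]
    rw [mul_pow]
    ring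
  · have h7 : productVector hUs C x hy ρ = 0 := by
      ext τ
      rw [productVector_apply, forwardEvolution, if_neg fun h => hρ h.of_add.2, ← tensL_apply,
        map_zero]
      rfl
    rw [forwardEvolution, if_neg hρ, h7]
    simp only [map_zero]
    have h8 : ∀ n : ℕ, ((n.factorial : ℂ)⁻¹) • (0 : confSpace (Joint S K)) 0 = 0 := fun n =>
      smul_zero _
    simp only [h8, Finset.sum_const_zero, tendsto_const_nhds]

end Dyson
end

noncomputable section

/-! ### From two Dyson series to one series on the contour -/

section ContourSum

variable {E : Type*} [NormedAddCommGroup E] [InnerProductSpace ℂ E]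

theorem pointOp_contour {t : ℝ} (ht : 0 ≤ t) :
    pointOp (E := E) (volume.restrict (Set.Ioo 0 (2 * t))) =
      pointOp (volume.restrict (Set.Ioo 0 t)) + pointOp (volume.restrict (Set.Ioo t (2 * t))) := by
  rw [← pointOp_add_measure]
  refine LinearMap.ext fun h => confSpace.ext fun σ => ?_
  rw [pointOp_apply, pointOp_apply, restrict_Ioo_split ht (by linarith)]

theorem hasSum_inner_prod {p q : ℕ → E} {P Q : E} (T : E →L[ℂ] E) (hp : Summable fun n => ‖p n‖)
    (hq : Summable fun n => ‖q n‖) (hP : HasSum p P) (hQ : HasSum q Q) :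
    HasSum (fun m : ℕ × ℕ => inner ℂ (p m.2) (T (q m.1))) (inner ℂ P (T Q)) := by
  have h1 : Summable fun m : ℕ × ℕ => inner ℂ (p m.2) (T (q m.1)) := by
    refine ((hq.mul_of_nonneg hp (fun _ => norm_nonneg _) (fun _ => norm_nonneg _)).mul_left
      ‖T‖).of_norm_bounded fun m => (norm_inner_le_norm _ _).trans ?_
    calc _ ≤ ‖p m.2‖ * (‖T‖ * ‖q m.1‖) := by gcongr; exact T.le_opNorm _
      _ = _ := by ring
  have h2 : ∀ n, HasSum (fun l => inner ℂ (p l) (T (q n))) (inner ℂ P (T (q n))) := fun n =>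
    hP.map (AddMonoidHom.mk' (fun v => inner ℂ v (T (q n))) fun a b => inner_add_left _ _ _)
      (continuous_id.inner continuous_const)
  have h3 := h1.hasSum.prod_fiberwise h2
  have h4 : HasSum (fun n => inner ℂ P (T (q n))) (inner ℂ P (T Q)) :=
    ((innerSL ℂ P).comp T).hasSum hQ
  rw [← h3.unique h4]
  exact h1.hasSum

/-- The interval `(0, 2 t)` splits at `t` into commuting forward and backward integrations. The
binomial theorem makes the contour series the Cauchy product of the two Dyson series, paired through
`T`. -/
theorem hasSum_contourPair [CompleteSpace E] {t : ℝ} (ht : 0 ≤ t) (T : E →L[ℂ] E)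
    {P Q : confSpace E} {p q : E}
    (hp : Summable fun n : ℕ => ‖((n.factorial : ℂ)⁻¹) •
      (pointOp (volume.restrict (Set.Ioo 0 t)) ^ n) P 0‖)
    (hq : Summable fun n : ℕ => ‖((n.factorial : ℂ)⁻¹) •
      (pointOp (volume.restrict (Set.Ioo 0 t)) ^ n) Q 0‖)
    (hP : HasSum (fun n : ℕ => ((n.factorial : ℂ)⁻¹) •
      (pointOp (volume.restrict (Set.Ioo 0 t)) ^ n) P 0) p)
    (hQ : HasSum (fun n : ℕ => ((n.factorial : ℂ)⁻¹) •
      (pointOp (volume.restrict (Set.Ioo 0 t)) ^ n) Q 0) q) :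
    HasSum (fun n : ℕ => ((n.factorial : ℂ)⁻¹) •
      (pointOp (volume.restrict (Set.Ioo 0 (2 * t))) ^ n) (contourPair t T P Q) 0)
      (inner ℂ p (T q)) := by
  refine (congrArg (HasSum · _) (funext fun n => ?_)).mp
    (hasSum_antidiagonal (hasSum_inner_prod T hp hq hP hQ))
  have h1 := congrArg (confEval 0) (pow_div_factorial_add
    (PointKernel.op_commute (E := ℂ) (pointKernel (volume.restrict (Set.Ioo 0 t)))
      (pointKernel (volume.restrict (Set.Ioo t (2 * t))))) n (contourPair t T P Q))
  rw [map_sum] at h1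
  simp only [confEval_apply, confSpace.smul_apply] at h1
  rw [pointOp_contour ht]
  refine Eq.trans ?_ h1.symm
  refine Finset.sum_congr rfl fun m _ => ?_
  rw [pointOp_pow_contourPair t T ht P Q m.1 m.2, contourPair_apply, bwd_zero, fwd_zero, map_smul,
    inner_smul_left, inner_smul_right, smul_eq_mul]
  simp only [map_inv₀, Complex.conj_natCast]
  ring

end ContourSum

theorem hasSum_two_mul_of_odd_eq_zero {g : ℕ → ℂ} {a : ℂ} (h0 : ∀ p, g (2 * p + 1) = 0)
    (hg : HasSum g a) : HasSum (fun p => g (2 * p)) a := by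
  have hinj : Function.Injective fun p : ℕ => 2 * p := fun a b h => by simpa using h
  refine (hinj.hasSum_iff fun n hn => ?_).2 hg
  rcases Nat.even_or_odd' n with ⟨p, rfl | rfl⟩
  · exact absurd ⟨p, rfl⟩ hn
  · exact h0 p

/-! ### The joint amplitude as a Gaussian average -/

section Influence

variable {S K ι : Type*}
    [NormedAddCommGroup S] [InnerProductSpace ℂ S] [CompleteSpace S]
    [NormedAddCommGroup K] [InnerProductSpace ℂ K] [CompleteSpace K]
    {Hs : S →ₗ.[ℂ] S} {Us : ℝ → S →L[ℂ] S} {Ws : S →L[ℂ] S}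
    {Hb : K →ₗ.[ℂ] K} {Ub : ℝ → K →L[ℂ] K} {Wb : K →ₗ.[ℂ] K}
    {H : Joint S K →ₗ.[ℂ] Joint S K} {U : ℝ → Joint S K →L[ℂ] Joint S K}
    {e : HilbertBasis ι ℂ K} {β : ℝ} {ε : ι → ℝ} {t : ℝ}

/-- The system amplitude with insertions on the contour. -/
def systemAmplitude (hUs : IsEvolutionGroup Hs Us) (C Os : S →L[ℂ] S) (t : ℝ) (x : S) :
    confSpace ℂ :=
  contourPair t Os (isConf_forwardEvolution hUs C t x).toSpace
    (isConf_forwardEvolution hUs C t x).toSpace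

/-- The matrix element of an observable between two evolved product vectors with insertions on the
contour, averaged over the thermal state of the bath. -/
def jointAmplitude (e : HilbertBasis ι ℂ K) (β : ℝ) (ε : ι → ℝ)
    (U : ℝ → Joint S K →L[ℂ] Joint S K) (C Os : S →L[ℂ] S) (t : ℝ) (x : S) (σ : Multiset ℝ) : ℂ :=
  ∑' k, (thermalWeight β ε k : ℂ) *
    inner ℂ (forwardEvolution U (opTensor C 1) t (tens x (e k)) (bwd t σ))
      (opTensor Os 1 (forwardEvolution U (opTensor C 1) t (tens x (e k)) (fwd t σ)))

theorem norm_systemAmplitude_le (hUs : IsEvolutionGroup Hs Us) {C Os : S →L[ℂ] S} {M : ℝ}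
    (hC : ‖C‖ ≤ M) (x : S) (σ : Multiset ℝ) :
    ‖systemAmplitude hUs C Os t x σ‖ ≤ ‖Os‖ * ‖x‖ ^ 2 * M ^ Multiset.card σ := by
  have hM : 0 ≤ M := (norm_nonneg _).trans hC
  rw [systemAmplitude, contourPair_apply, IsConf.toSpace_apply, IsConf.toSpace_apply,
    ← card_fwd_add_card_bwd t σ, pow_add]
  have h1 := norm_forwardEvolution_le hUs hC t x (fwd t σ)
  have h2 := norm_forwardEvolution_le hUs hC t x (bwd t σ)
  calc _ ≤ ‖forwardEvolution Us C t x (bwd t σ)‖ * (‖Os‖ * ‖forwardEvolution Us C t x (fwd t σ)‖) :=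
        (norm_inner_le_norm _ _).trans (by gcongr; exact Os.le_opNorm _)
    _ ≤ (M ^ Multiset.card (bwd t σ) * ‖x‖) * (‖Os‖ * (M ^ Multiset.card (fwd t σ) * ‖x‖)) := by
        gcongr
    _ = _ := by ring

variable (hU : IsEvolutionGroup H U) (hβ : HasThermalState Hb β e ε)

-- The evolution is unitary, each insertion costs at most `M`, and the thermal weights sum to one.
-- The strength of the bath coupling does not enter, which is why the final estimate depends on `ΔB`
-- alone.
omit [CompleteSpace S] [CompleteSpace K] in
include hU hβ in
theorem norm_jointAmplitude_le [Nonempty ι] {C Os : S →L[ℂ] S} {M : ℝ}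
    (hC : ‖C‖ ≤ M) (x : S) (σ : Multiset ℝ) :
    ‖jointAmplitude e β ε U C Os t x σ‖ ≤ ‖Os‖ * ‖x‖ ^ 2 * M ^ Multiset.card σ := by
  have hM : 0 ≤ M := (norm_nonneg _).trans hC
  have hC' : ‖opTensor C (1 : K →L[ℂ] K)‖ ≤ M := (norm_opTensor_one_le _).trans hC
  have hw := (hasSum_thermalWeight hβ).mul_left (‖Os‖ * ‖x‖ ^ 2 * M ^ Multiset.card σ)
  rw [mul_one] at hw
  refine tsum_of_norm_bounded hw fun k => ?_
  have h0 : ‖tens x (e k)‖ = ‖x‖ := by rw [norm_tens, e.orthonormal.1 k, mul_one]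
  have h1 := norm_forwardEvolution_le hU hC' t (tens x (e k)) (fwd t σ)
  have h2 := norm_forwardEvolution_le hU hC' t (tens x (e k)) (bwd t σ)
  rw [h0] at h1 h2
  rw [norm_mul, Complex.norm_real, Real.norm_of_nonneg (thermalWeight_pos hβ k).le, mul_comm]
  refine mul_le_mul_of_nonneg_right ?_ (thermalWeight_pos hβ k).le
  rw [← card_fwd_add_card_bwd t σ, pow_add]
  calc _ ≤ ‖forwardEvolution U (opTensor C 1) t (tens x (e k)) (bwd t σ)‖ *
        (‖Os‖ * ‖forwardEvolution U (opTensor C 1) t (tens x (e k)) (fwd t σ)‖) :=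
        (norm_inner_le_norm _ _).trans (by
          gcongr
          exact (ContinuousLinearMap.le_opNorm _ _).trans
            (mul_le_mul_of_nonneg_right (norm_opTensor_one_le Os) (norm_nonneg _)))
    _ ≤ (M ^ Multiset.card (bwd t σ) * ‖x‖) * (‖Os‖ * (M ^ Multiset.card (fwd t σ) * ‖x‖)) := by
        gcongr
    _ = _ := by ring

variable (hUs : IsEvolutionGroup Hs Us) (hUb : IsEvolutionGroup Hb Ub)
  (hWb : IsSelfAdjoint Wb) (hH : ExtendsTotalHamiltonian Hs Hb Wb Ws H)
  (hdef : BathFunctionalDefined e β ε Ub Wb t) (hWick : WickTheorem e β ε Ub Wb t)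
  (ht : 0 < t) {C : ℝ} (hC : 0 ≤ C) (hB : ∀ τ₁ τ₂ : ℝ, 0 < τ₁ → τ₁ < τ₂ →
    τ₂ < 2 * t → ‖bathCorrelation e β ε Ub Wb t τ₁ τ₂‖ ≤ C)

-- Cauchy–Schwarz with the thermal weights, followed by `m! n! ≤ (m + n)!`.
include hUb hWb hβ hdef hWick ht hC hB in
theorem sum_mul_norm_bathVector_le (F : Finset ι) (τ τ' : Multiset ℝ) :
    ∑ k ∈ F, thermalWeight β ε k * (‖bathVector Ub Wb t (e k) τ‖ *
      ‖bathVector Ub Wb t (e k) τ'‖) ≤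
      √((2 * C) ^ (Multiset.card τ + Multiset.card τ') *
        (Multiset.card τ + Multiset.card τ').factorial) := by
  have h1 := Real.sum_mul_le_sqrt_mul_sqrt F
    (fun k => √(thermalWeight β ε k) * ‖bathVector Ub Wb t (e k) τ‖)
    (fun k => √(thermalWeight β ε k) * ‖bathVector Ub Wb t (e k) τ'‖)
  have h2 : ∀ k, √(thermalWeight β ε k) ^ 2 = thermalWeight β ε k := fun k =>
    Real.sq_sqrt (thermalWeight_pos hβ k).le
  have h3 : ∀ k, √(thermalWeight β ε k) * ‖bathVector Ub Wb t (e k) τ‖ *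
      (√(thermalWeight β ε k) * ‖bathVector Ub Wb t (e k) τ'‖) =
      thermalWeight β ε k * (‖bathVector Ub Wb t (e k) τ‖ *
      ‖bathVector Ub Wb t (e k) τ'‖) := fun k => by
    rw [← h2 k]
    simp only [Real.sqrt_sq (Real.sqrt_nonneg _)]
    ring
  simp only [mul_pow, h2, h3] at h1
  refine h1.trans ?_
  rw [← Real.sqrt_mul (Finset.sum_nonneg fun k _ =>
    mul_nonneg (thermalWeight_pos hβ k).le (sq_nonneg _))]
  refine Real.sqrt_le_sqrt ?_
  have h4 := sum_norm_sq_bathVector_le hUb hWb hβ hdef hWick ht hC hB F τ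
  have h5 := sum_norm_sq_bathVector_le hUb hWb hβ hdef hWick ht hC hB F τ'
  have h6 : ((Multiset.card τ).factorial * (Multiset.card τ').factorial : ℝ) ≤
      (Multiset.card τ + Multiset.card τ').factorial := by
    exact_mod_cast Nat.le_of_dvd (Nat.factorial_pos _)
      (Nat.factorial_mul_factorial_dvd_factorial_add _ _)
  calc _ ≤ ((2 * C) ^ Multiset.card τ * (Multiset.card τ).factorial) *
        ((2 * C) ^ Multiset.card τ' * (Multiset.card τ').factorial) :=
        mul_le_mul h4 h5 (Finset.sum_nonneg fun k _ =>
          mul_nonneg (thermalWeight_pos hβ k).le (sq_nonneg _)) (by positivity)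
    _ = (2 * C) ^ (Multiset.card τ + Multiset.card τ') *
        ((Multiset.card τ).factorial * (Multiset.card τ').factorial) := by rw [pow_add]; ring
    _ ≤ _ := by gcongr

set_option maxHeartbeats 1000000 in
include hU hβ hUs hUb hWb hH hdef hWick ht hC hB in
/-- The joint amplitude is the Gaussian average of the system amplitude. -/
theorem hasSum_jointAmplitude (Os : S →L[ℂ] S) (x : S) (σ : Multiset ℝ)
    (hBm : Measurable (Function.uncurry (symCorrelation e β ε Ub Wb t)))
    (hBb : ∃ C, ∀ u v, ‖symCorrelation e β ε Ub Wb t u v‖ ≤ C) :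
    HasSum (fun p : ℕ => ((p.factorial : ℂ)⁻¹) •
      ((pairKernel (volume.restrict (Set.Ioo 0 (2 * t))) _ hBm hBb).op ^ p)
        (systemAmplitude hUs (-Complex.I • Ws) Os t x) σ)
      (jointAmplitude e β ε U (-Complex.I • Ws) Os t x σ) := by
  classical
  have hcount := countable_of_hasThermalState hβ
  have he := eigenbasis_mem_domain hUb hβ hdef ht
  have hy : ∀ k, IsConf fun (_ : Unit) => bathVector Ub Wb t (e k) :=
    isConf_bathVector_eigenbasis hUb hWb hβ hdef hWick ht hC hB
  set c : S →L[ℂ] S := -Complex.I • Ws with hc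
  have hcW : ‖c‖ ≤ ‖Ws‖ := norm_neg_I_smul_le Ws
  set f := systemAmplitude hUs c Os t x with hf
  set I : Module.End ℂ (confSpace ℂ) := pointOp (volume.restrict (Set.Ioo 0 (2 * t))) with hI
  set h : ι → confSpace ℂ := fun k => (thermalWeight β ε k : ℂ) •
    contourPair t (opTensor Os 1) (productVector hUs c x (hy k) (bwd t σ))
      (productVector hUs c x (hy k) (fwd t σ)) with hh
  -- the terms of the sum over the eigenbasis
  have hterm : ∀ k τ, h k τ = f (τ + σ) * ((thermalWeight β ε k : ℂ) *
      inner ℂ (bathVector Ub Wb t (e k) (bwd t τ)) (bathVector Ub Wb t (e k) (fwd t τ))) := by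
    intro k τ
    rw [hh, confSpace.smul_apply, contourPair_apply, productVector_apply, productVector_apply,
      opTensor_tens, inner_tens, hf, systemAmplitude, contourPair_apply, bwd_add, fwd_add,
      smul_eq_mul]
    simp only [IsConf.toSpace_apply, one_apply_eq_self]
    ring
  -- The sum of the `h k`: Wick's theorem gives it at generic configurations, and elsewhere every
  -- term has a vanishing bath vector.
  set L : Multiset ℝ → ℂ := fun τ => if IsGeneric t τ then
    f (τ + σ) * haf (symCorrelation e β ε Ub Wb t) τ else 0 with hL
  have hsum : ∀ τ, HasSum (fun k => h k τ) (L τ) := by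
    intro τ
    simp only [hterm, hL]
    split_ifs with hτ
    · exact (hasSum_bathVector hUb hWb hdef hWick ht hτ).mul_left _
    · have h0 : ∀ k, (inner ℂ (bathVector Ub Wb t (e k) (bwd t τ))
          (bathVector Ub Wb t (e k) (fwd t τ)) : ℂ) = 0 := fun k => by
        by_cases h1 : IsForward t (fwd t τ)
        · rw [bathVector, if_neg fun h2 => hτ (isGeneric_of_isForward h1 h2), inner_zero_left]
        · rw [bathVector, bathVector, if_neg h1, inner_zero_right]
      simp only [h0, mul_zero, hasSum_zero]
  set R : ℕ → ℝ := fun n => ‖Os‖ * ‖x‖ ^ 2 * ‖Ws‖ ^ (n + Multiset.card σ) *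
    √((2 * C) ^ n * n.factorial) with hR
  have hbd : ∀ (F : Finset ι) (τ : Multiset ℝ),
      ∑ k ∈ F, ‖h k τ‖ ≤ R (Multiset.card τ) := by
    intro F τ
    have h1 := sum_mul_norm_bathVector_le hβ hUb hWb hdef hWick ht hC hB F (bwd t τ) (fwd t τ)
    rw [add_comm, card_fwd_add_card_bwd] at h1
    have h2 := norm_systemAmplitude_le (t := t) (Os := Os) hUs hcW x (τ + σ)
    rw [Multiset.card_add] at h2
    calc ∑ k ∈ F, ‖h k τ‖ ≤ ∑ k ∈ F, ‖f (τ + σ)‖ * (thermalWeight β ε k *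
          (‖bathVector Ub Wb t (e k) (bwd t τ)‖ * ‖bathVector Ub Wb t (e k) (fwd t τ)‖)) := by
          refine Finset.sum_le_sum fun k _ => ?_
          rw [hterm, norm_mul, norm_mul, Complex.norm_real,
            Real.norm_of_nonneg (thermalWeight_pos hβ k).le]
          have := (thermalWeight_pos hβ k).le
          gcongr
          exact norm_inner_le_norm _ _
      _ ≤ _ := by
          rw [← Finset.mul_sum]
          exact mul_le_mul h2 h1 (Finset.sum_nonneg fun k _ =>
            mul_nonneg (thermalWeight_pos hβ k).le (by positivity)) (by positivity)
  have hbd' : ∀ n, ∃ c, ∀ (F : Finset ι) (τ : Multiset ℝ), Multiset.card τ = n →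
      ∑ k ∈ F, ‖h k τ‖ ≤ c := fun n => ⟨R n, fun F τ hτ => hτ ▸ hbd F τ⟩
  set Ls : confSpace ℂ := (isConf_of_hasSum hsum hbd').toSpace with hLs
  have hconf : ConfHasSum h Ls := ⟨hsum, hbd'⟩
  -- the double series
  set a : ℕ × ι → ℂ := fun m => ((m.1.factorial : ℂ)⁻¹) • (I ^ m.1) (h m.2) 0 with ha
  have hrow : ∀ n, HasSum (fun k => a (n, k)) (((n.factorial : ℂ)⁻¹) • (I ^ n) Ls 0) := fun n =>
    ((hconf.op_pow (pointKernel (volume.restrict (Set.Ioo 0 (2 * t)))) n).hasSum 0).const_smul _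
  have hrowb : ∀ n (F : Finset ι), ∑ k ∈ F, ‖a (n, k)‖ ≤
      ((n.factorial : ℝ)⁻¹) * ((2 * t) ^ n * R n) := by
    intro n F
    simp only [ha, norm_smul, norm_inv, Complex.norm_natCast]
    rw [← Finset.mul_sum]
    have h1 := sum_norm_pointOp_pow_le (volume.restrict (Set.Ioo 0 (2 * t))) F h n 0 (β := R n)
      fun τ hτ => by simpa only [add_zero, hτ] using hbd F τ
    rw [Measure.real, Measure.restrict_apply_univ, Real.volume_Ioo, sub_zero,
      ENNReal.toReal_ofReal (by linarith)] at h1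
    gcongr
  have hRs : Summable fun n : ℕ => ((n.factorial : ℝ)⁻¹) * ((2 * t) ^ n * R n) := by
    have h1 := (summable_pow_mul_sqrt_div_factorial (Z := 2 * t * ‖Ws‖)
      (Y := 2 * C) (by positivity)).mul_left (‖Os‖ * ‖x‖ ^ 2 * ‖Ws‖ ^ Multiset.card σ)
    rw [abs_of_nonneg (by positivity)] at h1
    refine h1.congr fun n => ?_
    simp only [hR]
    rw [pow_add, mul_pow]
    ring
  have hrows : ∀ n, Summable fun k => ‖a (n, k)‖ := fun n =>
    summable_of_sum_le (fun _ => norm_nonneg _) (hrowb n)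
  -- Absolute convergence over the order `n` and the eigenvector `k` together. Summing over `k`
  -- first gives Wick's hafnian in each order; summing over `n` first gives the Dyson series of each
  -- eigenvector.
  have hasum : Summable a := by
    refine Summable.of_norm ((summable_prod_of_nonneg fun m => norm_nonneg _).2 ⟨hrows, ?_⟩)
    exact Summable.of_nonneg_of_le (fun n => tsum_nonneg fun k => norm_nonneg _)
      (fun n => Real.tsum_le_of_sum_le (fun _ => norm_nonneg _) (hrowb n)) hRs
  have hcol : ∀ k, HasSum (fun n => a (n, k)) ((thermalWeight β ε k : ℂ) *
      inner ℂ (forwardEvolution U (opTensor c 1) t (tens x (e k)) (bwd t σ))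
        (opTensor Os 1 (forwardEvolution U (opTensor c 1) t (tens x (e k)) (fwd t σ)))) := by
    intro k
    have hw := thermalWeight_pos hβ k
    have hbv : ∀ τ, ‖bathVector Ub Wb t (e k) τ‖ ≤ √(thermalWeight β ε k)⁻¹ *
        √((2 * C) ^ Multiset.card τ * (Multiset.card τ).factorial) := fun τ => by
      refine (norm_bathVector_le hUb hWb hβ hdef hWick ht hC hB k τ).trans_eq ?_
      rw [div_eq_inv_mul, Real.sqrt_mul (inv_nonneg.2 hw.le)]
    have hP := fun ρ => hasSum_productVector hUs hUb hU hWb hH hdef he ht k (hy k)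
      (by positivity) (Real.sqrt_nonneg _) hbv x ρ
    have h1 := (hasSum_contourPair ht.le (opTensor Os 1) (hP (bwd t σ)).1 (hP (fwd t σ)).1
      (hP (bwd t σ)).2 (hP (fwd t σ)).2).mul_left (thermalWeight β ε k : ℂ)
    refine (congrArg (HasSum · _) (funext fun n => ?_)).mp h1
    simp only [ha, hh, map_smul, confSpace.smul_apply, smul_eq_mul, hI]
    ring
  have htot : HasSum (fun n => ((n.factorial : ℂ)⁻¹) • (I ^ n) Ls 0)
      (jointAmplitude e β ε U c Os t x σ) := by
    have h1 := hasum.hasSum.prod_fiberwise hrow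
    have h2 := ((Equiv.prodComm ι ℕ).hasSum_iff.2 hasum.hasSum).prod_fiberwise hcol
    rw [jointAmplitude, h2.tsum_eq]
    exact h1
  -- back to the Hafnian
  set Hf : confSpace ℂ := (isConf_haf symCorrelation_comm hBm
    (norm_symCorrelation_le hC hB)).toSpace with hHf
  -- Almost every configuration in `(0, 2 t)` is generic, so the restriction in `L` disappears under
  -- the integrals.
  have hgen : ∀ n, (I ^ n) Ls 0 = (I ^ n) (confMul Hf (shift σ f)) 0 := fun n => by
    have hP : ∀ᵐ u ∂(volume.restrict (Set.Ioo 0 (2 * t)) : Measure ℝ),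
        0 < u ∧ u < 2 * t ∧ u ≠ t := by
      have h1 : ∀ᵐ u ∂(volume.restrict (Set.Ioo 0 (2 * t)) : Measure ℝ), u ∉ ({t} : Set ℝ) :=
        (Set.countable_singleton t).ae_notMem _
      filter_upwards [h1, ae_restrict_mem measurableSet_Ioo] with u hu hu'
      exact ⟨hu'.1, hu'.2, hu⟩
    refine pointOp_pow_congr_nodup _ hP n 0 fun τ _ hn hτ => ?_
    have hg : IsGeneric t τ := ⟨hn, fun s hs => (hτ s hs).1⟩
    rw [add_zero, hLs, IsConf.toSpace_apply, confMul_apply, hHf, IsConf.toSpace_apply, shift_apply,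
      hL]
    simp only
    rw [if_pos hg, smul_eq_mul, mul_comm]
  have hodd : ∀ p, ((2 * p + 1).factorial : ℂ)⁻¹ • (I ^ (2 * p + 1)) Ls 0 = 0 := fun p => by
    rw [hgen, hI, pointOp_pow_haf_odd _ symCorrelation_comm Hf (fun _ => rfl), smul_zero]
  have hev := hasSum_two_mul_of_odd_eq_zero hodd htot
  refine (congrArg (HasSum · _) (funext fun p => ?_)).mp hev
  rw [hgen, hI, pointOp_pow_haf_even _ hBm hBb symCorrelation_comm Hf
    (fun _ => rfl), PointKernel.op_pow_shift, shift_apply, zero_add]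

end Influence
end

noncomputable section

/-! ### Comparison of two baths -/

theorem integral_square_eq_two_mul_integral_triangle {a : ℝ} (ha : 0 ≤ a) {g : ℝ → ℝ → ℝ}
    (hg : Measurable (Function.uncurry g)) (hb : ∃ C, ∀ u v, ‖g u v‖ ≤ C)
    (hs : ∀ u v, g u v = g v u) (hd : ∀ u, g u u = 0) :
    ∫ p : ℝ × ℝ, g p.1 p.2 ∂((volume.restrict (Set.Ioo 0 a)).prod (volume.restrict (Set.Ioo 0 a))) =
      2 * ∫ v in (0 : ℝ)..a, ∫ u in (0 : ℝ)..v, g u v := by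
  set μ : Measure ℝ := volume.restrict (Set.Ioo 0 a) with hμ
  obtain ⟨C, hC⟩ := hb
  have hlt : MeasurableSet {p : ℝ × ℝ | p.1 < p.2} := measurableSet_lt measurable_fst measurable_snd
  have hi : Integrable (fun p : ℝ × ℝ => g p.1 p.2) (μ.prod μ) :=
    Integrable.of_bound hg.aestronglyMeasurable C (Filter.Eventually.of_forall fun p => hC _ _)
  set h : ℝ × ℝ → ℝ := {p : ℝ × ℝ | p.1 < p.2}.indicator fun p => g p.1 p.2 with hh
  have hhi : Integrable h (μ.prod μ) := hi.indicator hlt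
  have hsplit : ∀ p : ℝ × ℝ, g p.1 p.2 = h p + h p.swap := by
    rintro ⟨u, v⟩
    simp only [hh, Set.indicator_apply, Set.mem_ofPred_eq, Prod.fst_swap, Prod.snd_swap]
    rcases lt_trichotomy u v with huv | rfl | huv
    · simp [huv, huv.not_gt]
    · simp [hd]
    · simp [huv, huv.not_gt, hs u v]
  have h1 : ∫ p, h p ∂(μ.prod μ) = ∫ v in (0 : ℝ)..a, ∫ u in (0 : ℝ)..v, g u v := by
    rw [integral_prod_symm _ hhi, intervalIntegral.integral_of_le ha, integral_Ioc_eq_integral_Ioo]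
    refine setIntegral_congr_fun measurableSet_Ioo fun v hv => ?_
    rw [intervalIntegral.integral_of_le hv.1.le, integral_Ioc_eq_integral_Ioo,
      show Set.Ioo 0 v = Set.Iio v ∩ Set.Ioo 0 a from by
        ext u; exact ⟨fun h => ⟨h.2, h.1, h.2.trans hv.2⟩, fun h => ⟨h.2.1, h.1⟩⟩,
      ← Measure.restrict_restrict measurableSet_Iio, ← integral_indicator measurableSet_Iio]
    rfl
  simp only [hsplit]
  have h2 : Integrable (fun p => h p.swap) (μ.prod μ) := hhi.swap
  rw [integral_add hhi h2, integral_prod_swap, h1, two_mul]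

variable {S K ι : Type*}
    [NormedAddCommGroup S] [InnerProductSpace ℂ S] [CompleteSpace S]
    [NormedAddCommGroup K] [InnerProductSpace ℂ K] [CompleteSpace K]
    {Hs : S →ₗ.[ℂ] S} {Us : ℝ → S →L[ℂ] S} {Ws : S →L[ℂ] S}
    {Hb : K →ₗ.[ℂ] K} {Ub : ℝ → K →L[ℂ] K} {Wb Wb' : K →ₗ.[ℂ] K}
    {H H' : Joint S K →ₗ.[ℂ] Joint S K} {U U' : ℝ → Joint S K →L[ℂ] Joint S K}
    {e : HilbertBasis ι ℂ K} {β : ℝ} {ε : ι → ℝ} {t : ℝ}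

omit [CompleteSpace K] in
theorem integral_norm_symCorrelation_sub (ht : 0 < t)
    (hBm : Measurable (Function.uncurry (symCorrelation e β ε Ub Wb t)))
    (hBm' : Measurable (Function.uncurry (symCorrelation e β ε Ub Wb' t)))
    (hb : ∃ C, ∀ u v, ‖symCorrelation e β ε Ub Wb' t u v - symCorrelation e β ε Ub Wb t u v‖ ≤ C) :
    ∫ p : ℝ × ℝ, ‖symCorrelation e β ε Ub Wb' t p.1 p.2 - symCorrelation e β ε Ub Wb t p.1 p.2‖
        ∂((volume.restrict (Set.Ioo 0 (2 * t))).prod (volume.restrict (Set.Ioo 0 (2 * t)))) =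
      2 * ∫ s₂ in (0 : ℝ)..(2 * t), ∫ s₁ in (0 : ℝ)..s₂,
        ‖bathCorrelation e β ε Ub Wb' t s₁ s₂ - bathCorrelation e β ε Ub Wb t s₁ s₂‖ := by
  have hd : ∀ W u, symCorrelation e β ε Ub W t u u = 0 := fun W u => by
    rw [symCorrelation, if_neg fun h => (isGeneric_pair.1 h).1 rfl]
  rw [integral_square_eq_two_mul_integral_triangle (by linarith)
    (g := fun u v => ‖symCorrelation e β ε Ub Wb' t u v - symCorrelation e β ε Ub Wb t u v‖)
    (hBm'.sub hBm).norm (by simpa using hb)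
    (fun u v => by rw [symCorrelation_comm u v, symCorrelation_comm u v])
    fun u => by rw [hd, hd, sub_zero, norm_zero]]
  have hne' : ∀ a : ℝ, ∀ᵐ u : ℝ, u ≠ a := fun a => by
    simpa using (Set.countable_singleton a).ae_notMem (volume : Measure ℝ)
  congr 1
  refine intervalIntegral.integral_congr_ae ?_
  filter_upwards [hne' t, hne' (2 * t)] with v hv hv2 hv'
  rw [Set.uIoc_of_le (by linarith)] at hv'
  refine intervalIntegral.integral_congr_ae ?_
  filter_upwards [hne' t, hne' v] with u hu huv hu'
  rw [Set.uIoc_of_le hv'.1.le] at hu'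
  have huv' := lt_of_le_of_ne hu'.2 huv
  have hv2' := lt_of_le_of_ne hv'.2 hv2
  have hg : IsGeneric t {u, v} :=
    isGeneric_pair.2 ⟨huv, ⟨hu'.1, huv'.trans hv2', hu⟩, hv'.1, hv2', hv⟩
  rw [symCorrelation_of_lt hg huv', symCorrelation_of_lt hg huv']

/-- The pair operator of the second bath is that of the first plus the one with weight `ΔB / 2`. The
hypothesis of `norm_exp_op_sub_le` on the unperturbed exponential holds because its value at `σ` is
the joint amplitude with insertions at `σ`, to which the unitary bound applies. -/
theorem norm_jointAmplitude_sub_le [Nonempty ι] (hU : IsEvolutionGroup H U)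
    (hU' : IsEvolutionGroup H' U') (hβ : HasThermalState Hb β e ε)
    (hUs : IsEvolutionGroup Hs Us) (hUb : IsEvolutionGroup Hb Ub)
    (hWb : IsSelfAdjoint Wb) (hWb' : IsSelfAdjoint Wb')
    (hH : ExtendsTotalHamiltonian Hs Hb Wb Ws H) (hH' : ExtendsTotalHamiltonian Hs Hb Wb' Ws H')
    (hdef : BathFunctionalDefined e β ε Ub Wb t) (hdef' : BathFunctionalDefined e β ε Ub Wb' t)
    (hWick : WickTheorem e β ε Ub Wb t) (hWick' : WickTheorem e β ε Ub Wb' t)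
    (ht : 0 < t) (hB : BoundedCorrelation e β ε Ub Wb t) (hB' : BoundedCorrelation e β ε Ub Wb' t)
    (Os : S →L[ℂ] S) (x : S) :
    ‖jointAmplitude e β ε U' (-Complex.I • Ws) Os t x 0 -
        jointAmplitude e β ε U (-Complex.I • Ws) Os t x 0‖ ≤
      ‖Os‖ * (Real.exp (‖Ws‖ ^ 2 * ∫ s₂ in (0 : ℝ)..(2 * t), ∫ s₁ in (0 : ℝ)..s₂,
        ‖bathCorrelation e β ε Ub Wb' t s₁ s₂ - bathCorrelation e β ε Ub Wb t s₁ s₂‖) - 1) *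
        ‖x‖ ^ 2 := by
  have hpos : ∀ {W : K →ₗ.[ℂ] K}, BoundedCorrelation e β ε Ub W t → ∃ C : ℝ, 0 ≤ C ∧
      ∀ τ₁ τ₂ : ℝ, 0 < τ₁ → τ₁ < τ₂ → τ₂ < 2 * t → ‖bathCorrelation e β ε Ub W t τ₁ τ₂‖ ≤ C :=
    fun ⟨C, hC⟩ => ⟨max C 0, le_max_right _ _, fun τ₁ τ₂ h1 h2 h3 =>
      (hC τ₁ τ₂ h1 h2 h3).trans (le_max_left _ _)⟩
  obtain ⟨C, hC, hB⟩ := hpos hB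
  obtain ⟨C', hC', hB'⟩ := hpos hB'
  have hBm := measurable_symCorrelation hUb hWb hβ hdef hWick ht hC hB
  have hBm' := measurable_symCorrelation hUb hWb' hβ hdef' hWick' ht hC' hB'
  have hBb : ∃ C, ∀ u v, ‖symCorrelation e β ε Ub Wb t u v‖ ≤ C :=
    ⟨C, norm_symCorrelation_le hC hB⟩
  have hBb' : ∃ C, ∀ u v, ‖symCorrelation e β ε Ub Wb' t u v‖ ≤ C :=
    ⟨C', norm_symCorrelation_le hC' hB'⟩
  have hDb : ∃ C, ∀ u v, ‖symCorrelation e β ε Ub Wb' t u v -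
      symCorrelation e β ε Ub Wb t u v‖ ≤ C :=
    ⟨C' + C, fun u v => (norm_sub_le _ _).trans
      (add_le_add (norm_symCorrelation_le hC' hB' u v) (norm_symCorrelation_le hC hB u v))⟩
  set μ : Measure ℝ := volume.restrict (Set.Ioo 0 (2 * t)) with hμ
  set κ := pairKernel μ _ hBm hBb with hκ
  set κ' := pairKernel μ (fun u v => symCorrelation e β ε Ub Wb' t u v -
    symCorrelation e β ε Ub Wb t u v) (hBm'.sub hBm) hDb with hκ'
  have hJ : (pairKernel μ _ hBm' hBb').op (E := ℂ) = κ'.op + κ.op := by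
    refine LinearMap.ext fun h => confSpace.ext fun σ => ?_
    rw [LinearMap.add_apply, confSpace.add_apply]
    simp only [PointKernel.op_apply]
    have h1 := κ'.integrable h σ
    have h2 := κ.integrable h σ
    refine Eq.trans (integral_congr_ae (Filter.Eventually.of_forall fun p => ?_))
      (integral_add h1 h2)
    simp only [hκ, hκ', pairKernel, ← add_smul]
    congr 1
    ring
  have hs := fun σ => hasSum_jointAmplitude hU hβ hUs hUb hWb hH hdef hWick ht hC hB Os x σ hBm hBb
  have hs' := hasSum_jointAmplitude hU' hβ hUs hUb hWb' hH' hdef' hWick' ht hC' hB' Os x 0 hBm' hBb'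
  have hmain := norm_exp_op_sub_le κ κ' _ hJ (systemAmplitude hUs (-Complex.I • Ws) Os t x)
    (K := ‖Os‖ * ‖x‖ ^ 2) (norm_nonneg Ws)
    (norm_systemAmplitude_le hUs (norm_neg_I_smul_le Ws) x)
    fun σ => by
      rw [(hs σ).tsum_eq]
      exact norm_jointAmplitude_le hU hβ (norm_neg_I_smul_le Ws) x σ
  rw [hs'.tsum_eq, (hs 0).tsum_eq] at hmain
  refine hmain.trans_eq ?_
  -- The weight `1 / 2` compensates the two triangles that make up the square.
  have hint : ∫ p, ‖κ'.coeff p‖ ∂κ'.measure = ∫ s₂ in (0 : ℝ)..(2 * t), ∫ s₁ in (0 : ℝ)..s₂,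
      ‖bathCorrelation e β ε Ub Wb' t s₁ s₂ - bathCorrelation e β ε Ub Wb t s₁ s₂‖ := by
    simp only [hκ', pairKernel, norm_mul, norm_inv, Complex.norm_ofNat]
    rw [integral_const_mul, integral_norm_symCorrelation_sub ht hBm hBm' hDb,
      inv_mul_cancel_left₀ two_ne_zero]
  rw [hint, mul_comm _ (‖Ws‖ ^ 2)]
  ring

end

noncomputable section

/-! ### The trace formula for expectations -/

section Trace

variable {E I : Type*} [NormedAddCommGroup E] [InnerProductSpace ℂ E] [CompleteSpace E]

omit [CompleteSpace E] in
theorem sum_norm_inner_mul_inner_le {J : Type*} {b : J → E} (hb : Orthonormal ℂ b) (x y : E)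
    (F : Finset J) : ∑ l ∈ F, ‖inner ℂ x (b l) * inner ℂ (b l) y‖ ≤ ‖x‖ * ‖y‖ := by
  simp only [norm_mul]
  refine (Real.sum_mul_le_sqrt_mul_sqrt F _ _).trans ?_
  have h1 : ∀ z : E, √(∑ l ∈ F, ‖inner ℂ (b l) z‖ ^ 2) ≤ ‖z‖ := fun z =>
    Real.sqrt_le_iff.2 ⟨norm_nonneg _, hb.sum_inner_products_le z⟩
  refine mul_le_mul ?_ (h1 y) (Real.sqrt_nonneg _) (norm_nonneg _)
  simpa only [norm_inner_symm x] using h1 x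

/-- Inserting the basis of the trace gives a double series that converges absolutely, by Bessel and
Cauchy–Schwarz. It may then be summed over the basis first, by Parseval's identity. -/
theorem hasSum_trace {v : I → E} {ρ A : E →L[ℂ] E} (hv : Summable fun i => ‖v i‖ ^ 2)
    (hρ : HasSum (fun i => InnerProductSpace.rankOne ℂ (v i) (v i)) ρ) (B : E →L[ℂ] E) :
    HasSum (fun i => inner ℂ (B.adjoint (v i)) (A (v i))) (trace (A * ρ * B)) := by
  obtain ⟨b, hb⟩ : ∃ b, b = stdHilbertBasis E := ⟨_, rfl⟩
  set a : I × hilbertBasisSet E → ℂ := fun p =>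
    inner ℂ (B.adjoint (v p.1)) (b p.2) * inner ℂ (b p.2) (A (v p.1)) with ha
  have h1 : ∀ i (F : Finset (hilbertBasisSet E)), ∑ l ∈ F, ‖a (i, l)‖ ≤
      ‖B.adjoint‖ * ‖A‖ * ‖v i‖ ^ 2 := fun i F => by
    simp only [ha]
    refine (sum_norm_inner_mul_inner_le b.orthonormal _ _ F).trans ?_
    calc ‖B.adjoint (v i)‖ * ‖A (v i)‖ ≤ (‖B.adjoint‖ * ‖v i‖) * (‖A‖ * ‖v i‖) := by
          gcongr <;> exact ContinuousLinearMap.le_opNorm _ _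
      _ = _ := by ring
  have hsum : Summable a := by
    refine Summable.of_norm ((summable_prod_of_nonneg fun m => norm_nonneg _).2
      ⟨fun i => summable_of_sum_le (fun _ => norm_nonneg _) (h1 i), ?_⟩)
    exact Summable.of_nonneg_of_le (fun n => tsum_nonneg fun k => norm_nonneg _)
      (fun n => Real.tsum_le_of_sum_le (fun _ => norm_nonneg _) (h1 n)) (hv.mul_left _)
  have hcol : ∀ l, HasSum (fun i => a (i, l)) (inner ℂ (b l) ((A * ρ * B) (b l))) := fun l => by
    have h2 := ((innerSL ℂ (b l)).comp A).hasSum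
      ((ContinuousLinearMap.apply ℂ E (B (b l))).hasSum hρ)
    refine (congrArg (HasSum · _) (funext fun i => ?_)).mp h2
    simp [ha, ContinuousLinearMap.adjoint_inner_left]
  have h3 := ((Equiv.prodComm _ I).hasSum_iff.2 hsum.hasSum).prod_fiberwise hcol
  have hrow : ∀ i, HasSum (fun l => a (i, l)) (inner ℂ (B.adjoint (v i)) (A (v i))) := fun i => by
    simp only [ha]
    exact b.hasSum_inner_mul_inner (B.adjoint (v i)) (A (v i))
  rw [trace, ← hb, h3.tsum_eq]
  exact hsum.hasSum.prod_fiberwise hrow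

/-- The vectors are the images of an orthonormal basis under `√ρ`. Their squared norms sum to the
trace, and no eigenvectors of `ρ` are needed. -/
theorem IsDensityOperator.exists_hasSum {ρ : E →L[ℂ] E} (hρ : IsDensityOperator ρ) :
    ∃ v : hilbertBasisSet E → E, HasSum (fun j => ‖v j‖ ^ 2) 1 ∧
      ∀ x, HasSum (fun j => inner ℂ (v j) x • v j) (ρ x) := by
  have h0 : 0 ≤ ρ := (ContinuousLinearMap.nonneg_iff_isPositive ρ).2 hρ.positive
  set r := CFC.sqrt ρ with hr
  have hrr : ∀ x, r (r x) = ρ x := fun x => by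
    rw [← CFC.sqrt_mul_sqrt_self ρ h0]
    rfl
  have hsa : ∀ x y, inner ℂ (r x) y = inner ℂ x (r y) := by
    have h1 : 0 ≤ r := CFC.sqrt_nonneg ρ
    exact ((ContinuousLinearMap.nonneg_iff_isPositive r).1 h1).inner_left_eq_inner_right
  refine ⟨fun j => r (stdHilbertBasis E j), ?_, fun x => ?_⟩
  · have h1 := Complex.reCLM.hasSum hρ.hasTrace_one
    refine (congrArg (HasSum · _) (funext fun j => ?_)).mp h1
    rw [← hrr, ← hsa]
    exact inner_self_eq_norm_sq (𝕜 := ℂ) _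
  · have h1 := r.hasSum ((stdHilbertBasis E).hasSum_repr (r x))
    rw [hrr] at h1
    refine (congrArg (HasSum · _) (funext fun j => ?_)).mp h1
    rw [map_smul, HilbertBasis.repr_apply_apply, hsa]

end Trace

section Expectation

variable {S K ι : Type*}
    [NormedAddCommGroup S] [InnerProductSpace ℂ S] [CompleteSpace S]
    [NormedAddCommGroup K] [InnerProductSpace ℂ K] [CompleteSpace K]
    {Hb : K →ₗ.[ℂ] K} {H : Joint S K →ₗ.[ℂ] Joint S K} {U : ℝ → Joint S K →L[ℂ] Joint S K}
    {e : HilbertBasis ι ℂ K} {β : ℝ} {ε : ι → ℝ} {t : ℝ}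

theorem hasSum_thermalState_apply [Nonempty ι] (hβ : HasThermalState Hb β e ε) (y : K) :
    HasSum (fun k => (thermalWeight β ε k : ℂ) • inner ℂ (e k) y • e k) (thermalState β e ε y) := by
  have h1 : Summable fun k => (thermalWeight β ε k : ℂ) •
      InnerProductSpace.rankOne ℂ (e k) (e k) := by
    refine Summable.of_norm_bounded (hasSum_thermalWeight hβ).summable fun k => ?_
    rw [norm_smul, InnerProductSpace.norm_rankOne, e.orthonormal.1 k, Complex.norm_real,
      Real.norm_of_nonneg (thermalWeight_pos hβ k).le, mul_one, mul_one]
  have h2 := (ContinuousLinearMap.apply ℂ K y).hasSum h1.hasSum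
  refine (congrArg (HasSum · _) (funext fun k => ?_)).mp h2
  simp

omit [CompleteSpace S] in
theorem hasSum_rankOne_initialState [Nonempty ι] {J : Type*} (hβ : HasThermalState Hb β e ε)
    {ρs : S →L[ℂ] S} {v : J → S} (hv : HasSum (fun j => ‖v j‖ ^ 2) 1)
    (hρs : ∀ x, HasSum (fun j => inner ℂ (v j) x • v j) (ρs x)) :
    (Summable fun p : J × ι => ‖((√(thermalWeight β ε p.2) : ℝ) : ℂ) • tens (v p.1) (e p.2)‖ ^ 2) ∧
    HasSum (fun p : J × ι => InnerProductSpace.rankOne ℂ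
      (((√(thermalWeight β ε p.2) : ℝ) : ℂ) • tens (v p.1) (e p.2))
      (((√(thermalWeight β ε p.2) : ℝ) : ℂ) • tens (v p.1) (e p.2)))
      (opTensor ρs (thermalState β e ε)) := by
  have hw : ∀ k, √(thermalWeight β ε k) * √(thermalWeight β ε k) = thermalWeight β ε k := fun k =>
    Real.mul_self_sqrt (thermalWeight_pos hβ k).le
  have h1 : Summable fun p : J × ι =>
      ‖((√(thermalWeight β ε p.2) : ℝ) : ℂ) • tens (v p.1) (e p.2)‖ ^ 2 := by
    refine (hv.summable.mul_of_nonneg (hasSum_thermalWeight hβ).summable (fun _ => sq_nonneg _)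
      fun k => (thermalWeight_pos hβ k).le).congr fun p => ?_
    rw [norm_smul, norm_tens, e.orthonormal.1, Complex.norm_real,
      Real.norm_of_nonneg (Real.sqrt_nonneg _), mul_one, mul_pow,
      Real.sq_sqrt (thermalWeight_pos hβ _).le, mul_comm]
  refine ⟨h1, ?_⟩
  have h2 : Summable fun p : J × ι => InnerProductSpace.rankOne ℂ
      (((√(thermalWeight β ε p.2) : ℝ) : ℂ) • tens (v p.1) (e p.2))
      (((√(thermalWeight β ε p.2) : ℝ) : ℂ) • tens (v p.1) (e p.2)) :=
    Summable.of_norm_bounded h1 fun p => by rw [InnerProductSpace.norm_rankOne, sq]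
  refine (?_ : _ = opTensor ρs (thermalState β e ε)) ▸ h2.hasSum
  refine clm_ext_tens fun x y => ?_
  have h3 := (ContinuousLinearMap.apply ℂ (Joint S K) (tens x y)).hasSum h2.hasSum
  have h4 : ∀ j, HasSum (fun k => InnerProductSpace.rankOne ℂ
      (((√(thermalWeight β ε k) : ℝ) : ℂ) • tens (v j) (e k))
      (((√(thermalWeight β ε k) : ℝ) : ℂ) • tens (v j) (e k)) (tens x y))
      (tens (inner ℂ (v j) x • v j) (thermalState β e ε y)) := fun j => by
    have h5 := (tensL S K (inner ℂ (v j) x • v j)).hasSum (hasSum_thermalState_apply hβ y)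
    refine (congrArg (HasSum · _) (funext fun k => ?_)).mp h5
    rw [InnerProductSpace.rankOne_apply, inner_smul_left, inner_tens, map_smul, map_smul, map_smul,
      smul_apply, tensL_apply, Complex.conj_ofReal, smul_smul, smul_smul,
      smul_smul, show (thermalWeight β ε k : ℂ) = (√(thermalWeight β ε k) : ℝ) *
        (√(thermalWeight β ε k) : ℝ) by rw [← Complex.ofReal_mul, hw]]
    congr 1
    ring
  have h6 := h3.prod_fiberwise h4
  rw [opTensor_tens]
  exact h6.unique (((tensL S K).flip (thermalState β e ε y)).hasSum (hρs x))

theorem forwardEvolution_zero {E : Type*} [NormedAddCommGroup E] [NormedSpace ℂ E]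
    (G : ℝ → E →L[ℂ] E) (C : E →L[ℂ] E) (t : ℝ) (x : E) : forwardEvolution G C t x 0 = G t x := by
  rw [forwardEvolution, if_pos ⟨by simp, by simp⟩]
  simp [insertedEvolution]

/-- The initial state is a sum of rank-one operators indexed by pairs of a system vector and an
eigenvector of the bath. Summing over the latter first leaves one joint amplitude for each `v j`. -/
theorem hasSum_expectation [Nonempty ι] {J : Type*} (hU : IsEvolutionGroup H U)
    (hβ : HasThermalState Hb β e ε)
    {ρs : S →L[ℂ] S} {v : J → S} (hv : HasSum (fun j => ‖v j‖ ^ 2) 1)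
    (hρs : ∀ x, HasSum (fun j => inner ℂ (v j) x • v j) (ρs x)) (C Os : S →L[ℂ] S) :
    HasSum (fun j => jointAmplitude e β ε U C Os t (v j) 0)
      (expectation U (opTensor ρs (thermalState β e ε)) Os t) := by
  obtain ⟨h1, h2⟩ := hasSum_rankOne_initialState hβ hv hρs
  have h3 := hasSum_trace (A := opTensor Os 1 * U t) h1 h2 (U (-t))
  have hadj : ∀ φ, (U (-t)).adjoint φ = U t φ := fun φ => by
    refine ext_inner_right ℂ fun ψ => ?_
    rw [ContinuousLinearMap.adjoint_inner_left, hU.inner_apply_left]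
  refine (congrArg (HasSum · _) (funext fun j => ?_)).mp
    (h3.prod_fiberwise fun j => (h3.summable.prod_factor j).hasSum)
  refine tsum_congr fun k => ?_
  rw [fwd_zero, bwd_zero, forwardEvolution_zero, hadj, mul_apply_eq_comp, map_smul,
    map_smul, inner_smul_left, inner_smul_right, Complex.conj_ofReal, ← mul_assoc,
    ← Complex.ofReal_mul, Real.mul_self_sqrt (thermalWeight_pos hβ k).le]

end Expectation

end
end OpenQuantum

theorem mainTheorem1 {S K ι : Type*}
    [NormedAddCommGroup S] [InnerProductSpace ℂ S] [CompleteSpace S]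
    [NormedAddCommGroup K] [InnerProductSpace ℂ K] [CompleteSpace K]
    -- system: Hamiltonian, coupling operator, observable, initial state
    (Hs : S →ₗ.[ℂ] S) (Us : ℝ → S →L[ℂ] S) (hUs : IsEvolutionGroup Hs Us)
    (Ws : S →L[ℂ] S) (hWs : IsSelfAdjoint Ws) (Os : S →L[ℂ] S)
    (ρs : S →L[ℂ] S) (hρs : IsDensityOperator ρs)
    -- bath: Hamiltonian and thermal state
    (Hb : K →ₗ.[ℂ] K) (Ub : ℝ → K →L[ℂ] K) (hUb : IsEvolutionGroup Hb Ub)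
    (β : ℝ) (e : HilbertBasis ι ℂ K) (ε : ι → ℝ) (hβ : HasThermalState Hb β e ε)
    -- the two bath coupling operators and the two total Hamiltonians
    (Wb Wb' : K →ₗ.[ℂ] K) (hWb : IsSelfAdjoint Wb) (hWb' : IsSelfAdjoint Wb')
    (H H' : Joint S K →ₗ.[ℂ] Joint S K) (U U' : ℝ → Joint S K →L[ℂ] Joint S K)
    (hU : IsEvolutionGroup H U) (hU' : IsEvolutionGroup H' U')
    (hH : ExtendsTotalHamiltonian Hs Hb Wb Ws H)
    (hH' : ExtendsTotalHamiltonian Hs Hb Wb' Ws H')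
    -- Wick's theorem and bounded bath correlations for both baths
    (t : ℝ) (ht : 0 ≤ t)
    (hdef : BathFunctionalDefined e β ε Ub Wb t) (hdef' : BathFunctionalDefined e β ε Ub Wb' t)
    (hWick : WickTheorem e β ε Ub Wb t) (hWick' : WickTheorem e β ε Ub Wb' t)
    (hB : BoundedCorrelation e β ε Ub Wb t) (hB' : BoundedCorrelation e β ε Ub Wb' t) :
    ‖expectation U' (opTensor ρs (thermalState β e ε)) Os t
        - expectation U (opTensor ρs (thermalState β e ε)) Os t‖
      ≤ ‖Os‖ * (Real.exp (‖Ws‖ ^ 2 * ∫ s₂ in (0 : ℝ)..(2 * t), ∫ s₁ in (0 : ℝ)..s₂,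
          ‖bathCorrelation e β ε Ub Wb' t s₁ s₂ - bathCorrelation e β ε Ub Wb t s₁ s₂‖) - 1) := by
  -- If the basis is empty, the bath space is zero, the thermal weights do not sum to one, and both
  -- expectations agree trivially.
  cases isEmpty_or_nonempty ι with
  | inl hι =>
    have hK : ∀ y : K, y = 0 := fun y => by
      have h1 := e.hasSum_repr y
      exact h1.unique hasSum_empty
    have hJ : ∀ A B : Joint S K →L[ℂ] Joint S K, A = B := fun A B =>
      clm_ext_tens fun x y => by rw [hK y, ← tensL_apply, map_zero, map_zero, map_zero]
    rw [expectation, expectation, hJ (_ * U' (-t)) (opTensor Os 1 * U t *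
      opTensor ρs (thermalState β e ε) * U (-t)), sub_self, norm_zero]
    refine mul_nonneg (norm_nonneg _) (sub_nonneg.2 (Real.one_le_exp ?_))
    exact mul_nonneg (sq_nonneg _) (intervalIntegral.integral_nonneg (by linarith) fun s hs =>
      intervalIntegral.integral_nonneg hs.1 fun _ _ => norm_nonneg _)
  | inr hι =>
    -- At `t = 0` there is no evolution and the difference vanishes; the contour argument needs `0 <
    -- t`.
    rcases ht.eq_or_lt with rfl | ht
    · simp [expectation, hU.zero, hU'.zero]
    obtain ⟨v, hv, hvρ⟩ := hρs.exists_hasSum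
    have h1 := (hasSum_expectation (t := t) hU' hβ hv hvρ (-Complex.I • Ws) Os).sub
      (hasSum_expectation (t := t) hU hβ hv hvρ (-Complex.I • Ws) Os)
    have h2 := hv.mul_left (‖Os‖ * (Real.exp (‖Ws‖ ^ 2 * ∫ s₂ in (0 : ℝ)..(2 * t),
      ∫ s₁ in (0 : ℝ)..s₂, ‖bathCorrelation e β ε Ub Wb' t s₁ s₂ -
        bathCorrelation e β ε Ub Wb t s₁ s₂‖) - 1))
    rw [mul_one] at h2
    rw [← h1.tsum_eq]
    exact tsum_of_norm_bounded h2 fun j => norm_jointAmplitude_sub_le hU hU' hβ hUs hUb hWb hWb'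
      hH hH' hdef hdef' hWick hWick' ht hB hB' Os (v j)
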